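/- **Setting.** Let $N,d\ge 1$, let $(\Omega,\mathcal G,\mathbb P)$ be a complete probability space and let $X=(X_t,\ t\in\mathbb R_+^N)$ be an $\mathbb R^d$-valued centered Gaussian process with continuous paths and independent coordinate processes $X^1,\dots,X^d$ having a common covariance function $\sigma(s,t)=\mathbb E[X^i_sX^i_t]$. Write $\sigma^2(t)=\sigma(t,t)$ and $\rho(s,t)=\sigma(s,t)/(\sigma(s)\sigma(t))$. All norms are Euclidean; $s\le t$ is the coordinatewise order, $s<t$ means $s\le t$ and $s\ne t$, and $s\wedge t$ is the coordinatewise minimum. Let $\alpha\in(0,1)$ and $\gamma\ge\alpha$. *Hypothesis A1.* For all $0<a<b<\infty$ there are positive finite constants $\delta,\varepsilon,C_1,\dots,C_5$ such that for all $s,t\in[a,b]^N$: $C_1\le\sigma^2(t)\le C_2$; $\left|1-\frac{\sigma(s,t)}{\sigma^2(s)}\right|\le C_3\|t-s\|^{\gamma}$ if $\|t-s\|\le\delta$; $C_4\|t-s\|^{2\alpha}\le 1-\rho^2(s,t)\le C_5\|t-s\|^{2\alpha}$ if $\|t-s\|\le\delta$; $|\rho(s,t)|<1-\varepsilon$ if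 $\|t-s\|>\delta$. *Filtrations.* A commuting filtration is an increasing family $(\mathcal F_t,\ t\in\mathbb R_+^N)$ of sub-$\sigma$-fields of $\mathcal G$ such that $\mathcal F_0$ contains all null sets of $\mathcal G$, $\mathcal F_t=\bigcap_{s>t}\mathcal F_s$ for all $t$, and $\mathbb E[Y\mid\mathcal F_s]=\mathbb E[Y\mid\mathcal F_{s\wedge t}]$ a.s. for all $s,t$ and all bounded $\mathcal F_t$-measurable $Y$. It is called Gaussian relative to $X$ if every $\mathcal F_s$ is generated, up to null sets, by a family of real random variables that is jointly Gaussian with $X$ (for example, the completed natural filtration of $X$, or that of a Gaussian noise of which $X$ is a linear functional). *Hypothesis A2.* For all $0<a<b<\infty$ and $M>0$ there are positive finite constants $C_6,C_7,C_8$ such that for all $s,t\in[a,b]^N$ with $s\le t$: $\mathbb 1_{\{\|X_s\|\le M\}}\,\big\|\mathbb E[X_t-X_s\mid\mathcal F_s]\big\|\le C_6\|t-s\|^{\gamma}$ a.s.; $C_7\|t-s\|^{2\alpha}\le \mathbb E\Big[\big\|(X_t-X_s)-\mathbb E[X_t-X_s\mid\mathcal F_s]\big\|^2\Big]\le C_8\|t-s\|^{2\alpha}$.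 *Capacity.* Fix $M>0$. For $0\le\beta<d$ let $k_\beta(x)=\|x\|^{-\beta}$ if $\beta>0$ and $k_0(x)=\ln(3M/\|x\|)$, with $k_\beta(0)=+\infty$. For compact $A\subset\{\|x\|<M\}$ let $$\mathrm{Cap}_\beta(A)=\Big(\inf_{\mu}\iint k_\beta(x-y)\,\mu(dx)\,\mu(dy)\Big)^{-1},$$ the infimum being over all probability measures $\mu$ on $\mathbb R^d$ supported in $A$ (with $\inf\emptyset=\infty$, $1/\infty=0$). For $\beta<0$ let $\mathrm{Cap}_\beta(A)=1$. **Theorem 3.1.** Assume that Hypothesis A1 holds for $\alpha\in(0,1)$ and $\gamma\ge\alpha$, and that $N/\alpha\ge 2$. (a) For all $0<a<b<\infty$ and $M>0$ there is a finite positive constant $K_1$ such that for all nonempty compact sets $A\subset\{x\in\mathbb R^d:\|x\|<M\}$, $$K_1\,\mathrm{Cap}_{d-N/\alpha}(A)\le\mathbb P\{\exists\, t\in[a,b]^N: X_t\in A\}.$$ (b) Suppose in addition that $X$ is adapted to a commuting filtration that is Gaussian relative to $X$, and that Hypothesis A2 holds for the same $\alpha,\gamma$. Then for all $0<a<b<\infty$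 and $M>0$ there is a finite positive constant $K_2$ such that for all compact sets $A\subset\{x\in\mathbb R^d:\|x\|<M\}$, $$\mathbb P\{\exists\, t\in[a,b]^N: X_t\in A\}\le K_2\,\mathrm{Cap}_{d-N/\alpha}(A).$$ -/

import Mathlib

open MeasureTheory ProbabilityTheory Set
open scoped NNReal ENNReal

noncomputable section

namespace GaussianHitting

/-- The parameter set `ℝ₊^N`, with the coordinatewise order (so `s < t` means `s ≤ t` and
`s ≠ t`, and `s ⊓ t` is the coordinatewise minimum). -/
abbrev Param (N : ℕ) : Type := Fin N → ℝ≥0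

/-- The Euclidean distance `‖t - s‖` on the parameter set. -/
def paramDist {N : ℕ} (s t : Param N) : ℝ := √(∑ i, ((t i : ℝ) - (s i : ℝ)) ^ 2)

/-- The cube `[a, b]^N`. -/
def cube (N : ℕ) (a b : ℝ≥0) : Set (Param N) := {t | ∀ i, a ≤ t i ∧ t i ≤ b}

section Capacity

variable {E : Type*} [MeasurableSpace E]

/-- The `k` energy of a measure. -/
def energy [Sub E] (k : E → ℝ≥0∞) (μ : Measure E) : ℝ≥0∞ :=
  ∫⁻ x, ∫⁻ y, k (x - y) ∂μ ∂μ

/-- The `k` capacity of a closed set `A`: the inverse of the infimum of the energies of the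
probability measures carried by `A` (with `1 / ∞ = 0`, and infimum `∞` if there are none). -/
def capacity [Sub E] (k : E → ℝ≥0∞) (A : Set E) : ℝ≥0∞ :=
  (⨅ (μ : Measure E) (_ : IsProbabilityMeasure μ) (_ : μ Aᶜ = 0), energy k μ)⁻¹

end Capacity

/-- The Newtonian `β` kernel on `ℝ^d` for `0 ≤ β`: `‖x‖ ^ (-β)` if `β > 0` and `log (3 M / ‖x‖)` if
`β = 0`, with its limit value `∞` at the origin. The logarithm is nonnegative for `‖x‖ ≤ 3 M`; only
the values for `‖x‖ < 2 M` enter the capacity of a subset of the ball of radius `M`. -/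
def newtonKernel {d : ℕ} (M β : ℝ) (x : EuclideanSpace ℝ (Fin d)) : ℝ≥0∞ :=
  if x = 0 then ∞
  else if β = 0 then ENNReal.ofReal (Real.log (3 * M / ‖x‖))
  else ENNReal.ofReal (‖x‖ ^ (-β))

/-- The capacity `Cap_β`; it is `1` for `β < 0`. -/
def newtonCap {d : ℕ} (M β : ℝ) (A : Set (EuclideanSpace ℝ (Fin d))) : ℝ≥0∞ :=
  if β < 0 then 1 else capacity (newtonKernel M β) A

section Field

variable {Ω : Type*} [mΩ : MeasurableSpace Ω] {N d : ℕ}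

/-- `X` is a continuous centered Gaussian process with independent coordinate processes, each of
which has the covariance function `σ`. -/
structure IsCenteredGaussianField (P : Measure Ω)
    (X : Param N → Ω → EuclideanSpace ℝ (Fin d)) (σ : Param N → Param N → ℝ) : Prop where
  continuous_paths : ∀ ω, Continuous fun t => X t ω
  gaussian : IsGaussianProcess X P
  centered : ∀ t i, ∫ ω, X t ω i ∂P = 0
  indep_coord : iIndepFun (fun (i : Fin d) (ω : Ω) (t : Param N) => X t ω i) P
  covariance : ∀ i s t, ∫ ω, X s ω i * X t ω i ∂P = σ s t

/-- The correlation function of the covariance function `σ`. -/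
def correlation (σ : Param N → Param N → ℝ) (s t : Param N) : ℝ :=
  σ s t / (√(σ t t) * √(σ s s))

/-- The condition on the covariance function (variance bounds, conditional mean given `X_s` of order
`‖t - s‖ ^ γ`, conditional variance of order `‖t - s‖ ^ (2 α)`, nondegeneracy). -/
def HypA1 (σ : Param N → Param N → ℝ) (α γ : ℝ) : Prop :=
  ∀ a b : ℝ≥0, 0 < a → a < b →
    ∃ δ ε C₁ C₂ C₃ C₄ C₅ : ℝ, 0 < δ ∧ 0 < ε ∧ 0 < C₁ ∧ 0 < C₂ ∧ 0 < C₃ ∧ 0 < C₄ ∧ 0 < C₅ ∧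
      ∀ s ∈ cube N a b, ∀ t ∈ cube N a b,
        (C₁ ≤ σ t t ∧ σ t t ≤ C₂) ∧
        (paramDist s t ≤ δ → |1 - σ s t / σ s s| ≤ C₃ * paramDist s t ^ γ) ∧
        (paramDist s t ≤ δ →
          C₄ * paramDist s t ^ (2 * α) ≤ 1 - correlation σ s t ^ 2 ∧
          1 - correlation σ s t ^ 2 ≤ C₅ * paramDist s t ^ (2 * α)) ∧
        (δ < paramDist s t → |correlation σ s t| < 1 - ε)

/-- A complete, right continuous, commuting filtration. -/
structure IsCommutingFiltration (P : Measure Ω) (𝓕 : Filtration (Param N) mΩ) : Prop where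
  complete : ∀ S : Set Ω, P S = 0 → MeasurableSet[𝓕 0] S
  right_continuous : ∀ t, (𝓕 t : MeasurableSpace Ω) = ⨅ s, ⨅ _ : t < s, (𝓕 s : MeasurableSpace Ω)
  commuting : ∀ (s t : Param N) (Y : Ω → ℝ), Measurable[𝓕 t] Y → (∃ C : ℝ, ∀ ω, |Y ω| ≤ C) →
    P[Y | 𝓕 s] =ᵐ[P] P[Y | 𝓕 (s ⊓ t)]

/-- The filtration `𝓕` is Gaussian relative to `X`: every `𝓕 s` is generated, up to null sets, by a
family `H` of real random variables that is jointly Gaussian with the process `X`. The natural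
filtration of `X` and that of a Gaussian noise of which `X` is a linear functional are examples. -/
def IsGaussianFiltration (P : Measure Ω) (X : Param N → Ω → EuclideanSpace ℝ (Fin d))
    (𝓕 : Filtration (Param N) mΩ) : Prop :=
  ∀ s : Param N, ∃ H : Set (Ω → ℝ),
    IsGaussianProcess
      (Sum.elim (fun (p : Param N × Fin d) (ω : Ω) => X p.1 ω p.2) (fun h : H => (h : Ω → ℝ))) P ∧
    (∀ h ∈ H, Measurable[𝓕 s] h) ∧
    ∀ S : Set Ω, MeasurableSet[𝓕 s] S →
      ∃ S' : Set Ω,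
        MeasurableSet[⨆ h : H, MeasurableSpace.comap (h : Ω → ℝ) inferInstance] S' ∧ S =ᵐ[P] S'

/-- The condition on the conditional mean and the conditional variance of the increments. -/
def HypA2 (P : Measure Ω) (X : Param N → Ω → EuclideanSpace ℝ (Fin d))
    (𝓕 : Filtration (Param N) mΩ) (α γ : ℝ) : Prop :=
  ∀ a b : ℝ≥0, 0 < a → a < b → ∀ M : ℝ, 0 < M →
    ∃ C₆ C₇ C₈ : ℝ, 0 < C₆ ∧ 0 < C₇ ∧ 0 < C₈ ∧
      ∀ s ∈ cube N a b, ∀ t ∈ cube N a b, s ≤ t →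
        (∀ᵐ ω ∂P, ‖X s ω‖ ≤ M →
          ‖(P[fun ω' => X t ω' - X s ω' | 𝓕 s]) ω‖ ≤ C₆ * paramDist s t ^ γ) ∧
        C₇ * paramDist s t ^ (2 * α) ≤
          ∫ ω, ‖(X t ω - X s ω) - (P[fun ω' => X t ω' - X s ω' | 𝓕 s]) ω‖ ^ 2 ∂P ∧
        ∫ ω, ‖(X t ω - X s ω) - (P[fun ω' => X t ω' - X s ω' | 𝓕 s]) ω‖ ^ 2 ∂P ≤
          C₈ * paramDist s t ^ (2 * α)

/-- The probability that `X` hits `A` during `[a, b]^N`. -/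
def hitProb (P : Measure Ω) (X : Param N → Ω → EuclideanSpace ℝ (Fin d)) (a b : ℝ≥0)
    (A : Set (EuclideanSpace ℝ (Fin d))) : ℝ≥0∞ :=
  P {ω | ∃ t ∈ cube N a b, X t ω ∈ A}

end Field

end GaussianHitting

end

/-! Both bounds rest on the occupation functional J_ε = ∫ dt ∫ μ(dx) 1{X_t lies in the box of half
side ε around x}, where t runs over a cube and μ is a probability measure on A.

Lower bound. The mean of J_ε is at least of order ε^d. For the second moment, write X_t as a
multiple of X_s plus an independent Gaussian residual whose standard deviation is of order ‖t -
s‖^α. This gives the two-point estimate `exists_measure_box_box_le`: a product of boxes has mass at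
most of order ε^(2d) max(‖x - y‖, ε, ‖t - s‖^α)^(-d). Times within distance r of s have volume of
order r^N, so integration over t turns the last factor into the kernel of index d - N/α truncated at
ε (`lintegral_max_rpow_le`). Hence E[J_ε²] is at most of order ε^(2d) times the energy of μ, and the
Paley–Zygmund inequality bounds P(J_ε ≠ 0) below by a constant over the energy. If J_ε ≠ 0, the path
comes within dε of A; continuity and compactness allow ε → 0.

Upper bound. Take μ to be the law of a point of A that X visits, conditioned on a visit, and let U
be the truncated potential of μ. There is no first hitting time for several parameters, so a maximal
inequality replaces stopping. For fixed s, the conditional mean of J_ε (over a slightly larger cube)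
given the past is at least of order ε^d U(X_s). For this the conditional law of X_t given 𝓕_s must
depend on X_s only: the residual of X_t on X_s is uncorrelated with the past, since otherwise the
conditional mean of the increment could not be bounded while X_s is bounded
(`covariance_residual_eq_zero`), and joint Gaussianity upgrades this to independence. Cairoli's
inequality then bounds the mean of the supremum over s of the squared conditional means by 4^(N+1)
E[J_ε²]. Evaluated where A is hit, this reads P(hit) ∫ U² dμ ≤ const · I, where I = ∫ U dμ is the
truncated energy. As ∫ U² dμ ≥ I², it follows that P(hit) · I ≤ const, and Fatou's lemma removes the
truncation. -/

namespace GaussianHitting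

/-! ### Volume of cubes and balls in the parameter set, and the radial kernel. -/

/-- Lebesgue measure on the half line. -/
noncomputable def halfLineVolume : Measure ℝ≥0 := Measure.comap ((↑) : ℝ≥0 → ℝ) volume

lemma measurableEmbedding_nnreal_coe : MeasurableEmbedding ((↑) : ℝ≥0 → ℝ) :=
  NNReal.isClosedEmbedding_coe.measurableEmbedding

lemma halfLineVolume_Icc (a b : ℝ≥0) : halfLineVolume (Icc a b) = ENNReal.ofReal (b - a) := by
  rw [halfLineVolume, measurableEmbedding_nnreal_coe.comap_apply]
  have : ((↑) : ℝ≥0 → ℝ) '' Icc a b = Icc (a : ℝ) b := by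
    ext x
    constructor
    · rintro ⟨y, ⟨h1, h2⟩, rfl⟩
      exact ⟨by exact_mod_cast h1, by exact_mod_cast h2⟩
    · rintro ⟨h1, h2⟩
      exact ⟨⟨x, a.2.trans h1⟩, ⟨h1, h2⟩, rfl⟩
  rw [this, Real.volume_Icc]

lemma halfLineVolume_Ico (a b : ℝ≥0) : halfLineVolume (Ico a b) = ENNReal.ofReal (b - a) := by
  rw [halfLineVolume, measurableEmbedding_nnreal_coe.comap_apply]
  have : ((↑) : ℝ≥0 → ℝ) '' Ico a b = Ico (a : ℝ) b := by
    ext x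
    constructor
    · rintro ⟨y, ⟨h1, h2⟩, rfl⟩
      exact ⟨by exact_mod_cast h1, by exact_mod_cast h2⟩
    · rintro ⟨h1, h2⟩
      exact ⟨⟨x, a.2.trans h1⟩, ⟨h1, h2⟩, rfl⟩
  rw [this, Real.volume_Ico]

lemma halfLineVolume_closedBall_le (a : ℝ≥0) (r : ℝ) :
    halfLineVolume (Metric.closedBall a r) ≤ ENNReal.ofReal (2 * r) := by
  rw [halfLineVolume, measurableEmbedding_nnreal_coe.comap_apply]
  have : ((↑) : ℝ≥0 → ℝ) '' Metric.closedBall a r ⊆ Metric.closedBall (a : ℝ) r := by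
    rintro _ ⟨y, h, rfl⟩
    exact h
  exact (measure_mono this).trans (Real.volume_closedBall _ _).le

instance : SigmaFinite halfLineVolume := by
  refine ⟨⟨⟨fun n => Icc 0 n, fun _ => trivial, fun n => ?_, ?_⟩⟩⟩
  · rw [halfLineVolume_Icc]; exact ENNReal.ofReal_lt_top
  · ext x
    simp only [mem_iUnion, mem_Icc, zero_le, true_and, mem_univ, iff_true]
    exact exists_nat_ge x

/-- Lebesgue measure on the parameter set. -/
noncomputable def paramVolume (N : ℕ) : Measure (Param N) := Measure.pi fun _ => halfLineVolume

instance (N : ℕ) : SigmaFinite (paramVolume N) := by unfold paramVolume; infer_instance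

/-- The half-open cube with lower corner `s` and side `r`. -/
def cornerCube {N : ℕ} (s : Param N) (r : ℝ≥0) : Set (Param N) :=
  univ.pi fun i => Ico (s i) (s i + r)

lemma measurableSet_cornerCube {N : ℕ} (s : Param N) (r : ℝ≥0) :
    MeasurableSet (cornerCube s r) :=
  MeasurableSet.univ_pi fun _ => measurableSet_Ico

lemma paramVolume_cornerCube {N : ℕ} (s : Param N) (r : ℝ≥0) :
    paramVolume N (cornerCube s r) = ENNReal.ofReal ((r : ℝ) ^ N) := by
  rw [paramVolume, cornerCube, Measure.pi_pi]
  simp [halfLineVolume_Ico, ENNReal.ofReal_pow]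

lemma dist_lt_of_mem_cornerCube {N : ℕ} {s t : Param N} {r : ℝ≥0} (hr : 0 < r)
    (h : t ∈ cornerCube s r) : dist s t < r := by
  rw [dist_pi_lt_iff (by exact_mod_cast hr)]
  intro i
  have h' := h i (mem_univ i)
  rw [NNReal.dist_eq, abs_sub_comm, abs_lt]
  have h1 : (s i : ℝ) ≤ t i := by exact_mod_cast h'.1
  have h2 : (t i : ℝ) < s i + r := by exact_mod_cast h'.2
  have : (0 : ℝ) < r := by exact_mod_cast hr
  constructor <;> linarith

lemma le_dist_of_notMem_cornerCube {N : ℕ} {s t : Param N} {r : ℝ≥0} (hst : s ≤ t)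
    (h : t ∉ cornerCube s r) : (r : ℝ) ≤ dist s t := by
  simp only [cornerCube, mem_univ_pi, not_forall, mem_Ico, not_and, not_lt] at h
  obtain ⟨i, hi⟩ := h
  have h2 : (s i : ℝ) + r ≤ t i := by exact_mod_cast hi (hst i)
  refine le_trans ?_ (dist_le_pi_dist s t i)
  rw [NNReal.dist_eq, abs_sub_comm]
  exact le_trans (by linarith) (le_abs_self _)

lemma cornerCube_mono {N : ℕ} (s : Param N) {r r' : ℝ≥0} (h : r ≤ r') :
    cornerCube s r ⊆ cornerCube s r' := fun _ ht i hi =>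
  ⟨(ht i hi).1, (ht i hi).2.trans_le (by gcongr)⟩

lemma le_of_mem_cornerCube {N : ℕ} {s t : Param N} {r : ℝ≥0} (h : t ∈ cornerCube s r) : s ≤ t :=
  fun i => (h i (mem_univ i)).1

lemma paramVolume_closedBall_le {N : ℕ} (s : Param N) {r : ℝ} (hr : 0 ≤ r) :
    paramVolume N (Metric.closedBall s r) ≤ ENNReal.ofReal ((2 * r) ^ N) := by
  rw [paramVolume, closedBall_pi s hr, Measure.pi_pi, ENNReal.ofReal_pow (by positivity)]
  calc ∏ i, halfLineVolume (Metric.closedBall (s i) r)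
      ≤ ∏ _i : Fin N, ENNReal.ofReal (2 * r) :=
        Finset.prod_le_prod' fun i _ => halfLineVolume_closedBall_le _ _
    _ = _ := by simp

lemma cube_eq_pi (N : ℕ) (a b : ℝ≥0) : cube N a b = univ.pi fun _ => Icc a b := by
  ext; simp only [cube, mem_ofPred_eq, mem_univ_pi, mem_Icc]

lemma measurableSet_cube (N : ℕ) (a b : ℝ≥0) : MeasurableSet (cube N a b) := by
  rw [cube_eq_pi]; exact MeasurableSet.univ_pi fun _ => measurableSet_Icc

lemma isCompact_cube (N : ℕ) (a b : ℝ≥0) : IsCompact (cube N a b) := by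
  rw [cube_eq_pi]; exact isCompact_univ_pi fun _ => isCompact_Icc

lemma paramVolume_cube (N : ℕ) (a b : ℝ≥0) :
    paramVolume N (cube N a b) = ENNReal.ofReal (b - a) ^ N := by
  rw [paramVolume, cube_eq_pi, Measure.pi_pi]
  simp [halfLineVolume_Icc]

lemma paramVolume_cube_lt_top (N : ℕ) (a b : ℝ≥0) : paramVolume N (cube N a b) < ∞ := by
  rw [paramVolume_cube]; exact ENNReal.pow_lt_top ENNReal.ofReal_lt_top

lemma paramVolume_cube_pos (N : ℕ) {a b : ℝ≥0} (h : a < b) : 0 < paramVolume N (cube N a b) := by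
  rw [paramVolume_cube]
  exact ENNReal.pow_pos (by simpa using h) _

lemma cornerCube_subset_cube {N : ℕ} {a b : ℝ≥0} {s : Param N} (hs : s ∈ cube N a b) {r : ℝ≥0} :
    cornerCube s r ⊆ cube N a (b + r) := fun _ ht i =>
  ⟨(hs i).1.trans (ht i (mem_univ i)).1,
    (ht i (mem_univ i)).2.le.trans (by gcongr; exact (hs i).2)⟩

/-- The radial profile of the Newtonian `β` kernel (and `1` for `β < 0`). -/
noncomputable def potential (M β u : ℝ) : ℝ :=
  if β < 0 then 1 else if β = 0 then Real.log (3 * M / u) else u ^ (-β)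

lemma potential_anti {M β u v : ℝ} (hu : 0 < u) (huv : u ≤ v) (hM : 0 < M) :
    potential M β v ≤ potential M β u := by
  unfold potential
  split_ifs with h1 h2
  · exact le_rfl
  · have : 0 < v := hu.trans_le huv
    exact Real.log_le_log (by positivity) (by gcongr)
  · exact Real.rpow_le_rpow_of_nonpos hu huv (by linarith)

end GaussianHitting

/-! ### Time integrals of ‖t - s‖^(-αd) and the kernel of index d - N/α. -/

namespace GaussianHitting

lemma measure_superlevel_le {N : ℕ} {α δ : ℝ} (hα : 0 < α) (hδ : 0 < δ) (s : Param N) {u l : ℝ}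
    (hu : 0 < u) (hl : 0 < l) :
    paramVolume N {t | l < max u (dist s t ^ α) ^ (-δ)} ≤
      ENNReal.ofReal (2 ^ N * l ^ (-((N : ℝ) / α / δ))) := by
  have hsub : {t | l < max u (dist s t ^ α) ^ (-δ)} ⊆
      Metric.closedBall s (l ^ (-(1 / (α * δ)))) := by
    intro t ht
    simp only [mem_ofPred_eq] at ht
    have hm : 0 < max u (dist s t ^ α) := lt_max_of_lt_left hu
    rw [Metric.mem_closedBall, dist_comm]
    have h1 : dist s t ≤ (max u (dist s t ^ α)) ^ (1 / α) := by
      calc dist s t = (dist s t ^ α) ^ (1 / α) := by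
            rw [← Real.rpow_mul dist_nonneg, mul_one_div_cancel hα.ne', Real.rpow_one]
        _ ≤ _ := Real.rpow_le_rpow (Real.rpow_nonneg dist_nonneg _) (le_max_right _ _)
            (by positivity)
    refine h1.trans ?_
    have h2 : (max u (dist s t ^ α)) ^ (1 / α) =
        ((max u (dist s t ^ α)) ^ (-δ)) ^ (-(1 / (α * δ))) := by
      rw [← Real.rpow_mul hm.le]; congr 1; field_simp
    rw [h2]
    exact Real.rpow_le_rpow_of_nonpos hl ht.le (by
      have : 0 < 1 / (α * δ) := by positivity
      linarith)
  refine (measure_mono hsub).trans ((paramVolume_closedBall_le s (by positivity)).trans_eq ?_)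
  rw [mul_pow, ← Real.rpow_natCast (l ^ _), ← Real.rpow_mul hl.le]
  congr 3
  field_simp

/-- Layer cake, cut at the level `l₀`. Below `l₀` a superlevel set has at most the volume of the
cube; above, it lies in a ball; from `u ^ (-δ)` on, it is empty. The sign of d - N/α decides which
`l₀` is useful. -/
lemma lintegral_layercake_le {N : ℕ} {α δ : ℝ} (hα : 0 < α) (hδ : 0 < δ) (a b : ℝ≥0)
    (s : Param N) {u : ℝ} (hu : 0 < u) {l₀ : ℝ} (hl₀ : 0 ≤ l₀) :
    ∫⁻ t in cube N a b, ENNReal.ofReal (max u (dist s t ^ α) ^ (-δ)) ∂paramVolume N ≤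
      ENNReal.ofReal l₀ * paramVolume N (cube N a b) +
        ∫⁻ l in Ioi l₀, (Iio (u ^ (-δ))).indicator
          (fun l => ENNReal.ofReal (2 ^ N * l ^ (-((N : ℝ) / α / δ)))) l := by
  have hmeas : Measurable fun t : Param N => max u (dist s t ^ α) ^ (-δ) := by fun_prop
  rw [lintegral_eq_lintegral_meas_lt _ (Filter.Eventually.of_forall fun t => by
    simp only [Pi.zero_apply]; positivity) hmeas.aemeasurable]
  rw [← Ioc_union_Ioi_eq_Ioi hl₀]
  refine (lintegral_union_le _ _ _).trans (add_le_add ?_ ?_)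
  · calc _ ≤ ∫⁻ _ in Ioc 0 l₀, paramVolume N (cube N a b) :=
          lintegral_mono fun l => (measure_mono (subset_univ _)).trans
            (by rw [Measure.restrict_apply_univ])
      _ = _ := by rw [lintegral_const, Measure.restrict_apply_univ, Real.volume_Ioc, mul_comm]; simp
  · refine setLIntegral_mono' measurableSet_Ioi fun l hl => ?_
    have hl' : 0 < l := hl₀.trans_lt hl
    by_cases hlu : l < u ^ (-δ)
    · rw [indicator_of_mem (by exact hlu)]
      exact (Measure.restrict_apply_le _ _).trans (measure_superlevel_le hα hδ s hu hl')
    · rw [indicator_of_notMem (by simpa using hlu)]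
      have : {t | l < max u (dist s t ^ α) ^ (-δ)} = ∅ := by
        ext t
        simp only [mem_ofPred_eq, mem_empty_iff_false, iff_false, not_lt]
        exact (Real.rpow_le_rpow_of_nonpos hu (le_max_left _ _) (by linarith)).trans
          (not_lt.1 hlu)
      rw [this]; simp

lemma lintegral_indicator_Iio_rpow {l₀ l₁ q c : ℝ} (hl₀ : 0 ≤ l₀) (h01 : l₀ ≤ l₁) (hc : 0 ≤ c)
    (hq : q < 1 ∨ 0 < l₀) :
    ∫⁻ l in Ioi l₀, (Iio l₁).indicator (fun l => ENNReal.ofReal (c * l ^ (-q))) l =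
      ENNReal.ofReal (c * ∫ l in l₀..l₁, l ^ (-q)) := by
  rw [lintegral_indicator measurableSet_Iio, Measure.restrict_restrict measurableSet_Iio,
    inter_comm, Ioi_inter_Iio, restrict_Ioo_eq_restrict_Ioc,
    ← intervalIntegral.integral_const_mul, intervalIntegral.integral_of_le h01]
  have hint : IntervalIntegrable (fun l : ℝ => l ^ (-q)) volume l₀ l₁ := by
    rcases hq with hq | hq
    · exact intervalIntegral.intervalIntegrable_rpow' (by linarith)
    · exact intervalIntegral.intervalIntegrable_rpow (Or.inr (by
        rw [uIcc_of_le h01]; exact fun h => absurd h.1 (not_le.2 hq)))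
  rw [ofReal_integral_eq_lintegral_ofReal]
  · exact ((intervalIntegrable_iff_integrableOn_Ioc_of_le h01).1 hint).const_mul c
  · refine (ae_restrict_iff' measurableSet_Ioc).2 (Filter.Eventually.of_forall fun l hl => ?_)
    have : 0 ≤ l := hl₀.trans hl.1.le
    simp only [Pi.zero_apply]; positivity

/-- The occupation bound for the time integral of `‖t - s‖ ^ (-α d)` regularised at level `u`. -/
lemma lintegral_max_rpow_le {N d : ℕ} (hN : 0 < N) (hd : 0 < d) {α M : ℝ} (hα : 0 < α)
    (hM : 0 < M) (a b : ℝ≥0) :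
    ∃ C : ℝ, 0 < C ∧ ∀ (s : Param N) (u : ℝ), 0 < u → u ≤ 2 * M →
      ∫⁻ t in cube N a b, ENNReal.ofReal (max u (dist s t ^ α) ^ (-(d : ℝ))) ∂paramVolume N ≤
        ENNReal.ofReal (C * potential M ((d : ℝ) - N / α) u) := by
  have hd' : (0 : ℝ) < d := by exact_mod_cast hd
  have hN' : (0 : ℝ) < N := by exact_mod_cast hN
  set V : ℝ := (paramVolume N (cube N a b)).toReal with hV
  have hVV : paramVolume N (cube N a b) = ENNReal.ofReal V :=
    (ENNReal.ofReal_toReal (paramVolume_cube_lt_top N a b).ne).symm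
  have hV0 : 0 ≤ V := ENNReal.toReal_nonneg
  set q : ℝ := (N : ℝ) / α / d with hq
  rcases lt_trichotomy ((d : ℝ) - N / α) 0 with hβ | hβ | hβ
  -- Here `l ^ (-q)` is integrable at infinity, so cutting at level `1` gives a bound free of `u`.
  · have hq1 : 1 < q := by rw [hq, lt_div_iff₀ hd']; linarith
    have hint : 0 ≤ 2 ^ N * ∫ l in Ioi (1 : ℝ), l ^ (-q) := by
      refine mul_nonneg (by positivity) (setIntegral_nonneg measurableSet_Ioi fun l hl => ?_)
      exact Real.rpow_nonneg (zero_le_one.trans (le_of_lt hl)) _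
    refine ⟨V + 2 ^ N * (∫ l in Ioi (1 : ℝ), l ^ (-q)) + 1, by positivity, fun s u hu huM => ?_⟩
    refine (lintegral_layercake_le hα hd' a b s hu zero_le_one).trans ?_
    rw [potential, if_pos hβ, hVV, ← ENNReal.ofReal_mul zero_le_one, one_mul, mul_one]
    refine le_trans (add_le_add_right (lintegral_mono (indicator_le_self _ _)) _) ?_
    have : ∫⁻ l in Ioi (1 : ℝ), ENNReal.ofReal (2 ^ N * l ^ (-q)) =
        ENNReal.ofReal (2 ^ N * ∫ l in Ioi (1 : ℝ), l ^ (-q)) := by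
      rw [← integral_const_mul, ofReal_integral_eq_lintegral_ofReal]
      · exact (integrableOn_Ioi_rpow_of_lt (by linarith) one_pos).const_mul _
      · refine (ae_restrict_iff' measurableSet_Ioi).2 (Filter.Eventually.of_forall fun l hl => ?_)
        have : (0 : ℝ) ≤ l := zero_le_one.trans (le_of_lt hl)
        simp only [Pi.zero_apply]; positivity
    rw [this, ← ENNReal.ofReal_add hV0 hint]
    exact ENNReal.ofReal_le_ofReal (by linarith)
  -- Critical case: with the cut at `(3 * M) ^ (-d)` the integral of `1 / l` is exactly `d * log (3
  -- * M / u)`. The part below the cut is absorbed because `u ≤ 2 * M` keeps the logarithm above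
  -- `log (3 / 2)`.
  · have hq1 : q = 1 := by rw [hq, div_eq_one_iff_eq hd'.ne']; linarith
    have hlog : 0 < Real.log (3 / 2) := Real.log_pos (by norm_num)
    set l₀ : ℝ := (3 * M) ^ (-(d : ℝ)) with hl₀
    have hl₀' : 0 < l₀ := by positivity
    refine ⟨l₀ * V / Real.log (3 / 2) + 2 ^ N * d, by positivity, fun s u hu huM => ?_⟩
    refine (lintegral_layercake_le hα hd' a b s hu hl₀'.le).trans ?_
    have hle : l₀ ≤ u ^ (-(d : ℝ)) :=
      Real.rpow_le_rpow_of_nonpos hu (by linarith) (by linarith)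
    rw [lintegral_indicator_Iio_rpow hl₀'.le hle (by positivity) (Or.inr hl₀'), hVV,
      ← ENNReal.ofReal_mul hl₀'.le, ← hq, hq1]
    have h1 : ∫ l in l₀..u ^ (-(d : ℝ)), l ^ (-(1 : ℝ)) = d * Real.log (3 * M / u) := by
      simp_rw [Real.rpow_neg_one]
      rw [integral_inv_of_pos hl₀' (by positivity), hl₀,
        ← Real.div_rpow (by positivity) (by positivity),
        Real.log_rpow (by positivity), Real.log_div hu.ne' (by positivity),
        Real.log_div (by positivity) hu.ne']
      ring
    have h2 : Real.log (3 / 2) ≤ Real.log (3 * M / u) :=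
      Real.log_le_log (by norm_num) (by rw [div_le_div_iff₀ (by norm_num) hu]; linarith)
    rw [h1, potential, if_neg (by linarith), if_pos hβ,
      ← ENNReal.ofReal_add (by positivity) (by
        have := hlog.le.trans h2
        positivity)]
    refine ENNReal.ofReal_le_ofReal ?_
    have h3 : l₀ * V ≤ l₀ * V / Real.log (3 / 2) * Real.log (3 * M / u) := by
      rw [div_mul_eq_mul_div, le_div_iff₀ hlog]; gcongr
    nlinarith
  -- Here `l ^ (-q)` is integrable at `0`: no cut is needed, and integrating up to `u ^ (-d)`
  -- produces the power `u ^ (-(d - N / α))`.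
  · have hq1 : q < 1 := by rw [hq, div_lt_one hd']; linarith
    refine ⟨2 ^ N / (1 - q), by have : 0 < 1 - q := by linarith
                                positivity, fun s u hu huM => ?_⟩
    refine (lintegral_layercake_le hα hd' a b s hu le_rfl).trans ?_
    rw [lintegral_indicator_Iio_rpow le_rfl (by positivity) (by positivity) (Or.inl hq1),
      integral_rpow (Or.inl (by linarith)), potential, if_neg (by linarith), if_neg hβ.ne']
    simp only [ENNReal.ofReal_zero, zero_mul, zero_add]
    rw [Real.zero_rpow (by linarith), ← Real.rpow_mul hu.le]
    refine ENNReal.ofReal_le_ofReal (le_of_eq ?_)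
    have : -(d : ℝ) * (-q + 1) = -((d : ℝ) - N / α) := by rw [hq]; field_simp; ring
    rw [this]
    ring

/-- One dyadic shell suffices: between the corner cubes of sides r and 2r, where r^α = u / (9M), the
integrand is at least (2r)^(-αd) and the volume at least r^N. The bound `u ≤ 2 * M` and `α < 1` give
2r ≤ 1, so the shell stays in the unit corner cube. -/
lemma le_lintegral_annulus_of_pos {N d : ℕ} (hN : 0 < N) {α M : ℝ} (hα : 0 < α)
    (hα1 : α < 1) (hM : 0 < M) :
    ∃ c : ℝ, 0 < c ∧ ∀ (s : Param N) (u : ℝ), 0 < u → u ≤ 2 * M →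
      ENNReal.ofReal (c * u ^ (-((d : ℝ) - N / α))) ≤
        ∫⁻ t in cornerCube s 1 ∩ {t | u ≤ 9 * M * dist s t ^ α},
          ENNReal.ofReal ((dist s t ^ α) ^ (-(d : ℝ))) ∂paramVolume N := by
  refine ⟨(2 : ℝ) ^ (-(α * d)) * (9 * M) ^ ((d : ℝ) - N / α), by positivity,
    fun s u hu huM => ?_⟩
  set r : ℝ≥0 := ⟨(u / (9 * M)) ^ (1 / α), by positivity⟩ with hr
  have hrr : (r : ℝ) = (u / (9 * M)) ^ (1 / α) := rfl
  have hr0' : (0 : ℝ) < r := by rw [hrr]; positivity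
  have hr0 : 0 < r := by exact_mod_cast hr0'
  have hx : u / (9 * M) ≤ 1 / 2 := by rw [div_le_div_iff₀ (by positivity) two_pos]; linarith
  have hr1 : (r : ℝ) ≤ 1 / 2 := by
    rw [hrr]
    refine le_trans ?_ hx
    exact (Real.rpow_le_rpow_of_exponent_ge (by positivity) (by linarith)
      ((one_le_div hα).2 hα1.le)).trans_eq (Real.rpow_one _)
  have hra : (r : ℝ) ^ α = u / (9 * M) := by
    rw [hrr, ← Real.rpow_mul (by positivity), one_div_mul_cancel hα.ne', Real.rpow_one]
  have hsub : cornerCube s (2 * r) \ cornerCube s r ⊆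
      cornerCube s 1 ∩ {t | u ≤ 9 * M * dist s t ^ α} := by
    intro t ht
    refine ⟨cornerCube_mono s ?_ ht.1, ?_⟩
    · have : ((2 * r : ℝ≥0) : ℝ) ≤ 1 := by push_cast; linarith
      exact_mod_cast this
    · have h := le_dist_of_notMem_cornerCube (le_of_mem_cornerCube ht.1) ht.2
      have := Real.rpow_le_rpow hr0'.le h hα.le
      rw [hra, div_le_iff₀ (by positivity)] at this
      simp only [mem_ofPred_eq]; linarith
  refine le_trans ?_ (lintegral_mono_set hsub)
  calc ENNReal.ofReal ((2 : ℝ) ^ (-(α * d)) * (9 * M) ^ ((d : ℝ) - N / α) *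
        u ^ (-((d : ℝ) - N / α)))
      = ENNReal.ofReal (((2 * r : ℝ) ^ α) ^ (-(d : ℝ))) * ENNReal.ofReal ((r : ℝ) ^ N) := by
        rw [← ENNReal.ofReal_mul (by positivity)]
        congr 1
        have e1 : (r : ℝ) ^ N = (u / (9 * M)) ^ ((N : ℝ) / α) := by
          rw [hrr, ← Real.rpow_natCast, ← Real.rpow_mul (by positivity)]; congr 1; field_simp
        rw [Real.mul_rpow two_pos.le hr0'.le, hra, e1,
          Real.mul_rpow (x := 2 ^ α) (y := u / (9 * M)) (by positivity) (by positivity),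
          ← Real.rpow_mul two_pos.le, mul_assoc, mul_assoc, ← Real.rpow_add (by positivity),
          Real.div_rpow hu.le (by positivity),
          show -(d : ℝ) + N / α = -((d : ℝ) - N / α) by ring,
          Real.rpow_neg (x := 9 * M) (by positivity), mul_neg, div_inv_eq_mul]
        ring
    _ ≤ ENNReal.ofReal (((2 * r : ℝ) ^ α) ^ (-(d : ℝ))) *
          paramVolume N (cornerCube s (2 * r) \ cornerCube s r) := by
        gcongr
        refine le_trans ?_ le_measure_sdiff
        rw [paramVolume_cornerCube, paramVolume_cornerCube, ← ENNReal.ofReal_sub _ (by positivity)]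
        refine ENNReal.ofReal_le_ofReal ?_
        have h2 : (2 : ℝ) ≤ 2 ^ N := le_self_pow₀ one_le_two hN.ne'
        have h3 : (0 : ℝ) ≤ (r : ℝ) ^ N := by positivity
        push_cast
        rw [mul_pow]
        nlinarith
    _ = ∫⁻ _ in cornerCube s (2 * r) \ cornerCube s r,
          ENNReal.ofReal (((2 * r : ℝ) ^ α) ^ (-(d : ℝ))) ∂paramVolume N := by
        rw [lintegral_const, Measure.restrict_apply_univ]
    _ ≤ _ := by
        refine setLIntegral_mono' ((measurableSet_cornerCube s _).diff
          (measurableSet_cornerCube s _)) fun t ht => ENNReal.ofReal_le_ofReal ?_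
        have h1 := le_dist_of_notMem_cornerCube (le_of_mem_cornerCube ht.1) ht.2
        have h2 := dist_lt_of_mem_cornerCube (by positivity) ht.1
        push_cast at h2
        have h3 : 0 < dist s t := hr0'.trans_le h1
        exact Real.rpow_le_rpow_of_nonpos (by positivity)
          (Real.rpow_le_rpow h3.le h2.le hα.le) (by simp)

/-- In the critical case every scale between r and 1 contributes equally, so all of them are summed
by layer cake. The superlevel set at l contains the corner cube of volume 1/l minus the one of side
r, whose volume is 1/L. -/
lemma le_lintegral_annulus_of_eq {N d : ℕ} (hN : 0 < N) (hd : 0 < d) {α M : ℝ} (hα : 0 < α)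
    (hα1 : α < 1) (hM : 0 < M) (hβ : (d : ℝ) - N / α = 0) (s : Param N) {u : ℝ} (hu : 0 < u)
    (huM : u ≤ 2 * M) :
    ENNReal.ofReal (Real.log (3 * M / u)) ≤
        ∫⁻ t in cornerCube s 1 ∩ {t | u ≤ 9 * M * dist s t ^ α},
          ENNReal.ofReal ((dist s t ^ α) ^ (-(d : ℝ))) ∂paramVolume N := by
  have hN' : (0 : ℝ) < N := by exact_mod_cast hN
  have hd1 : (1 : ℝ) ≤ d := by exact_mod_cast hd
  have hNd : (N : ℝ) = α * d := by
    have : (N : ℝ) / α = d := by linarith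
    rw [← this]; field_simp
  set r : ℝ≥0 := ⟨(u / (9 * M)) ^ (1 / α), by positivity⟩ with hr
  have hrr : (r : ℝ) = (u / (9 * M)) ^ (1 / α) := rfl
  have hr0' : (0 : ℝ) < r := by rw [hrr]; positivity
  have hra : (r : ℝ) ^ α = u / (9 * M) := by
    rw [hrr, ← Real.rpow_mul (by positivity), one_div_mul_cancel hα.ne', Real.rpow_one]
  have hsub : cornerCube s 1 \ cornerCube s r ⊆
      cornerCube s 1 ∩ {t | u ≤ 9 * M * dist s t ^ α} := by
    intro t ht
    refine ⟨ht.1, ?_⟩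
    have h := le_dist_of_notMem_cornerCube (le_of_mem_cornerCube ht.1) ht.2
    have := Real.rpow_le_rpow hr0'.le h hα.le
    rw [hra, div_le_iff₀ (by positivity)] at this
    simp only [mem_ofPred_eq]; linarith
  refine le_trans ?_ (lintegral_mono_set hsub)
  have hmeas : Measurable fun t : Param N => (dist s t ^ α) ^ (-(d : ℝ)) := by fun_prop
  rw [lintegral_eq_lintegral_meas_lt _ (Filter.Eventually.of_forall fun t => by
    simp only [Pi.zero_apply]; positivity) hmeas.aemeasurable]
  set L : ℝ := (9 * M / u) ^ (d : ℝ) with hL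
  have hML : 1 ≤ 9 * M / u := by rw [le_div_iff₀ hu]; linarith
  have hL1 : 1 ≤ L := Real.one_le_rpow hML (by positivity)
  have hrN : (r : ℝ) ^ N = 1 / L := by
    have e : 1 / α * (N : ℝ) = d := by rw [hNd]; field_simp
    rw [hrr, ← Real.rpow_natCast, ← Real.rpow_mul (by positivity), e, hL, ← inv_div (9 * M) u,
      Real.inv_rpow (by positivity), one_div]
  calc ENNReal.ofReal (Real.log (3 * M / u))
      ≤ ENNReal.ofReal (∫ l in (1 : ℝ)..L, (l⁻¹ - 1 / L)) := by
        refine ENNReal.ofReal_le_ofReal ?_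
        rw [intervalIntegral.integral_sub, integral_inv_of_pos one_pos (by linarith),
          intervalIntegral.integral_const, div_one, smul_eq_mul, hL,
          Real.log_rpow (by positivity), ← hL]
        -- The factor `9` is spent here: `log 3 ≥ 1` pays for the subtracted `(L - 1) / L`.
        · have e1 : Real.log (9 * M / u) = Real.log 3 + Real.log (3 * M / u) := by
            rw [← Real.log_mul (by norm_num) (by positivity)]; congr 1; ring
          have e2 : 1 ≤ Real.log 3 := by
            rw [Real.le_log_iff_exp_le (by norm_num)]
            linarith [Real.exp_one_lt_d9]
          have e3 : 0 ≤ Real.log (3 * M / u) := Real.log_nonneg (by rw [le_div_iff₀ hu]; linarith)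
          have e4 : (L - 1) * (1 / L) ≤ 1 := by
            rw [mul_one_div, div_le_one (by linarith)]; linarith
          rw [e1]
          nlinarith
        · exact intervalIntegral.intervalIntegrable_inv (fun x hx => by
            rw [uIcc_of_le hL1] at hx; exact (one_pos.trans_le hx.1).ne') continuousOn_id
        · exact intervalIntegrable_const
    _ = ∫⁻ l in Ioc 1 L, ENNReal.ofReal (l⁻¹ - 1 / L) := by
        rw [intervalIntegral.integral_of_le hL1, ofReal_integral_eq_lintegral_ofReal]
        · refine IntegrableOn.integrable ?_
          rw [← intervalIntegrable_iff_integrableOn_Ioc_of_le hL1]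
          exact (intervalIntegral.intervalIntegrable_inv (fun x hx => by
            rw [uIcc_of_le hL1] at hx; exact (one_pos.trans_le hx.1).ne') continuousOn_id).sub
            intervalIntegrable_const
        · refine (ae_restrict_iff' measurableSet_Ioc).2 (Filter.Eventually.of_forall fun l hl => ?_)
          have := hl.1
          simp only [Pi.zero_apply, sub_nonneg, one_div]
          exact inv_anti₀ (by linarith) hl.2
    _ ≤ ∫⁻ l in Ioc 1 L, (paramVolume N).restrict (cornerCube s 1 \ cornerCube s r)
          {t | l < (dist s t ^ α) ^ (-(d : ℝ))} := by
        refine setLIntegral_mono' measurableSet_Ioc fun l hl => ?_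
        have hl0 : 0 < l := one_pos.trans hl.1
        set ρ : ℝ≥0 := ⟨l ^ (-(1 / N) : ℝ), by positivity⟩ with hρ
        have hρρ : (ρ : ℝ) = l ^ (-(1 / N) : ℝ) := rfl
        have hρ0 : (0 : ℝ) < ρ := by rw [hρρ]; positivity
        have hρN : (ρ : ℝ) ^ N = l⁻¹ := by
          rw [hρρ, ← Real.rpow_natCast, ← Real.rpow_mul hl0.le, ← Real.rpow_neg_one]
          congr 1; field_simp
        have hρ1 : (ρ : ℝ) ≤ 1 := Real.rpow_le_one_of_one_le_of_nonpos hl.1.le (by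
          have : 0 < 1 / (N : ℝ) := by positivity
          linarith)
        rw [Measure.restrict_apply' ((measurableSet_cornerCube s _).diff
          (measurableSet_cornerCube s _))]
        have hsub2 : cornerCube s ρ \ cornerCube s r ⊆
            {t | l < (dist s t ^ α) ^ (-(d : ℝ))} ∩ (cornerCube s 1 \ cornerCube s r) := by
          intro t ht
          refine ⟨?_, cornerCube_mono s (by exact_mod_cast hρ1) ht.1, ht.2⟩
          have h1 := le_dist_of_notMem_cornerCube (le_of_mem_cornerCube ht.1) ht.2
          have h2 := dist_lt_of_mem_cornerCube (by exact_mod_cast hρ0) ht.1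
          have h3 : 0 < dist s t := hr0'.trans_le h1
          have h4 : dist s t ^ N < l⁻¹ := by
            rw [← hρN]; exact pow_lt_pow_left₀ h2 h3.le hN.ne'
          simp only [mem_ofPred_eq]
          rw [← Real.rpow_mul h3.le, mul_neg, ← hNd, Real.rpow_neg h3.le, Real.rpow_natCast]
          exact (lt_inv_comm₀ (by positivity) hl0).1 h4
        refine le_trans ?_ (measure_mono hsub2)
        refine le_trans ?_ le_measure_sdiff
        rw [paramVolume_cornerCube, paramVolume_cornerCube, ← ENNReal.ofReal_sub _ (by positivity),
          hρN, hrN]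
    _ ≤ _ := lintegral_mono_set fun l hl => one_pos.trans hl.1

/-- The occupation bound from below, over the times `t ≥ s` whose distance to `s` is at least of the
order `u ^ (1 / α)`. -/
lemma le_lintegral_annulus {N d : ℕ} (hN : 0 < N) (hd : 0 < d) {α M : ℝ} (hα : 0 < α)
    (hα1 : α < 1) (hM : 0 < M) (hβ : 0 ≤ (d : ℝ) - N / α) :
    ∃ c : ℝ, 0 < c ∧ ∀ (s : Param N) (u : ℝ), 0 < u → u ≤ 2 * M →
      ENNReal.ofReal (c * potential M ((d : ℝ) - N / α) u) ≤
        ∫⁻ t in cornerCube s 1 ∩ {t | u ≤ 9 * M * dist s t ^ α},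
          ENNReal.ofReal ((dist s t ^ α) ^ (-(d : ℝ))) ∂paramVolume N := by
  rcases hβ.eq_or_lt with h | h
  · refine ⟨1, one_pos, fun s u hu huM => ?_⟩
    rw [potential, if_neg (by linarith), if_pos h.symm, one_mul]
    exact le_lintegral_annulus_of_eq hN hd hα hα1 hM h.symm s hu huM
  · obtain ⟨c, hc, H⟩ := le_lintegral_annulus_of_pos (d := d) hN hα hα1 hM
    refine ⟨c, hc, fun s u hu huM => ?_⟩
    rw [potential, if_neg (by linarith), if_neg h.ne']
    exact H s u hu huM

end GaussianHitting

/-! ### One-dimensional normal estimates. -/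

namespace GaussianHitting

lemma gaussianReal_ball_le_of_pdf_le {v : ℝ≥0} (hv : v ≠ 0) {z r K : ℝ} (hK : 0 ≤ K)
    (h : ∀ x ∈ Metric.ball z r, gaussianPDFReal 0 v x ≤ K) :
    gaussianReal 0 v (Metric.ball z r) ≤ ENNReal.ofReal (K * (2 * r)) := by
  rw [gaussianReal_apply _ hv, ENNReal.ofReal_mul hK, ← Real.volume_ball z r,
    ← setLIntegral_const]
  exact setLIntegral_mono' Metric.isOpen_ball.measurableSet fun x hx =>
    ENNReal.ofReal_le_ofReal (h x hx)

lemma le_gaussianReal_ball_of_le_pdf {v : ℝ≥0} (hv : v ≠ 0) {z r K : ℝ} (hK : 0 ≤ K)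
    (h : ∀ x ∈ Metric.ball z r, K ≤ gaussianPDFReal 0 v x) :
    ENNReal.ofReal (K * (2 * r)) ≤ gaussianReal 0 v (Metric.ball z r) := by
  rw [gaussianReal_apply _ hv, ENNReal.ofReal_mul hK, ← Real.volume_ball z r,
    ← setLIntegral_const]
  exact setLIntegral_mono' Metric.isOpen_ball.measurableSet fun x hx =>
    ENNReal.ofReal_le_ofReal (h x hx)

lemma inv_sqrt_two_pi_mul_le (v : ℝ≥0) :
    (√(2 * Real.pi * v))⁻¹ * 2 ≤ 1 / √(v : ℝ) := by
  rcases eq_or_ne v 0 with rfl | hv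
  · simp
  have hv' : (0 : ℝ) < v := by positivity
  rw [Real.sqrt_mul (by positivity)]
  have h2 : 2 ≤ √(2 * Real.pi) := Real.le_sqrt_of_sq_le (by nlinarith [Real.pi_gt_three])
  have h3 : 0 < √(v : ℝ) := Real.sqrt_pos.2 hv'
  rw [mul_inv, mul_right_comm, one_div]
  refine mul_le_of_le_one_left (by positivity) ?_
  rw [inv_mul_le_iff₀ (by positivity)]
  linarith

/-- A centered normal law charges an interval of half-length `r` by at most `r / √v`. -/
lemma gaussianReal_ball_le {v : ℝ≥0} (hv : v ≠ 0) {z r : ℝ} (hr : 0 ≤ r) :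
    gaussianReal 0 v (Metric.ball z r) ≤ ENNReal.ofReal (r / √(v : ℝ)) := by
  refine (gaussianReal_ball_le_of_pdf_le hv (K := (√(2 * Real.pi * v))⁻¹) (by positivity)
    fun x _ => ?_).trans (ENNReal.ofReal_le_ofReal ?_)
  · rw [gaussianPDFReal]
    exact mul_le_of_le_one_right (by positivity) (Real.exp_le_one_iff.2 (by
      rw [neg_div]; exact neg_nonpos.2 (by positivity)))
  · have := mul_le_mul_of_nonneg_left (inv_sqrt_two_pi_mul_le v) hr
    calc _ = r * ((√(2 * Real.pi * v))⁻¹ * 2) := by ring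
      _ ≤ _ := this
      _ = _ := by ring

/-- For `y ≥ 1` a single term of the exponential series at `y ^ 2 / 8` is enough; for `y ≤ 1` the
right side is at least `1`. The decay of order `d` lets one far coordinate compensate the
normalising factors of all `d` coordinate densities. -/
lemma exp_neg_sq_le {d : ℕ} {y : ℝ} (hy : 0 < y) :
    Real.exp (-(y ^ 2 / 8)) ≤ 8 ^ d * d.factorial * (1 / y) ^ d := by
  rw [Real.exp_neg, div_pow, one_pow, mul_one_div, le_div_iff₀ (by positivity), mul_comm,
    ← div_eq_mul_inv, div_le_iff₀ (Real.exp_pos _)]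
  have h1 : (1 : ℝ) ≤ 8 ^ d := one_le_pow₀ (by norm_num)
  have h2 : (1 : ℝ) ≤ d.factorial := by exact_mod_cast Nat.one_le_iff_ne_zero.2 d.factorial_ne_zero
  have h12 : (1 : ℝ) ≤ 8 ^ d * d.factorial := one_le_mul_of_one_le_of_one_le h1 h2
  rcases le_total y 1 with h | h
  · calc y ^ d ≤ 1 := pow_le_one₀ hy.le h
      _ ≤ 8 ^ d * d.factorial * 1 := by linarith
      _ ≤ _ := by gcongr; exact Real.one_le_exp (by positivity)
  · have h3 := Real.pow_div_factorial_le_exp (y ^ 2 / 8) (by positivity) d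
    rw [div_le_iff₀ (by positivity), div_pow, div_le_iff₀ (by positivity)] at h3
    calc y ^ d ≤ (y ^ 2) ^ d := by
          rw [← pow_mul]; exact pow_le_pow_right₀ h (by omega)
      _ ≤ _ := h3
      _ = _ := by ring

/-- Polynomial decay of the mass that a centered normal law puts on an interval far from `0`. -/
lemma gaussianReal_ball_le_of_le {v : ℝ≥0} (hv : v ≠ 0) (d : ℕ) {z r : ℝ} (hr : 0 ≤ r)
    (hz : 2 * r ≤ |z|) (hz0 : z ≠ 0) :
    gaussianReal 0 v (Metric.ball z r) ≤
      ENNReal.ofReal (r / √(v : ℝ) * (8 ^ d * d.factorial * (√(v : ℝ) / |z|) ^ d)) := by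
  have hv' : (0 : ℝ) < v := by positivity
  have hz' : 0 < |z| := abs_pos.2 hz0
  refine (gaussianReal_ball_le_of_pdf_le hv
    (K := (√(2 * Real.pi * v))⁻¹ * (8 ^ d * d.factorial * (√(v : ℝ) / |z|) ^ d)) (by positivity)
    fun x hx => ?_).trans (ENNReal.ofReal_le_ofReal ?_)
  · rw [gaussianPDFReal]
    refine mul_le_mul_of_nonneg_left ?_ (by positivity)
    have h1 : |z| / 2 ≤ |x| := by
      rw [Metric.mem_ball, Real.dist_eq] at hx
      have := abs_sub_abs_le_abs_sub z x
      rw [abs_sub_comm] at this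
      linarith
    have h2 : |z| ^ 2 / 4 ≤ (x - 0) ^ 2 := by
      rw [sub_zero, ← sq_abs x]; nlinarith
    have := exp_neg_sq_le (d := d) (y := |z| / √(v : ℝ)) (by positivity)
    rw [one_div_div] at this
    refine le_trans (Real.exp_le_exp.2 ?_) this
    rw [neg_div, neg_le_neg_iff, div_pow, Real.sq_sqrt hv'.le, div_div,
      div_le_div_iff₀ (by positivity) (by positivity)]
    nlinarith
  · have := mul_le_mul_of_nonneg_left (inv_sqrt_two_pi_mul_le v)
      (show 0 ≤ r * (8 ^ d * d.factorial * (√(v : ℝ) / |z|) ^ d) by positivity)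
    calc _ = r * (8 ^ d * d.factorial * (√(v : ℝ) / |z|) ^ d) * ((√(2 * Real.pi * v))⁻¹ * 2) := by
          ring
      _ ≤ _ := this
      _ = _ := by ring

/-- A lower bound for the mass that a centered normal law puts on an interval at a distance of the
order of the standard deviation. -/
lemma exists_le_gaussianReal_ball (L : ℝ) :
    ∃ c : ℝ, 0 < c ∧ ∀ (v : ℝ≥0), v ≠ 0 → ∀ z r : ℝ, 0 ≤ r → |z| + r ≤ L * √(v : ℝ) →
      ENNReal.ofReal (c * (r / √(v : ℝ))) ≤ gaussianReal 0 v (Metric.ball z r) := by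
  refine ⟨2 * (√(2 * Real.pi))⁻¹ * Real.exp (-(L ^ 2 / 2)), by positivity,
    fun v hv z r hr hL => ?_⟩
  have hv' : (0 : ℝ) < v := by positivity
  refine le_trans (ENNReal.ofReal_le_ofReal (le_of_eq ?_)) (le_gaussianReal_ball_of_le_pdf hv
    (K := (√(2 * Real.pi * v))⁻¹ * Real.exp (-(L ^ 2 / 2))) (by positivity) fun x hx => ?_)
  · rw [Real.sqrt_mul (x := 2 * Real.pi) (by positivity), mul_inv]; ring
  · rw [gaussianPDFReal]
    refine mul_le_mul_of_nonneg_left (Real.exp_le_exp.2 ?_) (by positivity)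
    have h1 : |x| ≤ L * √(v : ℝ) := by
      rw [Metric.mem_ball, Real.dist_eq] at hx
      have := abs_sub_abs_le_abs_sub x z
      linarith
    have h2 : x ^ 2 ≤ L ^ 2 * v := by
      rw [← sq_abs x, ← Real.sq_sqrt hv'.le, ← mul_pow]
      exact pow_le_pow_left₀ (abs_nonneg _) h1 2
    rw [sub_zero, neg_div, neg_le_neg_iff, div_le_div_iff₀ (by positivity) two_pos]
    linarith

/-! ### Regression bounds on the whole cube from the covariance hypothesis. -/

/-- Bounds for the regression of `X_t` on `X_s` in terms of `dist s t ^ α`. -/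
structure IncrementBounds {N : ℕ} (σ : Param N → Param N → ℝ) (α : ℝ) (a b : ℝ≥0) (c C : ℝ) :
    Prop where
  c_pos : 0 < c
  C_pos : 0 < C
  le_var : ∀ t ∈ cube N a b, c ≤ σ t t
  var_le : ∀ t ∈ cube N a b, σ t t ≤ C
  abs_slope_le : ∀ s ∈ cube N a b, ∀ t ∈ cube N a b, |σ s t / σ s s| ≤ C
  abs_one_sub_slope_le : ∀ s ∈ cube N a b, ∀ t ∈ cube N a b,
    |1 - σ s t / σ s s| ≤ C * dist s t ^ α
  le_condVar : ∀ s ∈ cube N a b, ∀ t ∈ cube N a b,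
    c * (dist s t ^ α) ^ 2 ≤ σ t t - σ s t ^ 2 / σ s s
  condVar_le : ∀ s ∈ cube N a b, ∀ t ∈ cube N a b,
    σ t t - σ s t ^ 2 / σ s s ≤ C * (dist s t ^ α) ^ 2

lemma dist_le_paramDist {N : ℕ} (s t : Param N) : dist s t ≤ paramDist s t := by
  refine (dist_pi_le_iff (show 0 ≤ paramDist s t from Real.sqrt_nonneg _)).2 fun i => ?_
  rw [NNReal.dist_eq, abs_sub_comm, ← Real.sqrt_sq_eq_abs]
  exact Real.sqrt_le_sqrt (Finset.single_le_sum (f := fun i => ((t i : ℝ) - s i) ^ 2)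
    (fun i _ => sq_nonneg _) (Finset.mem_univ i))

lemma paramDist_le {N : ℕ} (s t : Param N) : paramDist s t ≤ (N + 1) * dist s t := by
  rw [paramDist, Real.sqrt_le_left (by positivity)]
  calc ∑ i, ((t i : ℝ) - s i) ^ 2 ≤ ∑ _i : Fin N, dist s t ^ 2 := by
        refine Finset.sum_le_sum fun i _ => ?_
        have := dist_le_pi_dist s t i
        rw [NNReal.dist_eq, abs_sub_comm] at this
        rw [← sq_abs]
        exact pow_le_pow_left₀ (abs_nonneg _) this 2
    _ = N * dist s t ^ 2 := by simp
    _ ≤ _ := by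
        rw [mul_pow]
        have : (0 : ℝ) ≤ N := by positivity
        gcongr
        nlinarith

lemma dist_le_of_mem_cube {N : ℕ} {a b : ℝ≥0} {s t : Param N} (hs : s ∈ cube N a b)
    (ht : t ∈ cube N a b) : dist s t ≤ b := by
  refine (dist_pi_le_iff (NNReal.coe_nonneg b)).2 fun i => ?_
  have h1 : (s i : ℝ) ≤ b := by exact_mod_cast (hs i).2
  have h2 : (t i : ℝ) ≤ b := by exact_mod_cast (ht i).2
  rw [NNReal.dist_eq, abs_le]
  constructor <;> linarith [(s i).2, (t i).2]

/-- The conditional variance equals `σ t t * (1 - correlation σ s t ^ 2)`, so near pairs are covered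
by the hypothesis, with `γ` lowered to `α` at the cost of `δ ^ (γ - α)`. For far pairs `dist s t ^
α` lies between `κ` and `B`, and boundedness together with `|ρ| < 1 - ε` suffices. Euclidean and sup
distances differ by a factor of at most `n = N + 1`. -/
lemma HypA1.incrementBounds {N : ℕ} {σ : Param N → Param N → ℝ} {α γ : ℝ} (hα : 0 < α)
    (hγ : α ≤ γ) (h : HypA1 σ α γ) {a b : ℝ≥0} (ha : 0 < a) (hab : a < b) :
    ∃ c C : ℝ, IncrementBounds σ α a b c C := by
  obtain ⟨δ, ε, C₁, C₂, C₃, C₄, C₅, hδ, hε, h1, h2, h3, h4, h5, H⟩ := h a b ha hab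
  have hb : (0 : ℝ) < b := by exact_mod_cast ha.trans hab
  set n : ℝ := N + 1 with hn
  have hn0 : 0 < n := by positivity
  set κ : ℝ := (δ / n) ^ α with hκ
  have hκ0 : 0 < κ := by positivity
  have hvar : ∀ s ∈ cube N a b, 0 < σ s s := fun s hs => h1.trans_le (H s hs s hs).1.1
  have hcorr : ∀ s ∈ cube N a b, ∀ t ∈ cube N a b,
      σ t t - σ s t ^ 2 / σ s s = σ t t * (1 - correlation σ s t ^ 2) := by
    intro s hs t ht
    have e1 := hvar s hs
    have e2 := hvar t ht
    rw [correlation, div_pow, mul_pow, Real.sq_sqrt e1.le, Real.sq_sqrt e2.le]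
    field_simp
  have hcorr0 : ∀ s ∈ cube N a b, ∀ t ∈ cube N a b, 0 ≤ 1 - correlation σ s t ^ 2 := by
    intro s hs t ht
    rcases le_or_gt (paramDist s t) δ with hd | hd
    · refine le_trans ?_ ((H s hs t ht).2.2.1 hd).1
      have : 0 ≤ paramDist s t := Real.sqrt_nonneg _
      positivity
    · have := (H s hs t ht).2.2.2 hd
      rw [← sq_abs]
      nlinarith [abs_nonneg (correlation σ s t)]
  have hslope : ∀ s ∈ cube N a b, ∀ t ∈ cube N a b, |σ s t / σ s s| ≤ C₂ / C₁ := by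
    intro s hs t ht
    have e1 := hvar s hs
    have e2 := hvar t ht
    have e3 := hcorr s hs t ht ▸ mul_nonneg e2.le (hcorr0 s hs t ht)
    rw [sub_nonneg, div_le_iff₀ e1] at e3
    have e4 : σ s t ^ 2 ≤ C₂ ^ 2 := by
      have := (H s hs s hs).1.2
      have := (H t ht t ht).1.2
      nlinarith
    have e5 : |σ s t| ≤ C₂ := abs_le_of_sq_le_sq e4 h2.le
    rw [abs_div, abs_of_pos e1]
    exact div_le_div₀ h2.le e5 h1 (H s hs s hs).1.1
  have hfar : ∀ s t : Param N, δ < paramDist s t → κ ≤ dist s t ^ α := by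
    intro s t hd
    refine Real.rpow_le_rpow (by positivity) ?_ hα.le
    rw [div_le_iff₀ hn0]
    linarith [paramDist_le s t]
  set B : ℝ := (b : ℝ) ^ α with hB
  have hB0 : 0 < B := by positivity
  have hTB : ∀ s ∈ cube N a b, ∀ t ∈ cube N a b, dist s t ^ α ≤ B := fun s hs t ht =>
    Real.rpow_le_rpow dist_nonneg (dist_le_of_mem_cube hs ht) hα.le
  have hsq : ∀ x : ℝ, 0 ≤ x → x ^ (2 * α) = (x ^ α) ^ 2 := fun x hx => by
    rw [mul_comm, Real.rpow_mul hx, ← Real.rpow_natCast]; norm_num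
  have hT0 : ∀ s t : Param N, 0 ≤ dist s t ^ α := fun s t => Real.rpow_nonneg dist_nonneg _
  have hpα : ∀ s t : Param N, paramDist s t ^ α ≤ n ^ α * dist s t ^ α := fun s t => by
    rw [← Real.mul_rpow hn0.le dist_nonneg]
    exact Real.rpow_le_rpow (Real.sqrt_nonneg _) (paramDist_le s t) hα.le
  have hpα' : ∀ s t : Param N, dist s t ^ α ≤ paramDist s t ^ α := fun s t =>
    Real.rpow_le_rpow dist_nonneg (dist_le_paramDist s t) hα.le
  set A₃ : ℝ := C₃ * (δ ^ (γ - α) * n ^ α) with hA₃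
  set A₅ : ℝ := C₂ * (C₅ * (n ^ α) ^ 2) with hA₅
  refine ⟨min C₁ (min (C₁ * C₄) (C₁ * (ε / B ^ 2))),
    C₂ + C₂ / C₁ + (1 + C₂ / C₁) / κ + A₃ + A₅ + C₂ / κ ^ 2, ?_⟩
  have p1 : 0 < C₂ / C₁ := by positivity
  have p2 : 0 < (1 + C₂ / C₁) / κ := by positivity
  have p3 : 0 < A₃ := by positivity
  have p4 : 0 < A₅ := by positivity
  have p5 : 0 < C₂ / κ ^ 2 := by positivity
  refine ⟨by positivity, by positivity, fun t ht => (min_le_left _ _).trans (H t ht t ht).1.1,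
    fun t ht => (H t ht t ht).1.2.trans (by linarith),
    fun s hs t ht => (hslope s hs t ht).trans (by linarith), fun s hs t ht => ?_,
    fun s hs t ht => ?_, fun s hs t ht => ?_⟩
  · have hT := hT0 s t
    rcases le_or_gt (paramDist s t) δ with hd | hd
    · have e1 : paramDist s t ^ γ ≤ δ ^ (γ - α) * (n ^ α * dist s t ^ α) := by
        have hp0 : 0 ≤ paramDist s t := Real.sqrt_nonneg _
        rcases hp0.eq_or_lt with h0 | h0
        · rw [← h0, Real.zero_rpow (by linarith)]; positivity
        · calc paramDist s t ^ γ = paramDist s t ^ (γ - α) * paramDist s t ^ α := by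
                rw [← Real.rpow_add h0]; congr 1; ring
            _ ≤ _ := by
                have := hpα s t
                have : 0 ≤ γ - α := by linarith
                gcongr
      calc _ ≤ C₃ * paramDist s t ^ γ := (H s hs t ht).2.1 hd
        _ ≤ C₃ * (δ ^ (γ - α) * (n ^ α * dist s t ^ α)) := by gcongr
        _ = A₃ * dist s t ^ α := by rw [hA₃]; ring
        _ ≤ _ := by gcongr; linarith
    · calc |1 - σ s t / σ s s| ≤ 1 + C₂ / C₁ := by
            refine (abs_sub _ _).trans ?_
            rw [abs_one]; linarith [hslope s hs t ht]
        _ = (1 + C₂ / C₁) / κ * κ := by field_simp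
        _ ≤ (1 + C₂ / C₁) / κ * dist s t ^ α := by gcongr; exact hfar s t hd
        _ ≤ _ := by gcongr; linarith
  · have hT := hT0 s t
    rw [hcorr s hs t ht]
    have hv := (H t ht t ht).1.1
    rcases le_or_gt (paramDist s t) δ with hd | hd
    · have e1 := ((H s hs t ht).2.2.1 hd).1
      rw [hsq (paramDist s t) (Real.sqrt_nonneg _)] at e1
      calc _ ≤ C₁ * C₄ * (dist s t ^ α) ^ 2 := by
            gcongr; exact (min_le_right _ _).trans (min_le_left _ _)
        _ = C₁ * (C₄ * (dist s t ^ α) ^ 2) := by ring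
        _ ≤ C₁ * (C₄ * (paramDist s t ^ α) ^ 2) := by
            gcongr C₁ * (C₄ * ?_)
            exact pow_le_pow_left₀ hT (hpα' s t) 2
        _ ≤ C₁ * (1 - correlation σ s t ^ 2) := by gcongr
        _ ≤ _ := by gcongr; exact hcorr0 s hs t ht
    · have e1 : ε ≤ 1 - correlation σ s t ^ 2 := by
        have := (H s hs t ht).2.2.2 hd
        rw [← sq_abs]
        nlinarith [abs_nonneg (correlation σ s t)]
      calc _ ≤ C₁ * (ε / B ^ 2) * (dist s t ^ α) ^ 2 := by
            gcongr; exact (min_le_right _ _).trans (min_le_right _ _)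
        _ ≤ C₁ * (ε / B ^ 2) * B ^ 2 := by gcongr; exact hTB s hs t ht
        _ = C₁ * ε := by field_simp
        _ ≤ _ := mul_le_mul hv e1 hε.le (h1.le.trans hv)
  · have hT := hT0 s t
    rw [hcorr s hs t ht]
    have hv := (H t ht t ht).1.2
    have hc := hcorr0 s hs t ht
    rcases le_or_gt (paramDist s t) δ with hd | hd
    · have e1 := ((H s hs t ht).2.2.1 hd).2
      rw [hsq (paramDist s t) (Real.sqrt_nonneg _)] at e1
      calc _ ≤ C₂ * (C₅ * (paramDist s t ^ α) ^ 2) := by gcongr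
        _ ≤ C₂ * (C₅ * (n ^ α * dist s t ^ α) ^ 2) := by
            gcongr
            · exact Real.rpow_nonneg (Real.sqrt_nonneg _) _
            · exact hpα s t
        _ = A₅ * (dist s t ^ α) ^ 2 := by rw [hA₅]; ring
        _ ≤ _ := by gcongr; linarith
    · calc _ ≤ C₂ * 1 := by gcongr; linarith [sq_nonneg (correlation σ s t)]
        _ = C₂ / κ ^ 2 * κ ^ 2 := by field_simp
        _ ≤ C₂ / κ ^ 2 * (dist s t ^ α) ^ 2 := by gcongr; exact hfar s t hd
        _ ≤ _ := by gcongr; linarith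

end GaussianHitting

/-! ### Gaussian regression of X_t on X_s, coordinate by coordinate. -/

namespace GaussianHitting

/-- The open box with centre `x` and half side `ε`. -/
def box {d : ℕ} (x : EuclideanSpace ℝ (Fin d)) (ε : ℝ) : Set (EuclideanSpace ℝ (Fin d)) :=
  {y | ∀ i, y i ∈ Metric.ball (x i) ε}

/-- The residual of the `i`-th coordinate of `X_t` in the regression on `X_s`. -/
noncomputable def residual {Ω : Type*} {N d : ℕ} (X : Param N → Ω → EuclideanSpace ℝ (Fin d))
    (σ : Param N → Param N → ℝ) (s t : Param N) (i : Fin d) (ω : Ω) : ℝ :=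
  X t ω i - σ s t / σ s s * X s ω i

variable {Ω : Type*} [mΩ : MeasurableSpace Ω] {P : Measure Ω} {N d : ℕ}
  {X : Param N → Ω → EuclideanSpace ℝ (Fin d)} {σ : Param N → Param N → ℝ}

namespace IsCenteredGaussianField

lemma isProbabilityMeasure (hX : IsCenteredGaussianField P X σ) : IsProbabilityMeasure P :=
  hX.gaussian.isProbabilityMeasure

lemma measurable [P.IsComplete] (hX : IsCenteredGaussianField P X σ) (t : Param N) :
    Measurable (X t) :=
  aemeasurable_iff_measurable.1 (hX.gaussian.aemeasurable t)

lemma measurable_coord [P.IsComplete] (hX : IsCenteredGaussianField P X σ) (t : Param N)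
    (i : Fin d) : Measurable fun ω => X t ω i :=
  (EuclideanSpace.proj (𝕜 := ℝ) i).continuous.measurable.comp (hX.measurable t)

lemma measurable_uncurry [P.IsComplete] (hX : IsCenteredGaussianField P X σ) :
    Measurable (Function.uncurry X) :=
  measurable_uncurry_of_continuous_of_measurable hX.continuous_paths hX.measurable

lemma isGaussianProcess_coord (hX : IsCenteredGaussianField P X σ) :
    IsGaussianProcess (fun (p : Param N × Fin d) ω => X p.1 ω p.2) P := by
  classical
  refine hX.gaussian.of_isGaussianProcess fun p => ⟨{p.1},
    (EuclideanSpace.proj p.2).comp (ContinuousLinearMap.proj ⟨p.1, by simp⟩), fun ω => ?_⟩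
  simp

lemma memLp_coord (hX : IsCenteredGaussianField P X σ) (t : Param N) (i : Fin d) :
    MemLp (fun ω => X t ω i) 2 P :=
  (hX.isGaussianProcess_coord.hasGaussianLaw_eval (t, i)).memLp_two

lemma covariance_coord (hX : IsCenteredGaussianField P X σ) (s t : Param N) (i : Fin d) :
    cov[fun ω => X s ω i, fun ω => X t ω i; P] = σ s t := by
  have := hX.isProbabilityMeasure
  rw [covariance_eq_sub (hX.memLp_coord s i) (hX.memLp_coord t i), hX.centered, hX.centered]
  simpa using hX.covariance i s t

lemma covariance_coord_ne (hX : IsCenteredGaussianField P X σ) (s t : Param N) {i j : Fin d}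
    (hij : i ≠ j) : cov[fun ω => X s ω i, fun ω => X t ω j; P] = 0 := by
  have := hX.isProbabilityMeasure
  refine IndepFun.covariance_eq_zero ?_ (hX.memLp_coord s i) (hX.memLp_coord t j)
  exact (hX.indep_coord.indepFun hij).comp (measurable_pi_apply s) (measurable_pi_apply t)

lemma symm (hX : IsCenteredGaussianField P X σ) (hd : 0 < d) (s t : Param N) : σ s t = σ t s := by
  rw [← hX.covariance ⟨0, hd⟩ s t, ← hX.covariance ⟨0, hd⟩ t s]
  simp_rw [mul_comm]

lemma memLp_residual (hX : IsCenteredGaussianField P X σ) (s t : Param N) (i : Fin d) :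
    MemLp (residual X σ s t i) 2 P :=
  (hX.memLp_coord t i).sub ((hX.memLp_coord s i).const_mul _)

lemma covariance_residual_left (hX : IsCenteredGaussianField P X σ) (s t : Param N) (i : Fin d)
    {Y : Ω → ℝ} (hY : MemLp Y 2 P) :
    cov[residual X σ s t i, Y; P] =
      cov[fun ω => X t ω i, Y; P] - σ s t / σ s s * cov[fun ω => X s ω i, Y; P] := by
  have := hX.isProbabilityMeasure
  unfold residual
  rw [covariance_fun_sub_left (hX.memLp_coord t i) ((hX.memLp_coord s i).const_mul _) hY,
    covariance_const_mul_left]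

/-- The slope `σ s t / σ s s` is the one that kills the covariance for `i = j`; distinct coordinates
are independent anyway. -/
lemma covariance_residual_coord (hX : IsCenteredGaussianField P X σ) (s t : Param N)
    (hs : σ s s ≠ 0) (i j : Fin d) :
    cov[residual X σ s t i, fun ω => X s ω j; P] = 0 := by
  rw [hX.covariance_residual_left s t i (hX.memLp_coord s j)]
  by_cases hij : i = j
  · subst hij
    rw [hX.covariance_coord, hX.covariance_coord, hX.symm i.pos t s]
    field_simp; ring
  · rw [hX.covariance_coord_ne _ _ hij, hX.covariance_coord_ne _ _ hij]; ring

lemma variance_residual (hX : IsCenteredGaussianField P X σ) (s t : Param N)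
    (hs : σ s s ≠ 0) (i : Fin d) :
    Var[residual X σ s t i; P] = σ t t - σ s t ^ 2 / σ s s := by
  have := hX.isProbabilityMeasure
  rw [← covariance_self (hX.memLp_residual s t i).aemeasurable,
    hX.covariance_residual_left s t i (hX.memLp_residual s t i),
    covariance_comm (fun ω => X s ω i), hX.covariance_residual_coord s t hs,
    covariance_comm, hX.covariance_residual_left s t i (hX.memLp_coord t i), hX.covariance_coord,
    hX.covariance_coord]
  ring

lemma integral_residual (hX : IsCenteredGaussianField P X σ) (s t : Param N) (i : Fin d) :
    ∫ ω, residual X σ s t i ω ∂P = 0 := by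
  have := hX.isProbabilityMeasure
  unfold residual
  rw [integral_sub ((hX.memLp_coord t i).integrable one_le_two)
    (((hX.memLp_coord s i).integrable one_le_two).const_mul _), integral_const_mul,
    hX.centered, hX.centered]
  simp

lemma hasGaussianLaw_coord_residual (hX : IsCenteredGaussianField P X σ) (s t : Param N)
    (i : Fin d) : HasGaussianLaw (fun ω => (X s ω i, residual X σ s t i ω)) P := by
  have h := (hX.isGaussianProcess_coord.hasGaussianLaw_prodMk (s := (s, i)) (t := (t, i)))
  exact h.map_fun ((ContinuousLinearMap.fst ℝ ℝ ℝ).prod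
    (ContinuousLinearMap.snd ℝ ℝ ℝ - (σ s t / σ s s) • ContinuousLinearMap.fst ℝ ℝ ℝ))

lemma indepFun_coord_residual (hX : IsCenteredGaussianField P X σ) (s t : Param N)
    (hs : σ s s ≠ 0) (i : Fin d) : IndepFun (fun ω => X s ω i) (residual X σ s t i) P := by
  refine (hX.hasGaussianLaw_coord_residual s t i).indepFun_of_covariance_eq_zero ?_
  rw [covariance_comm]
  exact hX.covariance_residual_coord s t hs i i

lemma map_coord (hX : IsCenteredGaussianField P X σ) (t : Param N) (i : Fin d) :
    P.map (fun ω => X t ω i) = gaussianReal 0 (σ t t).toNNReal := by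
  rw [(hX.isGaussianProcess_coord.hasGaussianLaw_eval (t, i)).map_eq_gaussianReal, hX.centered,
    ← covariance_self (hX.memLp_coord t i).aemeasurable, hX.covariance_coord]

lemma map_residual (hX : IsCenteredGaussianField P X σ) (s t : Param N)
    (hs : σ s s ≠ 0) (i : Fin d) :
    P.map (residual X σ s t i) = gaussianReal 0 (σ t t - σ s t ^ 2 / σ s s).toNNReal := by
  rw [(hX.hasGaussianLaw_coord_residual s t i).snd.map_eq_gaussianReal, hX.integral_residual,
    hX.variance_residual s t hs]

lemma measurable_residual [P.IsComplete] (hX : IsCenteredGaussianField P X σ) (s t : Param N)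
    (i : Fin d) : Measurable (residual X σ s t i) :=
  (hX.measurable_coord t i).sub ((hX.measurable_coord s i).const_mul _)

/-- Events that concern one coordinate each, at the times `s` and `t`, are independent. -/
lemma measure_forall_coord (hX : IsCenteredGaussianField P X σ) (s t : Param N)
    {B : Fin d → Set (ℝ × ℝ)} (hB : ∀ i, MeasurableSet (B i)) :
    P {ω | ∀ i, (X s ω i, X t ω i) ∈ B i} = ∏ i, P {ω | (X s ω i, X t ω i) ∈ B i} := by
  have hm : Measurable fun f : Param N → ℝ => (f s, f t) :=
    (measurable_pi_apply s).prodMk (measurable_pi_apply t)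
  have := hX.indep_coord.measure_inter_preimage_eq_mul Finset.univ
    (sets := fun i => (fun f : Param N → ℝ => (f s, f t)) ⁻¹' B i) fun i _ => hm (hB i)
  simp only [Finset.mem_univ, iInter_true] at this
  convert! this using 2
  ext ω; simp

lemma measure_box (hX : IsCenteredGaussianField P X σ) (t : Param N)
    (x : EuclideanSpace ℝ (Fin d)) (ε : ℝ) :
    P {ω | X t ω ∈ box x ε} = ∏ i, gaussianReal 0 (σ t t).toNNReal (Metric.ball (x i) ε) := by
  have h := hX.measure_forall_coord t t (B := fun i => Prod.fst ⁻¹' Metric.ball (x i) ε)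
    fun i => measurable_fst Metric.isOpen_ball.measurableSet
  simp only [mem_preimage] at h
  refine h.trans (Finset.prod_congr rfl fun i _ => ?_)
  rw [← hX.map_coord t i, Measure.map_apply_of_aemeasurable (hX.memLp_coord t i).aemeasurable
    Metric.isOpen_ball.measurableSet]
  rfl

/-- With slope m, the event forces the residual to lie within `(1 + |m|) * ε` of `y - m * x`. The
residual is independent of `X_s`, so the probabilities multiply. -/
lemma measure_coord_coord_le (hX : IsCenteredGaussianField P X σ) (s t : Param N)
    (hs : σ s s ≠ 0) (i : Fin d) (x y ε : ℝ) :
    P {ω | X s ω i ∈ Metric.ball x ε ∧ X t ω i ∈ Metric.ball y ε} ≤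
      gaussianReal 0 (σ s s).toNNReal (Metric.ball x ε) *
        gaussianReal 0 (σ t t - σ s t ^ 2 / σ s s).toNNReal
          (Metric.ball (y - σ s t / σ s s * x) ((1 + |σ s t / σ s s|) * ε)) := by
  rw [← hX.map_coord s i, ← hX.map_residual s t hs i,
    Measure.map_apply_of_aemeasurable (hX.memLp_coord s i).aemeasurable
    Metric.isOpen_ball.measurableSet, Measure.map_apply_of_aemeasurable
    (hX.memLp_residual s t i).aemeasurable Metric.isOpen_ball.measurableSet,
    ← (hX.indepFun_coord_residual s t hs i).measure_inter_preimage_eq_mul _ _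
      Metric.isOpen_ball.measurableSet Metric.isOpen_ball.measurableSet]
  refine measure_mono fun ω ⟨h1, h2⟩ => ⟨h1, ?_⟩
  simp only [mem_preimage, Metric.mem_ball, Real.dist_eq, residual] at h1 h2 ⊢
  set m := σ s t / σ s s
  calc |X t ω i - m * X s ω i - (y - m * x)| = |(X t ω i - y) - m * (X s ω i - x)| := by
        congr 1; ring
    _ ≤ |X t ω i - y| + |m * (X s ω i - x)| := abs_sub _ _
    _ < ε + |m| * ε := by
        rw [abs_mul]
        exact add_lt_add_of_lt_of_le h2 (mul_le_mul_of_nonneg_left h1.le (abs_nonneg _))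
    _ = _ := by ring

lemma measure_box_box_le (hX : IsCenteredGaussianField P X σ) (s t : Param N)
    (hs : σ s s ≠ 0) (x y : EuclideanSpace ℝ (Fin d)) (ε : ℝ) :
    P {ω | X s ω ∈ box x ε ∧ X t ω ∈ box y ε} ≤
      ∏ i, (gaussianReal 0 (σ s s).toNNReal (Metric.ball (x i) ε) *
        gaussianReal 0 (σ t t - σ s t ^ 2 / σ s s).toNNReal
          (Metric.ball (y i - σ s t / σ s s * x i) ((1 + |σ s t / σ s s|) * ε))) := by
  have h := hX.measure_forall_coord s t
    (B := fun i => Metric.ball (x i) ε ×ˢ Metric.ball (y i) ε)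
    fun i => Metric.isOpen_ball.measurableSet.prod Metric.isOpen_ball.measurableSet
  simp only [mem_prod, forall_and] at h
  refine (h.trans_le ?_)
  exact Finset.prod_le_prod' fun i _ => hX.measure_coord_coord_le s t hs i _ _ _

end IsCenteredGaussianField

end GaussianHitting

/-! ### Two-point and one-point estimates for boxes. -/

namespace GaussianHitting

variable {Ω : Type*} [mΩ : MeasurableSpace Ω] {P : Measure Ω} {N d : ℕ}
  {X : Param N → Ω → EuclideanSpace ℝ (Fin d)} {σ : Param N → Param N → ℝ}

lemma abs_coord_le_norm (x : EuclideanSpace ℝ (Fin d)) (i : Fin d) : |x i| ≤ ‖x‖ :=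
  PiLp.norm_apply_le x i

/-- If every coordinate were smaller, the squares would sum to less than `‖x‖ ^ 2 / d`. -/
lemma exists_norm_div_le_abs_coord (hd : 0 < d) (x : EuclideanSpace ℝ (Fin d)) :
    ∃ i, ‖x‖ / d ≤ |x i| := by
  by_contra! h
  have hd1 : (1 : ℝ) ≤ d := by exact_mod_cast hd
  have h1 : ‖x‖ ^ 2 < ∑ _i : Fin d, (‖x‖ / d) ^ 2 := by
    rw [EuclideanSpace.norm_sq_eq]
    refine Finset.sum_lt_sum_of_nonempty ⟨⟨0, hd⟩, Finset.mem_univ _⟩ fun i _ => ?_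
    exact pow_lt_pow_left₀ (h i) (abs_nonneg _) two_ne_zero
  rw [Finset.sum_const, Finset.card_univ, Fintype.card_fin, nsmul_eq_mul, div_pow,
    mul_div_assoc', lt_div_iff₀ (by positivity)] at h1
  nlinarith [sq_nonneg ‖x‖, mul_nonneg (sq_nonneg ‖x‖) (show (0:ℝ) ≤ d * (d - 1) by
    apply mul_nonneg <;> linarith)]

lemma prod_le_ofReal_pow {f : Fin d → ℝ≥0∞} {A : ℝ} (h : ∀ i, f i ≤ ENNReal.ofReal A)
    (hA : 0 ≤ A) : ∏ i, f i ≤ ENNReal.ofReal (A ^ d) := by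
  rw [ENNReal.ofReal_pow hA]
  exact (Finset.prod_le_prod' fun i _ => h i).trans_eq (by simp)

lemma ofReal_pow_le_prod {f : Fin d → ℝ≥0∞} {A : ℝ} (h : ∀ i, ENNReal.ofReal A ≤ f i)
    (hA : 0 ≤ A) : ENNReal.ofReal (A ^ d) ≤ ∏ i, f i := by
  rw [ENNReal.ofReal_pow hA]
  exact le_trans (by simp) (Finset.prod_le_prod' fun i _ => h i)

/-- Serves the case of distant boxes, where only one coordinate `i₀` is known to be far and supplies
the decay factor `E` for the whole product. -/
lemma prod_le_ofReal_pow_mul {f : Fin d → ℝ≥0∞} {A E : ℝ} (i₀ : Fin d)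
    (h : ∀ i, f i ≤ ENNReal.ofReal A) (h₀ : f i₀ ≤ ENNReal.ofReal (A * E)) (hA : 0 ≤ A)
    (hE : 0 ≤ E) : ∏ i, f i ≤ ENNReal.ofReal (A ^ d * E) := by
  calc ∏ i, f i ≤ ∏ i, ENNReal.ofReal (A * if i = i₀ then E else 1) := by
        refine Finset.prod_le_prod' fun i _ => ?_
        split_ifs with hi
        · subst hi; exact h₀
        · rw [mul_one]; exact h i
    _ = _ := by
        rw [← ENNReal.ofReal_prod_of_nonneg fun i _ => by split_ifs <;> positivity,
          Finset.prod_mul_distrib, Finset.prod_ite_eq']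
        simp

namespace IncrementBounds

variable {α : ℝ} {a b : ℝ≥0} {c C : ℝ}

set_option maxHeartbeats 1000000 in
/-- The two-point estimate: the joint law of `(X_s, X_t)` charges a product of boxes of size `ε`
by at most a constant times `ε ^ (2 d) * max (‖x - y‖, ε, ‖t - s‖ ^ α) ^ (-d)`. -/
lemma exists_measure_box_box_le (h : IncrementBounds σ α a b c C)
    (hX : IsCenteredGaussianField P X σ) (hd : 0 < d) {M : ℝ} (hM : 0 < M) :
    ∃ K : ℝ, 0 < K ∧ ∀ s ∈ cube N a b, ∀ t ∈ cube N a b, ∀ x y : EuclideanSpace ℝ (Fin d),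
      ‖x‖ ≤ M → ∀ ε : ℝ, 0 < ε →
        P {ω | X s ω ∈ box x ε ∧ X t ω ∈ box y ε} ≤ ENNReal.ofReal
          (K * ε ^ (2 * d) * max (max ‖x - y‖ ε) (dist s t ^ α) ^ (-(d : ℝ))) := by
  have hc := h.c_pos
  have hC := h.C_pos
  have hd0 : (0 : ℝ) < d := by exact_mod_cast hd
  have hd1 : (1 : ℝ) ≤ d := by exact_mod_cast hd
  set C₁ : ℝ := 1 + C with hC₁
  have hC₁1 : 1 < C₁ := by linarith
  -- The thresholds are tuned for the last regime below. There some coordinate of `x - y` is at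
  -- least `w / d`; `κ₂` makes the regression shift `|1 - m| * M` at most half of this, and `κ₁`
  -- makes twice the interval radius at most the remaining half.
  set κ₁ : ℝ := 1 / (4 * d * C₁) with hκ₁
  set κ₂ : ℝ := 1 / (2 * d * (C * M + 1)) with hκ₂
  have hκ₁0 : 0 < κ₁ := by positivity
  have hκ₂0 : 0 < κ₂ := by positivity
  have hκ₁1 : κ₁ < 1 := by
    rw [hκ₁, div_lt_one (by positivity)]; nlinarith
  have hκ₂1 : κ₂ < 1 := by
    rw [hκ₂, div_lt_one (by positivity)]; nlinarith [mul_pos hC hM]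
  set F : ℝ := 8 ^ d * d.factorial with hF
  have hF0 : 0 < F := by positivity
  set K₁ : ℝ := (1 / (√c * κ₁)) ^ d
  set K₂ : ℝ := (C₁ / (c * κ₂)) ^ d
  set K₃ : ℝ := F * (2 * d * C₁ / √c) ^ d
  have hK₁ : 0 < K₁ := by positivity
  have hK₂ : 0 < K₂ := by positivity
  have hK₃ : 0 < K₃ := by positivity
  refine ⟨K₁ + K₂ + K₃, by positivity, fun s hs t ht x y hx ε hε => ?_⟩
  have hσs : 0 < σ s s := hc.trans_le (h.le_var s hs)
  refine (hX.measure_box_box_le s t hσs.ne' x y ε).trans ?_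
  set T : ℝ := dist s t ^ α with hT
  have hT0 : 0 ≤ T := Real.rpow_nonneg dist_nonneg _
  set m : ℝ := σ s t / σ s s with hm
  have hmC : |m| ≤ C := h.abs_slope_le s hs t ht
  set w : ℝ := max (max ‖x - y‖ ε) T with hw
  have hwε : ε ≤ w := (le_max_right _ _).trans (le_max_left _ _)
  have hw0 : 0 < w := hε.trans_le hwε
  set v : ℝ≥0 := (σ t t - σ s t ^ 2 / σ s s).toNNReal with hv
  have hvar0 : 0 ≤ σ t t - σ s t ^ 2 / σ s s := le_trans (by positivity) (h.le_condVar s hs t ht)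
  have hvv : (v : ℝ) = σ t t - σ s t ^ 2 / σ s s := Real.coe_toNNReal _ hvar0
  set ρ : ℝ := (1 + |m|) * ε with hρ
  have hρ0 : 0 < ρ := by positivity
  have hρC : ρ ≤ C₁ * ε := by rw [hρ, hC₁]; gcongr
  have hG1 : ∀ i, gaussianReal 0 (σ s s).toNNReal (Metric.ball (x i) ε) ≤
      ENNReal.ofReal (ε / √c) := fun i => by
    refine (gaussianReal_ball_le (by simpa using hσs) hε.le).trans (ENNReal.ofReal_le_ofReal ?_)
    rw [Real.coe_toNNReal _ hσs.le]
    gcongr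
    exact h.le_var s hs
  have hsum : ∀ i : Fin 3, ![K₁, K₂, K₃] i * ε ^ (2 * d) * w ^ (-(d : ℝ)) ≤
      (K₁ + K₂ + K₃) * ε ^ (2 * d) * w ^ (-(d : ℝ)) := fun i => by
    gcongr
    fin_cases i <;> simp <;> linarith
  have hwd : w ^ (-(d : ℝ)) = (1 / w) ^ d := by
    rw [Real.rpow_neg hw0.le, Real.rpow_natCast, one_div, inv_pow]
  rw [hwd] at hsum ⊢
  -- Regime where `w` is comparable to `ε`: the marginal law of `X_s` alone gives `ε ^ d`, and the
  -- event at time `t` is dropped.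
  by_cases h1 : κ₁ * w ≤ ε
  · refine (prod_le_ofReal_pow (A := ε / √c) (fun i => ?_) (by positivity)).trans
      (ENNReal.ofReal_le_ofReal (le_trans ?_ (hsum 0)))
    · exact (mul_le_of_le_one_right' prob_le_one).trans (hG1 i)
    · show (ε / √c) ^ d ≤ K₁ * ε ^ (2 * d) * (1 / w) ^ d
      rw [pow_mul, ← mul_pow, ← mul_pow]
      refine pow_le_pow_left₀ (by positivity) ?_ d
      calc ε / √c = (1 / (√c * κ₁)) * (ε * (κ₁ * w)) * (1 / w) := by field_simp
        _ ≤ (1 / (√c * κ₁)) * (ε * ε) * (1 / w) := by gcongr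
        _ = _ := by ring
  push Not at h1
  -- Regime where `w` is comparable to `T`: the residual has standard deviation at least `√c * T`,
  -- and its bounded density is enough.
  by_cases h2 : κ₂ * w ≤ T
  · have hT1 : 0 < T := lt_of_lt_of_le (by positivity) h2
    have hv1 : c * T ^ 2 ≤ v := hvv ▸ h.le_condVar s hs t ht
    have hv0 : v ≠ 0 := by
      rintro h0
      rw [h0, NNReal.coe_zero] at hv1
      have : 0 < c * T ^ 2 := by positivity
      linarith
    have hsv : √c * T ≤ √(v : ℝ) := by
      refine Real.le_sqrt_of_sq_le ?_
      rwa [mul_pow, Real.sq_sqrt hc.le]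
    refine (prod_le_ofReal_pow (A := ε / √c * (C₁ * ε / (√c * T))) (fun i => ?_)
      (by positivity)).trans (ENNReal.ofReal_le_ofReal (le_trans ?_ (hsum 1)))
    · rw [ENNReal.ofReal_mul (by positivity)]
      refine mul_le_mul' (hG1 i) ((gaussianReal_ball_le hv0 hρ0.le).trans
        (ENNReal.ofReal_le_ofReal ?_))
      gcongr
    · show (ε / √c * (C₁ * ε / (√c * T))) ^ d ≤ K₂ * ε ^ (2 * d) * (1 / w) ^ d
      rw [pow_mul, ← mul_pow, ← mul_pow]
      refine pow_le_pow_left₀ (by positivity) ?_ d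
      have hcc : √c * √c = c := Real.mul_self_sqrt hc.le
      calc ε / √c * (C₁ * ε / (√c * T)) = C₁ / (√c * √c) * ε ^ 2 * (1 / T) := by
            field_simp
        _ = C₁ / c * ε ^ 2 * (1 / T) := by rw [hcc]
        _ ≤ C₁ / c * ε ^ 2 * (1 / (κ₂ * w)) := by gcongr
        _ = _ := by field_simp
  push Not at h2
  -- Remaining regime: `ε` and `T` are small against `w`, so the points are far apart and the
  -- residual must make an atypically large move in coordinate `i₀`.
  have hwx : w = ‖x - y‖ := by
    rcases le_or_gt T (max ‖x - y‖ ε) with h3 | h3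
    · rcases le_or_gt ε ‖x - y‖ with h4 | h4
      · rw [hw, max_eq_left h3, max_eq_left h4]
      · have : w = ε := by rw [hw, max_eq_left h3, max_eq_right h4.le]
        rw [this] at h1
        exact absurd h1 (mul_lt_of_lt_one_left hε hκ₁1).not_gt
    · have : w = T := by rw [hw, max_eq_right h3.le]
      rw [this] at h2
      exact absurd h2 (mul_lt_of_lt_one_left (this ▸ hw0) hκ₂1).not_gt
  obtain ⟨i₀, hi₀⟩ := exists_norm_div_le_abs_coord hd (x - y)
  rw [← hwx] at hi₀
  set z : ℝ := y i₀ - m * x i₀ with hz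
  have hzw : w / (2 * d) ≤ |z| := by
    have e1 : |x i₀ - y i₀| ≤ |z| + |1 - m| * |x i₀| := by
      rw [← abs_mul]
      calc |x i₀ - y i₀| = |(1 - m) * x i₀ - z| := by rw [hz]; congr 1; ring
        _ ≤ _ := (abs_sub _ _).trans_eq (add_comm _ _)
    have e2 : |1 - m| * |x i₀| ≤ C * T * M := by
      gcongr
      · exact h.abs_one_sub_slope_le s hs t ht
      · exact (abs_coord_le_norm x i₀).trans hx
    have e3 : C * T * M ≤ w / (2 * d) := by
      calc C * T * M ≤ (C * M + 1) * T := by nlinarith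
        _ ≤ (C * M + 1) * (κ₂ * w) := by gcongr
        _ = w / (2 * d) := by rw [hκ₂]; field_simp
    have e4 : w / d = w / (2 * d) + w / (2 * d) := by field_simp; ring
    have e5 : |(x - y) i₀| = |x i₀ - y i₀| := rfl
    linarith
  have hzρ : 2 * ρ ≤ |z| := by
    refine le_trans ?_ hzw
    calc 2 * ρ ≤ 2 * (C₁ * ε) := by gcongr
      _ ≤ 2 * (C₁ * (κ₁ * w)) := by gcongr
      _ = _ := by rw [hκ₁]; field_simp; ring
  have hz0 : 0 < |z| := lt_of_lt_of_le (by positivity) hzw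
  -- With zero conditional variance the residual law is the point mass at `0`, which the interval
  -- around `z` misses.
  by_cases hv0 : v = 0
  · rw [Finset.prod_eq_zero (Finset.mem_univ i₀)]
    · exact zero_le
    · rw [hv0, gaussianReal_zero_var, Measure.dirac_apply' _ Metric.isOpen_ball.measurableSet,
        indicator_of_notMem, mul_zero]
      rw [Metric.mem_ball, Real.dist_eq, zero_sub, abs_neg]
      linarith
  · have hv' : 0 < √(v : ℝ) := Real.sqrt_pos.2 (by positivity)
    refine (prod_le_ofReal_pow_mul (A := ε / √c * (C₁ * ε / √(v : ℝ)))
      (E := F * (√(v : ℝ) / |z|) ^ d) i₀ (fun i => ?_) ?_ (by positivity) (by positivity)).trans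
      (ENNReal.ofReal_le_ofReal (le_trans ?_ (hsum 2)))
    · rw [ENNReal.ofReal_mul (by positivity)]
      refine mul_le_mul' (hG1 i) ((gaussianReal_ball_le hv0 hρ0.le).trans
        (ENNReal.ofReal_le_ofReal ?_))
      gcongr
    · rw [mul_assoc, ENNReal.ofReal_mul (by positivity)]
      refine mul_le_mul' (hG1 i₀) ((gaussianReal_ball_le_of_le hv0 d hρ0.le hzρ
        (abs_pos.1 hz0)).trans (ENNReal.ofReal_le_ofReal ?_))
      gcongr
    · show (ε / √c * (C₁ * ε / √(v : ℝ))) ^ d * (F * (√(v : ℝ) / |z|) ^ d) ≤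
        F * (2 * d * C₁ / √c) ^ d * ε ^ (2 * d) * (1 / w) ^ d
      -- The decay factor has exactly the power of `√v` needed to cancel the `d` densities, so no
      -- lower bound on `v` enters.
      have e : ε / √c * (C₁ * ε / √(v : ℝ)) * (√(v : ℝ) / |z|) ≤
          2 * d * C₁ / √c * ε ^ 2 * (1 / w) := by
        calc ε / √c * (C₁ * ε / √(v : ℝ)) * (√(v : ℝ) / |z|) = C₁ / √c * ε ^ 2 * (1 / |z|) := by
              field_simp
          _ ≤ C₁ / √c * ε ^ 2 * (1 / (w / (2 * d))) := by gcongr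
          _ = _ := by field_simp
      calc _ = F * (ε / √c * (C₁ * ε / √(v : ℝ)) * (√(v : ℝ) / |z|)) ^ d := by
            rw [mul_pow _ (√(v : ℝ) / |z|)]; ring
        _ ≤ F * (2 * d * C₁ / √c * ε ^ 2 * (1 / w)) ^ d := by gcongr
        _ = _ := by rw [mul_pow, mul_pow, pow_mul]; ring

/-- For `ε ≤ 1` the box stays where all coordinates are at most `M + 1`, and there the normal
densities with variances in `[c, C]` are uniformly bounded below. -/
lemma exists_le_measure_box (h : IncrementBounds σ α a b c C)
    (hX : IsCenteredGaussianField P X σ) {M : ℝ} (hM : 0 < M) :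
    ∃ K : ℝ, 0 < K ∧ ∀ t ∈ cube N a b, ∀ x : EuclideanSpace ℝ (Fin d),
      ‖x‖ ≤ M → ∀ ε : ℝ, 0 < ε → ε ≤ 1 →
        ENNReal.ofReal (K * ε ^ d) ≤ P {ω | X t ω ∈ box x ε} := by
  have hc := h.c_pos
  have hC := h.C_pos
  obtain ⟨k, hk, H⟩ := exists_le_gaussianReal_ball ((M + 1) / √c)
  refine ⟨(k / √C) ^ d, by positivity, fun t ht x hx ε hε hε1 => ?_⟩
  have hσ : 0 < σ t t := hc.trans_le (h.le_var t ht)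
  rw [hX.measure_box, ← mul_pow]
  refine ofReal_pow_le_prod (fun i => ?_) (by positivity)
  refine le_trans (ENNReal.ofReal_le_ofReal ?_) (H _ (by simpa using hσ) (x i) ε hε.le ?_)
  · rw [Real.coe_toNNReal _ hσ.le, div_mul_eq_mul_div, mul_div_assoc]
    have := h.var_le t ht
    gcongr
  · rw [Real.coe_toNNReal _ hσ.le, div_mul_eq_mul_div, le_div_iff₀ (by positivity)]
    have e1 := (abs_coord_le_norm x i).trans hx
    have e2 : √c ≤ √(σ t t) := Real.sqrt_le_sqrt (h.le_var t ht)
    calc (|x i| + ε) * √c ≤ (M + 1) * √c := by gcongr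
      _ ≤ _ := by gcongr

/-- A lower bound for the mass that the law of `X_t` given `X_s = y` puts on a box. -/
lemma exists_le_prod_gaussianReal_ball (h : IncrementBounds σ α a b c C) {M Λ : ℝ} (hM : 0 < M)
    (hΛ : 0 < Λ) :
    ∃ K : ℝ, 0 < K ∧ ∀ s ∈ cube N a b, ∀ t ∈ cube N a b, ∀ x y : EuclideanSpace ℝ (Fin d),
      ‖y‖ ≤ M → ∀ ε : ℝ, 0 < ε → max ‖y - x‖ ε ≤ Λ * dist s t ^ α →
        ENNReal.ofReal (K * ε ^ d * (dist s t ^ α) ^ (-(d : ℝ))) ≤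
          ∏ i, gaussianReal 0 (σ t t - σ s t ^ 2 / σ s s).toNNReal
            (Metric.ball (x i - σ s t / σ s s * y i) ε) := by
  have hc := h.c_pos
  have hC := h.C_pos
  -- The centre `x i - m * y i` is at most `Λ * T + C * M * T`, the radius at most `Λ * T`, and the
  -- standard deviation at least `√c * T`.
  obtain ⟨k, hk, H⟩ := exists_le_gaussianReal_ball ((2 * Λ + C * M) / √c)
  refine ⟨(k / √C) ^ d, by positivity, fun s hs t ht x y hy ε hε hle => ?_⟩
  set T : ℝ := dist s t ^ α with hT
  have hT0 : 0 < T := pos_of_mul_pos_right (hε.trans_le ((le_max_right _ _).trans hle)) hΛ.le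
  set m : ℝ := σ s t / σ s s with hm
  set v : ℝ≥0 := (σ t t - σ s t ^ 2 / σ s s).toNNReal with hv
  have hvar0 : 0 < σ t t - σ s t ^ 2 / σ s s :=
    lt_of_lt_of_le (by positivity) (h.le_condVar s hs t ht)
  have hvv : (v : ℝ) = σ t t - σ s t ^ 2 / σ s s := Real.coe_toNNReal _ hvar0.le
  have hv0 : v ≠ 0 := by simpa [hv] using hvar0
  have hv1 : √c * T ≤ √(v : ℝ) := by
    refine Real.le_sqrt_of_sq_le ?_
    rw [mul_pow, Real.sq_sqrt hc.le, hvv]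
    exact h.le_condVar s hs t ht
  have hv2 : √(v : ℝ) ≤ √C * T := by
    rw [Real.sqrt_le_left (by positivity), mul_pow, Real.sq_sqrt hC.le, hvv]
    exact h.condVar_le s hs t ht
  have hv3 : 0 < √(v : ℝ) := lt_of_lt_of_le (by positivity) hv1
  rw [Real.rpow_neg hT0.le, Real.rpow_natCast, ← inv_pow, ← mul_pow, ← mul_pow]
  refine ofReal_pow_le_prod (fun i => ?_) (by positivity)
  refine le_trans (ENNReal.ofReal_le_ofReal ?_) (H v hv0 (x i - m * y i) ε hε.le ?_)
  · calc k / √C * ε * T⁻¹ = k * (ε / (√C * T)) := by field_simp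
      _ ≤ _ := by gcongr
  · have e1 : |x i - m * y i| ≤ Λ * T + C * T * M := by
      calc |x i - m * y i| = |(1 - m) * y i - (y i - x i)| := by congr 1; ring
        _ ≤ |(1 - m) * y i| + |y i - x i| := abs_sub _ _
        _ ≤ C * T * M + Λ * T := by
            rw [abs_mul]
            gcongr
            · exact h.abs_one_sub_slope_le s hs t ht
            · exact (abs_coord_le_norm y i).trans hy
            · exact (abs_coord_le_norm (y - x) i).trans ((le_max_left _ _).trans hle)
        _ = _ := by ring
    have e2 : ε ≤ Λ * T := (le_max_right _ _).trans hle
    calc |x i - m * y i| + ε ≤ (2 * Λ + C * M) / √c * (√c * T) := by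
          have : (2 * Λ + C * M) / √c * (√c * T) = (2 * Λ + C * M) * T := by field_simp
          rw [this]; linarith
      _ ≤ _ := by gcongr

end IncrementBounds

end GaussianHitting

/-! ### Moments of the occupation functional and the Paley–Zygmund inequality. -/

namespace GaussianHitting

section General

variable {Θ Ω : Type*} [MeasurableSpace Θ] [MeasurableSpace Ω]

lemma sq_lintegral_mul_le {μ : Measure Ω} {f g : Ω → ℝ≥0∞} (hf : AEMeasurable f μ)
    (hg : AEMeasurable g μ) :
    (∫⁻ ω, f ω * g ω ∂μ) ^ 2 ≤ (∫⁻ ω, f ω ^ 2 ∂μ) * ∫⁻ ω, g ω ^ 2 ∂μ := by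
  have h := ENNReal.lintegral_mul_le_Lp_mul_Lq μ Real.HolderConjugate.two_two hf hg
  simp only [Pi.mul_apply, ENNReal.rpow_two] at h
  refine (pow_le_pow_left₀ zero_le h 2).trans_eq ?_
  rw [mul_pow, ← ENNReal.rpow_natCast, ← ENNReal.rpow_natCast, ← ENNReal.rpow_mul,
    ← ENNReal.rpow_mul]
  norm_num

lemma sq_lintegral_le {μ : Measure Ω} [IsProbabilityMeasure μ] {f : Ω → ℝ≥0∞}
    (hf : AEMeasurable f μ) : (∫⁻ ω, f ω ∂μ) ^ 2 ≤ ∫⁻ ω, f ω ^ 2 ∂μ := by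
  simpa using sq_lintegral_mul_le hf (aemeasurable_const (b := 1))

/-- The Paley–Zygmund inequality for the event that a nonnegative variable does not vanish. -/
lemma sq_lintegral_le_mul_measure_ne_zero {μ : Measure Ω} {f : Ω → ℝ≥0∞} (hf : Measurable f) :
    (∫⁻ ω, f ω ∂μ) ^ 2 ≤ (∫⁻ ω, f ω ^ 2 ∂μ) * μ {ω | f ω ≠ 0} := by
  have hS : MeasurableSet {ω | f ω ≠ 0} := (hf (measurableSet_singleton 0)).compl
  have h := sq_lintegral_mul_le (μ := μ) hf.aemeasurable
    ((measurable_const (a := (1 : ℝ≥0∞))).indicator hS).aemeasurable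
  have e1 : ∀ ω, f ω * {ω | f ω ≠ 0}.indicator (fun _ => (1 : ℝ≥0∞)) ω = f ω := fun ω => by
    by_cases h0 : f ω = 0
    · simp [h0]
    · rw [indicator_of_mem (by exact h0), mul_one]
  have e2 : ∀ ω, {ω | f ω ≠ 0}.indicator (fun _ => (1 : ℝ≥0∞)) ω ^ 2 =
      {ω | f ω ≠ 0}.indicator (fun _ => (1 : ℝ≥0∞)) ω := fun ω => by
    by_cases h0 : f ω = 0 <;> simp [indicator, h0]
  simp only [e1, e2, lintegral_indicator_const hS, one_mul] at h
  exact h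

variable {ν : Measure Θ} {P : Measure Ω} [SFinite ν] [SFinite P]

lemma measurable_measure_section {S : Set (Θ × Ω)} (hS : MeasurableSet S) :
    Measurable fun θ => P {ω | (θ, ω) ∈ S} :=
  measurable_measure_prodMk_left hS

lemma measurable_measure_section_inter {S : Set (Θ × Ω)} (hS : MeasurableSet S) :
    Measurable fun q : Θ × Θ => P {ω | (q.1, ω) ∈ S ∧ (q.2, ω) ∈ S} := by
  have hm1 : Measurable fun p : (Θ × Θ) × Ω => (p.1.1, p.2) := by fun_prop
  have hm2 : Measurable fun p : (Θ × Θ) × Ω => (p.1.2, p.2) := by fun_prop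
  exact measurable_measure_section (S := {p : (Θ × Θ) × Ω | (p.1.1, p.2) ∈ S ∧ (p.1.2, p.2) ∈ S})
    ((hm1 hS).inter (hm2 hS))

lemma measurable_measure_section_inter_right {S : Set (Θ × Ω)} (hS : MeasurableSet S) (θ : Θ) :
    Measurable fun θ' => P {ω | (θ, ω) ∈ S ∧ (θ', ω) ∈ S} :=
  (measurable_measure_section_inter hS).comp measurable_prodMk_left

lemma lintegral_measure_section {S : Set (Θ × Ω)} (hS : MeasurableSet S) :
    ∫⁻ ω, ν {θ | (θ, ω) ∈ S} ∂P = ∫⁻ θ, P {ω | (θ, ω) ∈ S} ∂ν := by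
  have h1 := Measure.prod_apply (μ := ν) (ν := P) hS
  rw [Measure.prod_apply_symm hS] at h1
  exact h1

/-- The square of a measure of a set is the product measure of its square; the rest is Tonelli. -/
lemma lintegral_measure_section_sq {S : Set (Θ × Ω)} (hS : MeasurableSet S) :
    ∫⁻ ω, ν {θ | (θ, ω) ∈ S} ^ 2 ∂P =
      ∫⁻ θ, ∫⁻ θ', P {ω | (θ, ω) ∈ S ∧ (θ', ω) ∈ S} ∂ν ∂ν := by
  set S2 : Set ((Θ × Θ) × Ω) := {p | (p.1.1, p.2) ∈ S ∧ (p.1.2, p.2) ∈ S} with hS2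
  have hm1 : Measurable fun p : (Θ × Θ) × Ω => (p.1.1, p.2) := by fun_prop
  have hm2 : Measurable fun p : (Θ × Θ) × Ω => (p.1.2, p.2) := by fun_prop
  have hS2m : MeasurableSet S2 := (hm1 hS).inter (hm2 hS)
  have h := lintegral_measure_section (ν := ν.prod ν) (P := P) hS2m
  rw [lintegral_prod _ (measurable_measure_section hS2m).aemeasurable] at h
  refine Eq.trans (lintegral_congr fun ω => ?_) h
  rw [sq, ← Measure.prod_prod]
  rfl

end General

variable {Ω : Type*} [mΩ : MeasurableSpace Ω] {P : Measure Ω} {N d : ℕ}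
  {X : Param N → Ω → EuclideanSpace ℝ (Fin d)} {σ : Param N → Param N → ℝ}

/-- The measure `dt ⊗ μ` over the cube `[a, b]^N`. -/
noncomputable def cubeProd (N : ℕ) (a b : ℝ≥0) (μ : Measure (EuclideanSpace ℝ (Fin d))) :
    Measure (Param N × EuclideanSpace ℝ (Fin d)) :=
  ((paramVolume N).restrict (cube N a b)).prod μ

/-- The pairs of a parameter and a centre, together with the sample points for which the value of
the field is in the box around the centre. -/
def boxSet (X : Param N → Ω → EuclideanSpace ℝ (Fin d)) (ε : ℝ) :
    Set ((Param N × EuclideanSpace ℝ (Fin d)) × Ω) :=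
  {p | X p.1.1 p.2 ∈ box p.1.2 ε}

/-- The occupation functional `∫ dt ∫ μ(dx) 1{X_t ∈ box x ε}`. -/
noncomputable def occupation (X : Param N → Ω → EuclideanSpace ℝ (Fin d)) (a b : ℝ≥0)
    (μ : Measure (EuclideanSpace ℝ (Fin d))) (ε : ℝ) (ω : Ω) : ℝ≥0∞ :=
  cubeProd N a b μ {θ | (θ, ω) ∈ boxSet X ε}

/-- The energy of `μ` for the Newtonian kernel truncated at distance `ε`. -/
noncomputable def truncatedEnergy (M β ε : ℝ) (μ : Measure (EuclideanSpace ℝ (Fin d))) : ℝ≥0∞ :=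
  ∫⁻ x, ∫⁻ y, ENNReal.ofReal (potential M β (max ‖x - y‖ ε)) ∂μ ∂μ

lemma measurable_potential (M β : ℝ) : Measurable (potential M β) := by
  unfold potential
  split_ifs <;> fun_prop

lemma measurable_truncatedKernel (M β ε : ℝ) :
    Measurable fun q : EuclideanSpace ℝ (Fin d) × EuclideanSpace ℝ (Fin d) =>
      ENNReal.ofReal (potential M β (max ‖q.1 - q.2‖ ε)) :=
  ((measurable_potential M β).comp (by fun_prop)).ennreal_ofReal

lemma measurable_truncatedKernel_right (M β ε : ℝ) (x : EuclideanSpace ℝ (Fin d)) :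
    Measurable fun y => ENNReal.ofReal (potential M β (max ‖x - y‖ ε)) :=
  ((measurable_potential M β).comp
    (by fun_prop : Measurable fun y => max ‖x - y‖ ε)).ennreal_ofReal

lemma measurable_lintegral_truncatedKernel (M β ε : ℝ) (μ : Measure (EuclideanSpace ℝ (Fin d)))
    [SFinite μ] :
    Measurable fun x => ∫⁻ y, ENNReal.ofReal (potential M β (max ‖x - y‖ ε)) ∂μ :=
  (measurable_truncatedKernel M β ε).lintegral_prod_right'

lemma measurable_coord_apply (i : Fin d) :
    Measurable fun x : EuclideanSpace ℝ (Fin d) => x i :=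
  (EuclideanSpace.proj (𝕜 := ℝ) i).continuous.measurable

lemma measurableSet_boxSet [P.IsComplete] (hX : IsCenteredGaussianField P X σ) (ε : ℝ) :
    MeasurableSet (boxSet X ε) := by
  have h1 : Measurable fun p : (Param N × EuclideanSpace ℝ (Fin d)) × Ω => X p.1.1 p.2 :=
    hX.measurable_uncurry.comp ((measurable_fst.comp measurable_fst).prodMk measurable_snd)
  have : boxSet X ε = ⋂ i, {p | |X p.1.1 p.2 i - p.1.2 i| < ε} := by
    ext p; simp [boxSet, box, Real.dist_eq]
  rw [this]
  refine MeasurableSet.iInter fun i => measurableSet_lt ?_ measurable_const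
  exact continuous_abs.measurable.comp (((measurable_coord_apply i).comp h1).sub
    ((measurable_coord_apply i).comp (measurable_snd.comp measurable_fst)))

instance (a b : ℝ≥0) (μ : Measure (EuclideanSpace ℝ (Fin d))) [SFinite μ] :
    SFinite (cubeProd N a b μ) := by unfold cubeProd; infer_instance

lemma isFiniteMeasure_cubeProd (a b : ℝ≥0) (μ : Measure (EuclideanSpace ℝ (Fin d)))
    [IsFiniteMeasure μ] : IsFiniteMeasure (cubeProd N a b μ) := by
  have : IsFiniteMeasure ((paramVolume N).restrict (cube N a b)) :=
    ⟨by rw [Measure.restrict_apply_univ]; exact paramVolume_cube_lt_top N a b⟩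
  unfold cubeProd; infer_instance

lemma measurable_occupation [P.IsComplete] (hX : IsCenteredGaussianField P X σ) (a b : ℝ≥0)
    (μ : Measure (EuclideanSpace ℝ (Fin d))) [SFinite μ] (ε : ℝ) :
    Measurable (occupation X a b μ ε) :=
  measurable_measure_prodMk_right (measurableSet_boxSet hX ε)

lemma lintegral_cubeProd (a b : ℝ≥0) (μ : Measure (EuclideanSpace ℝ (Fin d))) [SFinite μ]
    {f : Param N × EuclideanSpace ℝ (Fin d) → ℝ≥0∞} (hf : Measurable f) :
    ∫⁻ θ, f θ ∂cubeProd N a b μ = ∫⁻ x, ∫⁻ t in cube N a b, f (t, x) ∂paramVolume N ∂μ := by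
  rw [cubeProd, lintegral_prod_symm _ hf.aemeasurable]

lemma ae_norm_lt {M : ℝ} {μ : Measure (EuclideanSpace ℝ (Fin d))}
    (hμ : μ (Metric.ball 0 M)ᶜ = 0) : ∀ᵐ x ∂μ, ‖x‖ < M := by
  filter_upwards [measure_eq_zero_iff_ae_notMem.1 hμ] with x hx
  simpa using hx

namespace IncrementBounds

variable {α : ℝ} {a b : ℝ≥0} {c C : ℝ}

/-- The second moment of the occupation functional is controlled by the truncated energy. -/
lemma exists_lintegral_occupation_sq_le [P.IsComplete] (h : IncrementBounds σ α a b c C)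
    (hX : IsCenteredGaussianField P X σ) (hN : 0 < N) (hd : 0 < d) (hα : 0 < α) {M : ℝ}
    (hM : 0 < M) :
    ∃ K : ℝ, 0 < K ∧ ∀ ε : ℝ, 0 < ε → ε ≤ 2 * M →
      ∀ (μ : Measure (EuclideanSpace ℝ (Fin d))) [IsProbabilityMeasure μ],
        μ (Metric.ball 0 M)ᶜ = 0 →
        ∫⁻ ω, occupation X a b μ ε ω ^ 2 ∂P ≤
          ENNReal.ofReal (K * ε ^ (2 * d)) * truncatedEnergy M ((d : ℝ) - N / α) ε μ := by
  have := hX.isProbabilityMeasure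
  obtain ⟨K₁, hK₁, H₁⟩ := h.exists_measure_box_box_le hX hd hM
  obtain ⟨K₂, hK₂, H₂⟩ := lintegral_max_rpow_le hN hd hα hM a b
  set V : ℝ := (paramVolume N (cube N a b)).toReal with hV
  have hVV : paramVolume N (cube N a b) = ENNReal.ofReal V :=
    (ENNReal.ofReal_toReal (paramVolume_cube_lt_top N a b).ne).symm
  have hV0 : 0 ≤ V := ENNReal.toReal_nonneg
  -- `V + 1` keeps the constant positive even if the cube is null.
  refine ⟨K₁ * K₂ * (V + 1), by positivity, fun ε hε hεM μ _ hμ => ?_⟩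
  have hS := measurableSet_boxSet hX ε
  set β : ℝ := (d : ℝ) - N / α with hβ
  unfold occupation
  rw [lintegral_measure_section_sq hS,
    lintegral_cubeProd a b μ (measurable_measure_section_inter hS).lintegral_prod_right']
  have hin : ∀ s ∈ cube N a b, ∀ x : EuclideanSpace ℝ (Fin d), ‖x‖ < M →
      ∫⁻ θ', P {ω | ((s, x), ω) ∈ boxSet X ε ∧ (θ', ω) ∈ boxSet X ε} ∂cubeProd N a b μ ≤
        ENNReal.ofReal (K₁ * K₂ * ε ^ (2 * d)) *
          ∫⁻ y, ENNReal.ofReal (potential M β (max ‖x - y‖ ε)) ∂μ := by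
    intro s hs x hx
    rw [lintegral_cubeProd a b μ (measurable_measure_section_inter_right hS _),
      ← lintegral_const_mul _ (measurable_truncatedKernel_right M β ε x)]
    refine lintegral_mono_ae ?_
    filter_upwards [ae_norm_lt hμ] with y hy
    have hu : 0 < max ‖x - y‖ ε := lt_max_of_lt_right hε
    have huM : max ‖x - y‖ ε ≤ 2 * M := max_le ((norm_sub_le x y).trans (by linarith)) hεM
    calc ∫⁻ t in cube N a b, P {ω | X s ω ∈ box x ε ∧ X t ω ∈ box y ε} ∂paramVolume N
        ≤ ∫⁻ t in cube N a b, ENNReal.ofReal (K₁ * ε ^ (2 * d)) *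
            ENNReal.ofReal (max (max ‖x - y‖ ε) (dist s t ^ α) ^ (-(d : ℝ))) ∂paramVolume N := by
          refine setLIntegral_mono' (measurableSet_cube N a b) fun t ht => ?_
          rw [← ENNReal.ofReal_mul (by positivity)]
          exact H₁ s hs t ht x y hx.le ε hε
      _ = ENNReal.ofReal (K₁ * ε ^ (2 * d)) * ∫⁻ t in cube N a b,
            ENNReal.ofReal (max (max ‖x - y‖ ε) (dist s t ^ α) ^ (-(d : ℝ))) ∂paramVolume N := by
          rw [lintegral_const_mul _ (by fun_prop)]
      _ ≤ ENNReal.ofReal (K₁ * ε ^ (2 * d)) *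
            ENNReal.ofReal (K₂ * potential M β (max ‖x - y‖ ε)) := by
          gcongr; exact H₂ s _ hu huM
      _ = _ := by
          rw [ENNReal.ofReal_mul hK₂.le, ← mul_assoc, ← ENNReal.ofReal_mul (by positivity)]
          congr 2; ring
  calc _ ≤ ∫⁻ x, ENNReal.ofReal V * (ENNReal.ofReal (K₁ * K₂ * ε ^ (2 * d)) *
          ∫⁻ y, ENNReal.ofReal (potential M β (max ‖x - y‖ ε)) ∂μ) ∂μ := by
        refine lintegral_mono_ae ?_
        filter_upwards [ae_norm_lt hμ] with x hx
        refine (setLIntegral_mono' (measurableSet_cube N a b) fun s hs => hin s hs x hx).trans_eq ?_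
        rw [lintegral_const, Measure.restrict_apply_univ, hVV, mul_comm]
    _ = ENNReal.ofReal V * ENNReal.ofReal (K₁ * K₂ * ε ^ (2 * d)) * truncatedEnergy M β ε μ := by
        simp_rw [← mul_assoc]
        rw [lintegral_const_mul _ (measurable_lintegral_truncatedKernel M β ε μ), truncatedEnergy]
    _ ≤ _ := by
        gcongr
        rw [← ENNReal.ofReal_mul hV0]
        refine ENNReal.ofReal_le_ofReal ?_
        have : 0 < K₁ * K₂ * ε ^ (2 * d) := by positivity
        nlinarith

/-- A lower bound for the first moment of the occupation functional. -/
lemma exists_le_lintegral_occupation [P.IsComplete] (h : IncrementBounds σ α a b c C)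
    (hX : IsCenteredGaussianField P X σ) (hab : a < b) {M : ℝ} (hM : 0 < M) :
    ∃ K : ℝ, 0 < K ∧ ∀ ε : ℝ, 0 < ε → ε ≤ 1 →
      ∀ (μ : Measure (EuclideanSpace ℝ (Fin d))) [IsProbabilityMeasure μ],
        μ (Metric.ball 0 M)ᶜ = 0 →
        ENNReal.ofReal (K * ε ^ d) ≤ ∫⁻ ω, occupation X a b μ ε ω ∂P := by
  have := hX.isProbabilityMeasure
  obtain ⟨K₁, hK₁, H₁⟩ := h.exists_le_measure_box hX hM
  set V : ℝ := (paramVolume N (cube N a b)).toReal with hV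
  have hVV : paramVolume N (cube N a b) = ENNReal.ofReal V :=
    (ENNReal.ofReal_toReal (paramVolume_cube_lt_top N a b).ne).symm
  have hV0 : 0 < V :=
    ENNReal.toReal_pos (paramVolume_cube_pos N hab).ne' (paramVolume_cube_lt_top N a b).ne
  refine ⟨K₁ * V, by positivity, fun ε hε hε1 μ _ hμ => ?_⟩
  have hS := measurableSet_boxSet hX ε
  unfold occupation
  rw [lintegral_measure_section hS, lintegral_cubeProd a b μ (measurable_measure_section hS)]
  calc ENNReal.ofReal (K₁ * V * ε ^ d)
      = ∫⁻ _, ENNReal.ofReal (K₁ * V * ε ^ d) ∂μ := by simp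
    _ ≤ _ := by
      refine lintegral_mono_ae ?_
      filter_upwards [ae_norm_lt hμ] with x hx
      calc ENNReal.ofReal (K₁ * V * ε ^ d)
          = ∫⁻ _ in cube N a b, ENNReal.ofReal (K₁ * ε ^ d) ∂paramVolume N := by
            rw [lintegral_const, Measure.restrict_apply_univ, hVV,
              ← ENNReal.ofReal_mul (by positivity)]
            congr 1; ring
        _ ≤ _ := setLIntegral_mono' (measurableSet_cube N a b) fun t ht => H₁ t ht x hx.le ε hε hε1

/-- Positivity of the occupation functional has probability of order at least the inverse of the
truncated energy. -/
lemma exists_le_truncatedEnergy_mul_measure [P.IsComplete] (h : IncrementBounds σ α a b c C)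
    (hX : IsCenteredGaussianField P X σ) (hN : 0 < N) (hd : 0 < d) (hα : 0 < α) (hab : a < b)
    {M : ℝ} (hM : 0 < M) :
    ∃ K : ℝ, 0 < K ∧ ∀ ε : ℝ, 0 < ε → ε ≤ 2 * M → ε ≤ 1 →
      ∀ (μ : Measure (EuclideanSpace ℝ (Fin d))) [IsProbabilityMeasure μ],
        μ (Metric.ball 0 M)ᶜ = 0 →
        ENNReal.ofReal K ≤ truncatedEnergy M ((d : ℝ) - N / α) ε μ *
          P {ω | occupation X a b μ ε ω ≠ 0} := by
  obtain ⟨K₁, hK₁, H₁⟩ := h.exists_le_lintegral_occupation hX hab hM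
  obtain ⟨K₂, hK₂, H₂⟩ := h.exists_lintegral_occupation_sq_le hX hN hd hα hM
  refine ⟨K₁ ^ 2 / K₂, by positivity, fun ε hε hεM hε1 μ _ hμ => ?_⟩
  have h1 := sq_lintegral_le_mul_measure_ne_zero (μ := P) (measurable_occupation hX a b μ ε)
  have h2 := (pow_le_pow_left₀ zero_le (H₁ ε hε hε1 μ hμ) 2).trans
    (h1.trans (mul_le_mul_left (H₂ ε hε hεM μ hμ) _))
  rw [← ENNReal.ofReal_pow (by positivity), mul_assoc] at h2
  have hpos : 0 < K₂ * ε ^ (2 * d) := by positivity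
  -- The squared first moment and the second moment carry the same power of `ε`; after cancellation
  -- the bound survives `ε → 0`.
  have e : (K₁ * ε ^ d) ^ 2 = K₂ * ε ^ (2 * d) * (K₁ ^ 2 / K₂) := by
    rw [mul_pow, ← pow_mul, mul_comm d 2]; field_simp
  rw [e, ENNReal.ofReal_mul hpos.le] at h2
  exact (ENNReal.mul_le_mul_iff_right (by simpa using hpos) ENNReal.ofReal_ne_top).1 h2

end IncrementBounds

end GaussianHitting

/-! ### From approximate hits to hits, and the lower bound. -/

namespace GaussianHitting

section Hitting

variable {T E Ω : Type*} [TopologicalSpace T] [PseudoMetricSpace E]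

/-- The distance from `f t` to `A` attains its minimum on `K`, and that minimum is below every `r
n`. -/
lemma exists_mem_of_forall_infDist_le {K : Set T} (hK : IsCompact K) {A : Set E}
    (hA : IsClosed A) (hA0 : A.Nonempty) {f : T → E} (hf : ContinuousOn f K) {r : ℕ → ℝ}
    (hr : Filter.Tendsto r Filter.atTop (nhds 0))
    (h : ∀ n, ∃ t ∈ K, Metric.infDist (f t) A ≤ r n) : ∃ t ∈ K, f t ∈ A := by
  obtain ⟨t₁, ht₁, -⟩ := h 0
  obtain ⟨t, ht, hmin⟩ := hK.exists_isMinOn ⟨t₁, ht₁⟩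
    ((Metric.continuous_infDist_pt A).comp_continuousOn hf)
  refine ⟨t, ht, ?_⟩
  have h0 : Metric.infDist (f t) A ≤ 0 := ge_of_tendsto' hr fun n => by
    obtain ⟨u, hu, hun⟩ := h n
    exact (hmin hu).trans hun
  have := (hA.mem_iff_infDist_zero hA0).2 (le_antisymm h0 Metric.infDist_nonneg)
  exact this

variable [SecondCountableTopology T] [MeasurableSpace E] [BorelSpace E] [MeasurableSpace Ω]

/-- A continuous process hits a closed set over a compact set of parameters on a measurable set. -/
lemma measurableSet_exists_mem {K : Set T} (hK : IsCompact K) {A : Set E} (hA : IsClosed A)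
    {X : T → Ω → E} (hXc : ∀ ω, ContinuousOn (fun t => X t ω) K)
    (hXm : ∀ t ∈ K, Measurable (X t)) :
    MeasurableSet {ω | ∃ t ∈ K, X t ω ∈ A} := by
  rcases A.eq_empty_or_nonempty with rfl | hA0
  · simp
  rcases K.eq_empty_or_nonempty with rfl | hK0
  · simp
  have : Nonempty K := hK0.to_subtype
  set D : ℕ → K := TopologicalSpace.denseSeq K
  have hD : DenseRange D := TopologicalSpace.denseRange_denseSeq K
  -- A hit makes each open neighbourhood of `A` visible at a point of the countable dense set;
  -- conversely, approximate hits at all scales force a hit by compactness.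
  have : {ω | ∃ t ∈ K, X t ω ∈ A} =
      ⋂ n : ℕ, ⋃ k, {ω | Metric.infDist (X (D k) ω) A < 1 / ((n : ℝ) + 1)} := by
    ext ω
    simp only [mem_ofPred_eq, mem_iInter, mem_iUnion]
    constructor
    · rintro ⟨t, ht, hA⟩ n
      have hcont : Continuous fun u : K => Metric.infDist (X u ω) A :=
        (Metric.continuous_infDist_pt A).comp (continuousOn_iff_continuous_domRestrict.1 (hXc ω))
      have hopen : IsOpen {u : K | Metric.infDist (X u ω) A < 1 / ((n : ℝ) + 1)} :=
        isOpen_lt hcont continuous_const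
      exact hD.exists_mem_open hopen ⟨⟨t, ht⟩, by
        simp only [mem_ofPred_eq, Metric.infDist_zero_of_mem hA]; positivity⟩
    · intro h
      refine exists_mem_of_forall_infDist_le hK hA hA0 (hXc ω)
        tendsto_one_div_add_atTop_nhds_zero_nat fun n => ?_
      obtain ⟨k, hk⟩ := h n
      exact ⟨D k, (D k).2, hk.le⟩
  rw [this]
  exact MeasurableSet.iInter fun n => MeasurableSet.iUnion fun k =>
    measurableSet_lt ((Metric.continuous_infDist_pt A).measurable.comp (hXm _ (D k).2))
      measurable_const

end Hitting

variable {Ω : Type*} [mΩ : MeasurableSpace Ω] {P : Measure Ω} {N d : ℕ}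
  {X : Param N → Ω → EuclideanSpace ℝ (Fin d)} {σ : Param N → Param N → ℝ}

/-- The events decrease in `n` and their intersection is contained in the hitting event, so
continuity from above applies. -/
lemma le_hitProb_of_forall_infDist [P.IsComplete] (hX : IsCenteredGaussianField P X σ)
    (a b : ℝ≥0) {A : Set (EuclideanSpace ℝ (Fin d))} (hA : IsCompact A) (hA0 : A.Nonempty)
    {κ : ℝ≥0∞} {r : ℕ → ℝ} (hr : Filter.Tendsto r Filter.atTop (nhds 0)) (hr' : Antitone r)
    (h : ∀ n, κ ≤ P {ω | ∃ t ∈ cube N a b, Metric.infDist (X t ω) A ≤ r n}) :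
    κ ≤ hitProb P X a b A := by
  have := hX.isProbabilityMeasure
  set E : ℕ → Set Ω := fun n => {ω | ∃ t ∈ cube N a b, Metric.infDist (X t ω) A ≤ r n} with hE
  have hEm : ∀ n, MeasurableSet (E n) := fun n =>
    measurableSet_exists_mem (A := {y | Metric.infDist y A ≤ r n}) (isCompact_cube N a b)
      (isClosed_le (Metric.continuous_infDist_pt A) continuous_const)
      (fun ω => (hX.continuous_paths ω).continuousOn) fun t _ => hX.measurable t
  have hanti : Antitone E := fun n m hnm ω ⟨t, ht, hle⟩ => ⟨t, ht, hle.trans (hr' hnm)⟩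
  have hinter : ⋂ n, E n ⊆ {ω | ∃ t ∈ cube N a b, X t ω ∈ A} := fun ω hω =>
    exists_mem_of_forall_infDist_le (isCompact_cube N a b) hA.isClosed hA0
      (hX.continuous_paths ω).continuousOn hr fun n => mem_iInter.1 hω n
  refine le_trans ?_ (measure_mono hinter)
  rw [hanti.measure_iInter (fun n => (hEm n).nullMeasurableSet) ⟨0, measure_ne_top _ _⟩]
  exact le_iInf h

lemma infDist_le_of_mem_box (hd : 0 < d) {A : Set (EuclideanSpace ℝ (Fin d))}
    {x y : EuclideanSpace ℝ (Fin d)} {ε : ℝ} (hx : x ∈ A) (hy : y ∈ box x ε) :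
    Metric.infDist y A ≤ d * ε := by
  refine (Metric.infDist_le_dist_of_mem hx).trans ?_
  obtain ⟨i, hi⟩ := exists_norm_div_le_abs_coord hd (y - x)
  rw [div_le_iff₀ (by exact_mod_cast hd)] at hi
  have h1 := hy i
  rw [Metric.mem_ball, Real.dist_eq] at h1
  rw [dist_eq_norm]
  have h2 : |(y - x) i| ≤ ε := h1.le
  calc ‖y - x‖ ≤ |(y - x) i| * d := hi
    _ ≤ ε * d := by gcongr
    _ = _ := mul_comm _ _

lemma occupation_eq_zero {Ω : Type*} {X : Param N → Ω → EuclideanSpace ℝ (Fin d)} {a b : ℝ≥0}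
    {μ : Measure (EuclideanSpace ℝ (Fin d))} [SFinite μ] {A : Set (EuclideanSpace ℝ (Fin d))} (hμA : μ Aᶜ = 0)
    {ε : ℝ} {ω : Ω} (h : ∀ t ∈ cube N a b, ∀ x ∈ A, X t ω ∉ box x ε) :
    occupation X a b μ ε ω = 0 := by
  have hsub : {θ : Param N × EuclideanSpace ℝ (Fin d) | (θ, ω) ∈ boxSet X ε} ⊆
      ((cube N a b)ᶜ ×ˢ univ) ∪ (univ ×ˢ Aᶜ) := by
    rintro ⟨t, x⟩ hθ
    by_cases ht : t ∈ cube N a b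
    · exact Or.inr ⟨trivial, fun hx => h t ht x hx hθ⟩
    · exact Or.inl ⟨ht, trivial⟩
  refine measure_mono_null hsub (measure_union_null ?_ ?_)
  · rw [cubeProd, Measure.prod_prod, Measure.restrict_apply (measurableSet_cube N a b).compl]
    simp
  · rw [cubeProd, Measure.prod_prod, hμA, mul_zero]

/-- The kernel decreases with distance, so replacing `‖x - y‖` by `max ‖x - y‖ ε` can only lower it.
-/
lemma truncatedEnergy_le_energy {M β ε : ℝ} (hM : 0 < M) (hβ : 0 ≤ β)
    (μ : Measure (EuclideanSpace ℝ (Fin d))) :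
    truncatedEnergy M β ε μ ≤ energy (newtonKernel M β) μ := by
  refine lintegral_mono fun x => lintegral_mono fun y => ?_
  unfold newtonKernel
  split_ifs with h1 h2
  · exact le_top
  · have := potential_anti (M := M) (β := β) (norm_pos_iff.2 h1) (le_max_left ‖x - y‖ ε) hM
    refine ENNReal.ofReal_le_ofReal (this.trans_eq ?_)
    rw [potential, if_neg (by linarith), if_pos h2]
  · have := potential_anti (M := M) (β := β) (norm_pos_iff.2 h1) (le_max_left ‖x - y‖ ε) hM
    refine ENNReal.ofReal_le_ofReal (this.trans_eq ?_)
    rw [potential, if_neg (by linarith), if_neg h2]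

/-- The hitting probability is bounded below by the inverse of any bound for the truncated energies
of a probability measure carried by the target. -/
lemma IncrementBounds.exists_le_mul_hitProb [P.IsComplete] {α : ℝ} {a b : ℝ≥0} {c C : ℝ}
    (h : IncrementBounds σ α a b c C) (hX : IsCenteredGaussianField P X σ) (hN : 0 < N)
    (hd : 0 < d) (hα : 0 < α) (hab : a < b) {M : ℝ} (hM : 0 < M) :
    ∃ K : ℝ, 0 < K ∧ ∀ (A : Set (EuclideanSpace ℝ (Fin d))), IsCompact A → A.Nonempty →
      A ⊆ Metric.ball 0 M → ∀ (μ : Measure (EuclideanSpace ℝ (Fin d))) [IsProbabilityMeasure μ],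
        μ Aᶜ = 0 → ∀ I : ℝ≥0∞, (∀ ε, truncatedEnergy M ((d : ℝ) - N / α) ε μ ≤ I) →
        ENNReal.ofReal K * I⁻¹ ≤ hitProb P X a b A := by
  obtain ⟨K, hK, H⟩ := h.exists_le_truncatedEnergy_mul_measure hX hN hd hα hab hM
  refine ⟨K, hK, fun A hA hA0 hAM μ _ hμA I hI => ?_⟩
  -- Scales tending to `0` that respect both requirements `ε ≤ 2 * M` and `ε ≤ 1`.
  set e : ℕ → ℝ := fun n => min (2 * M) 1 * (1 / ((n : ℝ) + 1)) with he
  have hmin : 0 < min (2 * M) 1 := by positivity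
  have he0 : ∀ n, 0 < e n := fun n => by positivity
  have hen : ∀ n, e n ≤ min (2 * M) 1 := fun n =>
    mul_le_of_le_one_right hmin.le (by
      rw [div_le_one (by positivity)]; linarith [Nat.cast_nonneg (α := ℝ) n])
  refine le_hitProb_of_forall_infDist hX a b hA hA0 (r := fun n => d * e n) ?_ ?_ fun n => ?_
  · have := (tendsto_one_div_add_atTop_nhds_zero_nat (𝕜 := ℝ)).const_mul (min (2 * M) 1)
    simpa [he] using this.const_mul (d : ℝ)
  · intro n m hnm
    have : (n : ℝ) ≤ m := by exact_mod_cast hnm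
    simp only [he]
    gcongr
  · have h1 := H (e n) (he0 n) ((hen n).trans (min_le_left _ _)) ((hen n).trans (min_le_right _ _))
      μ (measure_mono_null (compl_subset_compl.2 hAM) hμA)
    have h2 : {ω | occupation X a b μ (e n) ω ≠ 0} ⊆
        {ω | ∃ t ∈ cube N a b, Metric.infDist (X t ω) A ≤ d * e n} := by
      intro ω hω
      by_contra hcon
      refine hω (occupation_eq_zero hμA fun t ht x hx hbox => hcon ⟨t, ht, ?_⟩)
      exact infDist_le_of_mem_box hd hx hbox
    rw [← div_eq_mul_inv]
    refine ENNReal.div_le_of_le_mul' (h1.trans ?_)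
    gcongr
    exact hI _

/-- The lower bound for the hitting probability. -/
theorem exists_mul_newtonCap_le_hitProb [P.IsComplete] (hX : IsCenteredGaussianField P X σ)
    (hN : 0 < N) (hd : 0 < d) {α γ : ℝ} (hα : 0 < α) (hγ : α ≤ γ) (hA1 : HypA1 σ α γ) {a b : ℝ≥0}
    (ha : 0 < a) (hab : a < b) {M : ℝ} (hM : 0 < M) :
    ∃ K₁ : ℝ≥0, 0 < K₁ ∧
      ∀ A : Set (EuclideanSpace ℝ (Fin d)), IsCompact A → A.Nonempty → A ⊆ Metric.ball 0 M →
        (K₁ : ℝ≥0∞) * newtonCap M ((d : ℝ) - (N : ℝ) / α) A ≤ hitProb P X a b A := by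
  obtain ⟨c, C, h⟩ := hA1.incrementBounds hα hγ ha hab
  obtain ⟨K, hK, H⟩ := h.exists_le_mul_hitProb hX hN hd hα hab hM
  refine ⟨K.toNNReal, by simpa using hK, fun A hA hA0 hAM => ?_⟩
  change ENNReal.ofReal K * _ ≤ _
  unfold newtonCap
  split_ifs with hβ
  -- For a negative index the truncated kernel is constantly `1`, so a point mass has energy `1` and
  -- a single point of `A` suffices.
  · obtain ⟨x, hx⟩ := hA0
    have := H A hA ⟨x, hx⟩ hAM (Measure.dirac x)
      (by rw [Measure.dirac_apply' _ hA.isClosed.isOpen_compl.measurableSet]; simp [hx]) 1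
      fun ε => by simp [truncatedEnergy, potential, hβ]
    simpa using this
  · unfold capacity
    simp only [ENNReal.inv_iInf, ENNReal.mul_iSup]
    refine iSup_le fun μ => iSup_le fun hμ => iSup_le fun hμA => ?_
    exact H A hA hA0 hAM μ hμA _ fun ε => truncatedEnergy_le_energy hM (not_lt.1 hβ) μ

end GaussianHitting

/-! ### Measurable selection of a hit point. -/

namespace GaussianHitting

/-- Measurable selection of a value in `A` that a continuous process takes on a compact set. -/
lemma exists_measurable_hit_value {T E Ω : Type*} [MetricSpace T] [PseudoMetricSpace E]
    [MeasurableSpace E] [BorelSpace E] [MeasurableSpace Ω] [Nonempty E]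
    {K : Set T} (hK : IsCompact K) {A : Set E} (hA : IsClosed A) {X : T → Ω → E}
    (hXc : ∀ ω, Continuous fun t => X t ω) (hXm : ∀ t, Measurable (X t)) :
    ∃ Z : Ω → E, Measurable Z ∧ ∀ ω, (∃ t ∈ K, X t ω ∈ A) → Z ω ∈ A ∧ ∃ t ∈ K, X t ω = Z ω := by
  classical
  rcases K.eq_empty_or_nonempty with rfl | hK0
  · exact ⟨fun _ => Classical.arbitrary E, measurable_const, fun ω ⟨t, ht, _⟩ => ht.elim⟩
  have : Nonempty K := hK0.to_subtype
  have : CompactSpace K := isCompact_iff_compactSpace.1 hK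
  have : CompactSpace cantorSet := isCompact_iff_compactSpace.1 isCompact_cantorSet
  -- The parameter set has no linear order. Reparametrising `K` by a continuous surjection from the
  -- Cantor set, which sits in the real line, provides a genuine first hitting point `τ`.
  obtain ⟨φ, hφc, hφs⟩ := exists_nat_bool_continuous_surjective_of_compact K
  set F : cantorSet → K := φ ∘ cantorSetHomeomorphNatToBool with hF
  have hFc : Continuous F := hφc.comp cantorSetHomeomorphNatToBool.continuous
  have hFs : Function.Surjective F := hφs.comp cantorSetHomeomorphNatToBool.surjective
  set Y : cantorSet → Ω → E := fun u ω => X (F u) ω with hY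
  have hYc : ∀ ω, Continuous fun u => Y u ω := fun ω =>
    (hXc ω).comp (continuous_subtype_val.comp hFc)
  have hYm : ∀ u, Measurable (Y u) := fun u => hXm _
  set H : Ω → Set cantorSet := fun ω => {u | Y u ω ∈ A} with hH
  have hHc : ∀ ω, IsCompact (H ω) := fun ω => (hA.preimage (hYc ω)).isCompact
  set τ : Ω → ℝ := fun ω => sInf ((↑) '' H ω) with hτ
  have hmem : ∀ ω, (H ω).Nonempty → ∃ u ∈ H ω, (u : ℝ) = τ ω := fun ω hne =>
    ((hHc ω).image continuous_subtype_val).sInf_mem (hne.image _)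
  have hempty : ∀ ω, ¬ (H ω).Nonempty → τ ω = 0 := fun ω hne => by
    rw [hτ]; simp only [not_nonempty_iff_eq_empty.1 hne, image_empty, Real.sInf_empty]
  have hτmem : ∀ ω, τ ω ∈ cantorSet := fun ω => by
    by_cases hne : (H ω).Nonempty
    · obtain ⟨u, -, hu⟩ := hmem ω hne
      exact hu ▸ u.2
    · rw [hempty ω hne]; exact zero_mem_cantorSet
  have hhit : ∀ c : ℝ, MeasurableSet {ω | ∃ u ∈ {u : cantorSet | (u : ℝ) ≤ c}, Y u ω ∈ A} :=
    fun c => measurableSet_exists_mem (isClosed_le continuous_subtype_val continuous_const).isCompact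
      hA (fun ω => (hYc ω).continuousOn) fun u _ => hYm u
  have hne : MeasurableSet {ω | (H ω).Nonempty} := by
    have := measurableSet_exists_mem (X := Y) isCompact_univ hA
      (fun ω => (hYc ω).continuousOn) fun u _ => hYm u
    simpa [hH, Set.Nonempty] using this
  have hτm : Measurable τ := by
    refine measurable_of_Iic fun c => ?_
    -- The second piece accounts for the default `sInf ∅ = 0` on paths that never hit `A`.
    have : τ ⁻¹' Iic c = {ω | ∃ u ∈ {u : cantorSet | (u : ℝ) ≤ c}, Y u ω ∈ A} ∪
        ({ω | (H ω).Nonempty}ᶜ ∩ {_ω | 0 ≤ c}) := by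
      ext ω
      simp only [mem_preimage, mem_Iic, mem_union, mem_ofPred_eq, mem_inter_iff, mem_compl_iff]
      constructor
      · intro h
        by_cases hne : (H ω).Nonempty
        · obtain ⟨u, hu, hu'⟩ := hmem ω hne
          exact Or.inl ⟨u, hu' ▸ h, hu⟩
        · exact Or.inr ⟨hne, hempty ω hne ▸ h⟩
      · rintro (⟨u, hu, huA⟩ | ⟨hne, h0⟩)
        · exact (csInf_le ((hHc ω).image continuous_subtype_val).bddBelow
            (mem_image_of_mem _ huA)).trans hu
        · exact (hempty ω hne).trans_le h0
    rw [this]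
    exact (hhit c).union (hne.compl.inter (MeasurableSet.const _))
  set τ' : Ω → cantorSet := fun ω => ⟨τ ω, hτmem ω⟩ with hτ'
  have hτ'm : Measurable τ' := hτm.subtype_mk
  refine ⟨fun ω => Y (τ' ω) ω,
    (measurable_uncurry_of_continuous_of_measurable hYc hYm).comp (hτ'm.prodMk measurable_id), ?_⟩
  rintro ω ⟨t, ht, hA⟩
  obtain ⟨u, hu⟩ := hFs ⟨t, ht⟩
  have hne : (H ω).Nonempty := ⟨u, by simp only [hH, hY, mem_ofPred_eq, hu]; exact hA⟩
  obtain ⟨w, hw, hwτ⟩ := hmem ω hne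
  have : τ' ω = w := Subtype.ext hwτ.symm
  change Y (τ' ω) ω ∈ A ∧ ∃ t ∈ K, X t ω = Y (τ' ω) ω
  rw [this]
  exact ⟨hw, F w, (F w).2, rfl⟩

end GaussianHitting

/-! ### Doob's and Cairoli's maximal inequalities in L². -/

namespace GaussianHitting

variable {Ω : Type*} {mΩ : MeasurableSpace Ω} {P : Measure Ω}

lemma integrable_of_mem_Icc [IsFiniteMeasure P] {Y : Ω → ℝ} (hY : Measurable Y) {B : ℝ}
    (hB : ∀ ω, Y ω ∈ Icc 0 B) : Integrable Y P :=
  Integrable.of_bound hY.aestronglyMeasurable B (Filter.Eventually.of_forall fun ω => by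
    rw [Real.norm_eq_abs, abs_of_nonneg (hB ω).1]; exact (hB ω).2)

/-- A version of the conditional expectation with values in the interval `[0, B]`. -/
lemma exists_condExp_mem_Icc [IsProbabilityMeasure P] {m : MeasurableSpace Ω} (hm : m ≤ mΩ)
    {Y : Ω → ℝ} (hY : Measurable[mΩ] Y) {B : ℝ} (hB : ∀ ω, Y ω ∈ Icc 0 B) :
    ∃ Z : Ω → ℝ, Measurable[m] Z ∧ (∀ ω, Z ω ∈ Icc 0 B) ∧ P[Y | m] =ᵐ[P] Z := by
  have hB0 : 0 ≤ B := by
    obtain ⟨ω⟩ : Nonempty Ω := P.nonempty_of_neZero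
    exact (hB ω).1.trans (hB ω).2
  refine ⟨fun ω => min B (max 0 ((P[Y | m]) ω)), ?_, fun ω => ⟨?_, min_le_left _ _⟩, ?_⟩
  · exact Measurable.min measurable_const
      (Measurable.max measurable_const stronglyMeasurable_condExp.measurable)
  · exact le_min hB0 (le_max_left _ _)
  · have h0 : 0 ≤ᵐ[P] P[Y | m] := condExp_nonneg (Filter.Eventually.of_forall fun ω => (hB ω).1)
    have h1 : P[Y | m] ≤ᵐ[P] P[fun _ => B | m] :=
      condExp_mono (integrable_of_mem_Icc hY hB) (integrable_const _)
        (Filter.Eventually.of_forall fun ω => (hB ω).2)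
    rw [condExp_const hm] at h1
    filter_upwards [h0, h1] with ω h0 h1
    rw [max_eq_right (by exact h0), min_eq_right h1]

lemma integral_condExp_mul_of_mem_Icc [IsProbabilityMeasure P] {m : MeasurableSpace Ω}
    (hm : m ≤ mΩ) {Y D : Ω → ℝ} {B : ℝ} (hY : Integrable Y P)
    (hD : Measurable[m] D) (hDB : ∀ ω, D ω ∈ Icc 0 B) :
    ∫ ω, (P[Y | m]) ω * D ω ∂P = ∫ ω, Y ω * D ω ∂P := by
  have hint : Integrable (fun ω => Y ω * D ω) P :=
    hY.mul_bdd (c := B) (hD.mono hm le_rfl).aestronglyMeasurable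
      (Filter.Eventually.of_forall fun ω => by
        rw [Real.norm_eq_abs, abs_of_nonneg (hDB ω).1]; exact (hDB ω).2)
  have h := condExp_mul_of_stronglyMeasurable_right (μ := P) (m := m) hD.stronglyMeasurable
    (f := Y) hint hY
  rw [← integral_condExp hm (f := fun ω => Y ω * D ω)]
  exact integral_congr_ae h.symm

/-- **Doob's maximal inequality** in `L²` along a finite subset of an increasing family of
`σ`-algebras. -/
lemma exists_doob_maximal [IsProbabilityMeasure P] {ι : Type*} [LinearOrder ι]
    {𝓖 : ι → MeasurableSpace Ω} (hmono : Monotone 𝓖) (hle : ∀ r, 𝓖 r ≤ mΩ) (R : Finset ι)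
    {Z : Ω → ℝ} (hZ : Measurable Z) {B : ℝ} (hB : ∀ ω, Z ω ∈ Icc 0 B) :
    ∃ S : Ω → ℝ, Measurable S ∧ (∀ ω, S ω ∈ Icc 0 B) ∧
      (∀ r ∈ R, P[Z | 𝓖 r] ≤ᵐ[P] S) ∧ ∫ ω, S ω ^ 2 ∂P ≤ 4 * ∫ ω, Z ω ^ 2 ∂P := by
  have hB0 : 0 ≤ B := by
    obtain ⟨ω⟩ : Nonempty Ω := P.nonempty_of_neZero
    exact (hB ω).1.trans (hB ω).2
  have hprod : ∀ {f g : Ω → ℝ}, Measurable f → Measurable g → (∀ ω, f ω ∈ Icc 0 B) →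
      (∀ ω, g ω ∈ Icc 0 B) → Integrable (fun ω => f ω * g ω) P := fun hf hg hfB hgB =>
    integrable_of_mem_Icc (B := B * B) (hf.mul hg) fun ω =>
      ⟨mul_nonneg (hfB ω).1 (hgB ω).1, mul_le_mul (hfB ω).2 (hgB ω).2 (hgB ω).1 hB0⟩
  -- The inductive claim is E[S²] ≤ 2 E[ZS] for the running maximum S, which is adapted to the last
  -- index. The factor `4` then follows from 2ZS ≤ 2Z² + S²/2, all terms being bounded.
  suffices H : ∃ S : Ω → ℝ, Measurable S ∧ (∀ u, (∀ r ∈ R, r ≤ u) → R.Nonempty → Measurable[𝓖 u] S) ∧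
      (R = ∅ → S = 0) ∧ (∀ ω, S ω ∈ Icc 0 B) ∧ (∀ r ∈ R, P[Z | 𝓖 r] ≤ᵐ[P] S) ∧
      ∫ ω, S ω * S ω ∂P ≤ 2 * ∫ ω, Z ω * S ω ∂P by
    obtain ⟨S, hSm, -, -, hSB, hS, hI⟩ := H
    refine ⟨S, hSm, hSB, hS, ?_⟩
    have h1 : 2 * ∫ ω, Z ω * S ω ∂P ≤ 2 * ∫ ω, Z ω * Z ω ∂P + 1 / 2 * ∫ ω, S ω * S ω ∂P := by
      rw [← integral_const_mul, ← integral_const_mul, ← integral_const_mul,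
        ← integral_add ((hprod hZ hZ hB hB).const_mul _) ((hprod hSm hSm hSB hSB).const_mul _)]
      refine integral_mono ((hprod hZ hSm hB hSB).const_mul _)
        (((hprod hZ hZ hB hB).const_mul _).add ((hprod hSm hSm hSB hSB).const_mul _)) fun ω => ?_
      simp only
      nlinarith [sq_nonneg (2 * Z ω - S ω)]
    simp_rw [pow_two]
    linarith
  induction R using Finset.induction_on_max with
  | empty => exact ⟨0, measurable_const, fun _ _ _ => measurable_const, fun _ => rfl,
      fun ω => ⟨le_rfl, hB0⟩, by simp, by simp⟩
  | insert u R hu ih =>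
    obtain ⟨S, hSm, hS𝓖, hS0, hSB, hS, hI⟩ := ih
    obtain ⟨M, hMm, hMB, hM⟩ := exists_condExp_mem_Icc (P := P) (hle u) hZ hB
    have hSu : Measurable[𝓖 u] S := by
      rcases R.eq_empty_or_nonempty with h | h
      · rw [hS0 h]; exact measurable_const
      · exact hS𝓖 u (fun r hr => (hu r hr).le) h
    have hMm' : Measurable M := hMm.mono (hle u) le_rfl
    set S' : Ω → ℝ := fun ω => max (S ω) (M ω) with hS'
    have hS'u : Measurable[𝓖 u] S' := Measurable.max hSu hMm
    have hS'm : Measurable S' := hS'u.mono (hle u) le_rfl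
    have hS'B : ∀ ω, S' ω ∈ Icc 0 B := fun ω =>
      ⟨(hSB ω).1.trans (le_max_left _ _), max_le (hSB ω).2 (hMB ω).2⟩
    refine ⟨S', hS'm, fun v hv _ => hS'u.mono (hmono (hv u (by simp))) le_rfl, by simp, hS'B,
      fun r hr => ?_, ?_⟩
    · rcases Finset.mem_insert.1 hr with rfl | hr
      · filter_upwards [hM] with ω hω
        rw [hω]; exact le_max_right _ _
      · filter_upwards [hS r hr] with ω hω
        exact hω.trans (le_max_left _ _)
    -- With S' = max(S, M), pointwise S'² ≤ S² + 2M(S' - S), because (M - S)² ≥ 0. The increment S'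
    -- - S is measurable at the new index, so M may be replaced by Z under the expectation and the
    -- bound telescopes.
    · have hDB : ∀ ω, S' ω - S ω ∈ Icc 0 B := fun ω =>
        ⟨sub_nonneg.2 (le_max_left _ _), by linarith [(hS'B ω).2, (hSB ω).1]⟩
      have e1 : ∫ ω, M ω * (S' ω - S ω) ∂P = ∫ ω, Z ω * (S' ω - S ω) ∂P := by
        rw [← integral_condExp_mul_of_mem_Icc (D := fun ω => S' ω - S ω) (hle u)
          (integrable_of_mem_Icc hZ hB) (hS'u.sub hSu) hDB]
        refine integral_congr_ae ?_
        filter_upwards [hM] with ω hω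
        simp only [hω]
      have e2 : ∫ ω, S' ω * S' ω ∂P ≤ ∫ ω, S ω * S ω ∂P + 2 * ∫ ω, M ω * (S' ω - S ω) ∂P := by
        have i1 := (hprod (g := fun ω => S' ω - S ω) hMm' (hS'm.sub hSm) hMB hDB).const_mul 2
        rw [← integral_const_mul, ← integral_add (hprod hSm hSm hSB hSB) i1]
        refine integral_mono (hprod hS'm hS'm hS'B hS'B) ((hprod hSm hSm hSB hSB).add i1) fun ω => ?_
        simp only [hS']
        rcases le_total (M ω) (S ω) with h | h
        · rw [max_eq_left h]; linarith
        · rw [max_eq_right h]; nlinarith [sq_nonneg (M ω - S ω)]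
      have e3 : ∫ ω, Z ω * (S' ω - S ω) ∂P = ∫ ω, Z ω * S' ω ∂P - ∫ ω, Z ω * S ω ∂P := by
        rw [← integral_sub (hprod hZ hS'm hB hS'B) (hprod hZ hSm hB hSB)]
        simp_rw [mul_sub]
      linarith

variable {N : ℕ} {𝓕 : Filtration (Param N) mΩ}

/-- The commutation hypothesis concerns bounded `𝓕 t`-measurable variables, so it is applied to a
bounded version of the inner conditional expectation; the tower property finishes. -/
lemma IsCommutingFiltration.condExp_condExp [IsProbabilityMeasure P]
    (h𝓕 : IsCommutingFiltration P 𝓕) (s t : Param N) {Y : Ω → ℝ} (hY : Measurable Y) {B : ℝ}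
    (hB : ∀ ω, Y ω ∈ Icc 0 B) :
    P[P[Y | 𝓕 t] | 𝓕 s] =ᵐ[P] P[Y | 𝓕 (s ⊓ t)] := by
  obtain ⟨Z, hZm, hZB, hZ⟩ := exists_condExp_mem_Icc (P := P) (𝓕.le t) hY hB
  have h1 : P[P[Y | 𝓕 t] | 𝓕 s] =ᵐ[P] P[Z | 𝓕 s] := condExp_congr_ae hZ
  have h2 : P[Z | 𝓕 s] =ᵐ[P] P[Z | 𝓕 (s ⊓ t)] :=
    h𝓕.commuting s t Z hZm ⟨B, fun ω => by rw [abs_of_nonneg (hZB ω).1]; exact (hZB ω).2⟩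
  have h3 : P[P[Y | 𝓕 t] | 𝓕 (s ⊓ t)] =ᵐ[P] P[Z | 𝓕 (s ⊓ t)] := condExp_congr_ae hZ
  have h4 : P[P[Y | 𝓕 t] | 𝓕 (s ⊓ t)] =ᵐ[P] P[Y | 𝓕 (s ⊓ t)] :=
    condExp_condExp_of_le (𝓕.mono inf_le_right) (𝓕.le t)
  exact h1.trans (h2.trans (h3.symm.trans h4))

/-- **Cairoli's maximal inequality** in `L²` over a finite grid. -/
lemma IsCommutingFiltration.exists_cairoli_maximal [IsProbabilityMeasure P]
    (h𝓕 : IsCommutingFiltration P 𝓕) (R : Finset ℝ≥0) {Y : Ω → ℝ} (hY : Measurable Y) {B : ℝ}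
    (hB : ∀ ω, Y ω ∈ Icc 0 B) :
    ∃ S : Ω → ℝ, Measurable S ∧ (∀ ω, S ω ∈ Icc 0 B) ∧
      (∀ s : Param N, (∀ i, s i ∈ R) → P[Y | 𝓕 s] ≤ᵐ[P] S) ∧
      ∫ ω, S ω ^ 2 ∂P ≤ 4 ^ (N + 1) * ∫ ω, Y ω ^ 2 ∂P := by
  obtain ⟨b, hb⟩ : ∃ b : ℝ≥0, ∀ r ∈ R, r ≤ b := ⟨R.sup id, fun r hr => Finset.le_sup (f := id) hr⟩
  -- Coordinates are released one at a time, the others being frozen at an upper bound `b` of the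
  -- grid. The meet of `trunc k s` with the parameter that equals `s` in coordinate `k` and `b`
  -- elsewhere is `trunc (k + 1) s`, so commutation and the one-parameter inequality apply at each
  -- stage.
  set trunc : ℕ → Param N → Param N := fun k s i => if (i : ℕ) < k then s i else b with htrunc
  suffices H : ∀ k ≤ N, ∃ S : Ω → ℝ, Measurable S ∧ (∀ ω, S ω ∈ Icc 0 B) ∧
      (∀ s : Param N, (∀ i, s i ∈ R) → P[Y | 𝓕 (trunc k s)] ≤ᵐ[P] S) ∧
      ∫ ω, S ω ^ 2 ∂P ≤ 4 ^ (k + 1) * ∫ ω, Y ω ^ 2 ∂P by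
    obtain ⟨S, h1, h2, h3, h4⟩ := H N le_rfl
    refine ⟨S, h1, h2, fun s hs => ?_, h4⟩
    have : trunc N s = s := by ext i; simp [htrunc]
    rw [← this]; exact h3 s hs
  intro k
  induction k with
  | zero =>
    intro _
    -- The start is the inequality at the single time `(b, …, b)`; it costs the extra factor `4` in
    -- `4 ^ (N + 1)`.
    obtain ⟨S, h1, h2, h3, h4⟩ := exists_doob_maximal (P := P)
      (𝓖 := fun r : ℝ≥0 => (𝓕 (fun _ => r) : MeasurableSpace Ω))
      (fun r r' h => 𝓕.mono fun _ => h) (fun r => 𝓕.le _) {b} hY hB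
    refine ⟨S, h1, h2, fun s _ => ?_, by simpa using h4⟩
    have : trunc 0 s = fun _ => b := by ext i; simp [htrunc]
    rw [this]; exact h3 b (by simp)
  | succ k ih =>
    intro hk
    obtain ⟨S, hSm, hSB, hS, hI⟩ := ih (by omega)
    set j : Fin N := ⟨k, by omega⟩ with hj
    obtain ⟨S', h1, h2, h3, h4⟩ := exists_doob_maximal (P := P)
      (𝓖 := fun r : ℝ≥0 => (𝓕 (Function.update (fun _ => b) j r) : MeasurableSpace Ω))
      (fun r r' h => 𝓕.mono (update_le_update_iff.2 ⟨h, fun _ _ => le_rfl⟩))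
      (fun r => 𝓕.le _) R hSm hSB
    refine ⟨S', h1, h2, fun s hs => ?_, ?_⟩
    · have hinf : Function.update (fun _ => b) j (s j) ⊓ trunc k s = trunc (k + 1) s := by
        ext i
        have hi := hb _ (hs i)
        by_cases hij : i = j
        · subst hij
          simpa [htrunc, hj] using hi
        · have hik : (i : ℕ) ≠ k := fun h => hij (Fin.ext h)
          simp only [Pi.inf_apply, Function.update_of_ne hij, htrunc]
          by_cases hlt : (i : ℕ) < k
          · rw [if_pos hlt, if_pos (by omega), inf_eq_right.2 hi]
          · rw [if_neg hlt, if_neg (by omega), inf_idem]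
      have e1 := h𝓕.condExp_condExp (Function.update (fun _ => b) j (s j)) (trunc k s) hY hB
      rw [hinf] at e1
      have e2 : P[P[Y | 𝓕 (trunc k s)] | 𝓕 (Function.update (fun _ => b) j (s j))] ≤ᵐ[P]
          P[S | 𝓕 (Function.update (fun _ => b) j (s j))] :=
        condExp_mono integrable_condExp (integrable_of_mem_Icc hSm hSB) (hS s hs)
      exact e1.symm.le.trans (e2.trans (h3 _ (hs j)))
    · calc _ ≤ 4 * ∫ ω, S ω ^ 2 ∂P := h4
        _ ≤ 4 * (4 ^ (k + 1) * ∫ ω, Y ω ^ 2 ∂P) := by gcongr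
        _ = _ := by ring

end GaussianHitting

/-! ### The residual is uncorrelated with the past. -/

namespace GaussianHitting

variable {Ω : Type*} [mΩ : MeasurableSpace Ω] {P : Measure Ω}

/-- Processes in the linear span of a Gaussian process are Gaussian. -/
lemma isGaussianProcess_of_mem_span {T S : Type*} {Z : T → Ω → ℝ} (hZ : IsGaussianProcess Z P)
    {Y : S → Ω → ℝ} (h : ∀ s, Y s ∈ Submodule.span ℝ (range Z)) : IsGaussianProcess Y P := by
  refine hZ.of_isGaussianProcess fun s => ?_
  obtain ⟨c, hc⟩ := (Finsupp.mem_span_range_iff_exists_finsupp).1 (h s)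
  refine ⟨c.support, ∑ i : c.support, c i • ContinuousLinearMap.proj (R := ℝ) (φ := fun _ : c.support => ℝ) i, fun ω => ?_⟩
  rw [← hc, Finsupp.sum, Finset.sum_apply, ← Finset.sum_coe_sort]
  simp

lemma gaussianReal_Ioi_pos (m : ℝ) {v : ℝ≥0} (hv : v ≠ 0) (K : ℝ) :
    0 < gaussianReal m v (Ioi K) := by
  rw [pos_iff_ne_zero]
  intro h
  have h1 := gaussianReal_absolutelyContinuous' m hv h
  simp at h1

lemma gaussianReal_ball_pos {v : ℝ≥0} (hv : v ≠ 0) {r : ℝ} (hr : 0 < r) (z : ℝ) :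
    0 < gaussianReal 0 v (Metric.ball z r) := by
  rw [pos_iff_ne_zero]
  intro h
  have h1 := gaussianReal_absolutelyContinuous' 0 hv h
  rw [Real.volume_ball, ENNReal.ofReal_eq_zero] at h1
  linarith

variable {N d : ℕ} {X : Param N → Ω → EuclideanSpace ℝ (Fin d)} {σ : Param N → Param N → ℝ}

lemma norm_le_of_mem_box (hd : 0 < d) {y : EuclideanSpace ℝ (Fin d)} (hy : y ∈ box 0 1) :
    ‖y‖ ≤ d := by
  obtain ⟨i, hi⟩ := exists_norm_div_le_abs_coord hd y
  rw [div_le_iff₀ (by exact_mod_cast hd)] at hi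
  have h1 := hy i
  simp only [PiLp.zero_apply, Metric.mem_ball, dist_zero_right, Real.norm_eq_abs] at h1
  have : (0 : ℝ) < d := by exact_mod_cast hd
  nlinarith

lemma measurableSet_box (x : EuclideanSpace ℝ (Fin d)) (ε : ℝ) : MeasurableSet (box x ε) := by
  have : box x ε = ⋂ i, (fun y : EuclideanSpace ℝ (Fin d) => y i) ⁻¹' Metric.ball (x i) ε := by
    ext y; simp [box]
  rw [this]
  exact MeasurableSet.iInter fun i => measurable_coord_apply i Metric.isOpen_ball.measurableSet

/-- If the conditional mean of an increment is bounded while `X_s` is bounded, then the residual of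
the increment in the regression on `X_s` is uncorrelated with every variable which is
`𝓕_s`-measurable and jointly Gaussian with `X`. -/
lemma covariance_residual_eq_zero [P.IsComplete] (hX : IsCenteredGaussianField P X σ)
    (𝓕 : Filtration (Param N) mΩ) {s t : Param N} (hs : 0 < σ s s)
    (hXs : Measurable[𝓕 s] (X s)) {H : Set (Ω → ℝ)}
    (hG : IsGaussianProcess
      (Sum.elim (fun (p : Param N × Fin d) (ω : Ω) => X p.1 ω p.2) (fun h : H => (h : Ω → ℝ))) P)
    {h : Ω → ℝ} (hH : h ∈ H) (hhm : Measurable[𝓕 s] h) {C : ℝ}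
    (hC : ∀ᵐ ω ∂P, ‖X s ω‖ ≤ d → ‖(P[fun ω' => X t ω' - X s ω' | 𝓕 s]) ω‖ ≤ C) (i : Fin d) :
    cov[residual X σ s t i, h; P] = 0 := by
  have := hX.isProbabilityMeasure
  -- A nonzero covariance would put into the increment an unbounded Gaussian term that is known at
  -- time `s` and independent of `X_s`. On an event of the past where this term is large and `X_s`
  -- is bounded, the mean of the increment would exceed `C`.
  by_contra hκ
  set κ : ℝ := cov[residual X σ s t i, h; P] with hκdef
  set Zp := Sum.elim (fun (p : Param N × Fin d) (ω : Ω) => X p.1 ω p.2) (fun h : H => (h : Ω → ℝ))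
  have hspanX : ∀ u j, (fun ω => X u ω j) ∈ Submodule.span ℝ (range Zp) := fun u j =>
    Submodule.subset_span ⟨Sum.inl (u, j), rfl⟩
  have hspanh : h ∈ Submodule.span ℝ (range Zp) := Submodule.subset_span ⟨Sum.inr ⟨h, hH⟩, rfl⟩
  have hL2h : MemLp h 2 P := (hG.hasGaussianLaw_eval (Sum.inr ⟨h, hH⟩)).memLp_two
  have hL2X := hX.memLp_coord
  have hL2W := hX.memLp_residual s t i
  set W : Ω → ℝ := residual X σ s t i with hW
  have hspanW : W ∈ Submodule.span ℝ (range Zp) :=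
    Submodule.sub_mem _ (hspanX t i) (Submodule.smul_mem _ (σ s t / σ s s) (hspanX s i))
  set Q : Ω → ℝ := ∑ j, (cov[h, fun ω => X s ω j; P] / σ s s) • (fun ω => X s ω j) with hQ
  have hspanQ : Q ∈ Submodule.span ℝ (range Zp) :=
    Submodule.sum_mem _ fun j _ => Submodule.smul_mem _ _ (hspanX s j)
  have hL2Q' : ∀ j ∈ Finset.univ, MemLp ((cov[h, fun ω => X s ω j; P] / σ s s) •
      (fun ω => X s ω j)) 2 P := fun j _ => (hL2X s j).const_smul _
  have hL2Q : MemLp Q 2 P := memLp_finsetSum' _ hL2Q'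
  -- `Q` is the regression of `h` on the coordinates of `X_s`, so `G` is orthogonal to `X_s`; the
  -- factor `κ` makes its covariance with `W` equal to `κ ^ 2 > 0` whatever the sign of `κ`.
  set G : Ω → ℝ := κ • (h - Q) with hGdef
  have hspanG : G ∈ Submodule.span ℝ (range Zp) :=
    Submodule.smul_mem _ _ (Submodule.sub_mem _ hspanh hspanQ)
  have hL2G : MemLp G 2 P := (hL2h.sub hL2Q).const_smul _
  have hXsj : ∀ j, Measurable[𝓕 s] fun ω => X s ω j := fun j =>
    (measurable_coord_apply j).comp hXs
  have hGm : Measurable[𝓕 s] G := by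
    have hQm : Measurable[𝓕 s] Q := by
      rw [show Q = fun ω => ∑ j, cov[h, fun ω => X s ω j; P] / σ s s * X s ω j by
        ext ω; simp [hQ]]
      exact Finset.measurable_sum _ fun j _ => (hXsj j).const_mul _
    exact (hhm.sub hQm).const_smul κ
  have hcovQ : ∀ {Y : Ω → ℝ}, MemLp Y 2 P → cov[Y, Q; P] =
      ∑ j, cov[h, fun ω => X s ω j; P] / σ s s * cov[Y, fun ω => X s ω j; P] := fun hY => by
    rw [hQ, covariance_sum_right' hL2Q' hY]
    simp_rw [covariance_smul_right]
  have hWG : cov[W, G; P] = κ * κ := by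
    rw [hGdef, covariance_smul_right, covariance_sub_right hL2W hL2h hL2Q, hcovQ hL2W]
    rw [← hκdef, Finset.sum_eq_zero fun j _ => by
      rw [hW, hX.covariance_residual_coord s t hs.ne', mul_zero], sub_zero]
  have hXG : ∀ j, cov[fun ω => X s ω j, G; P] = 0 := fun j => by
    rw [hGdef, covariance_smul_right, covariance_sub_right (hL2X s j) hL2h hL2Q, hcovQ (hL2X s j),
      Finset.sum_eq_single j, hX.covariance_coord, div_mul_cancel₀ _ hs.ne', covariance_comm]
    · simp
    · intro k _ hkj
      rw [hX.covariance_coord_ne _ _ hkj.symm, mul_zero]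
    · simp
  set g : ℝ := Var[G; P] with hg
  have hgG : cov[G, G; P] = g := covariance_self hL2G.aemeasurable
  have hg0 : 0 < g := by
    refine lt_of_le_of_ne (variance_nonneg _ _) fun h0 => ?_
    have hconst : G =ᵐ[P] fun _ => ∫ ω, G ω ∂P := by
      refine (evariance_eq_zero_iff hL2G.aemeasurable).1 ?_
      rw [← hL2G.ofReal_variance_eq, ← hg, ← h0, ENNReal.ofReal_zero]
    have : cov[W, G; P] = 0 := by
      refine integral_eq_zero_of_ae ?_
      filter_upwards [hconst] with ω hω
      simp [hω]
    rw [hWG] at this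
    exact hκ (mul_self_eq_zero.1 this)
  set l : ℝ := κ * κ / g with hl
  have hl0 : 0 < l := div_pos (mul_self_pos.2 hκ) hg0
  set R : Ω → ℝ := W - l • G with hR
  have hspanR : R ∈ Submodule.span ℝ (range Zp) :=
    Submodule.sub_mem _ hspanW (Submodule.smul_mem _ _ hspanG)
  have hL2R : MemLp R 2 P := hL2W.sub (hL2G.const_smul _)
  have hRG : cov[R, G; P] = 0 := by
    rw [hR, covariance_sub_left hL2W (hL2G.const_smul _) hL2G, covariance_smul_left, hWG, hgG, hl]
    field_simp; ring
  have hRX : ∀ j, cov[R, fun ω => X s ω j; P] = 0 := fun j => by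
    rw [hR, covariance_sub_left hL2W (hL2G.const_smul _) (hL2X s j), covariance_smul_left,
      covariance_comm G, hXG, hW, hX.covariance_residual_coord s t hs.ne']
    ring
  -- the pair `(G, X_s)` and the remainder `R` are independent
  set V : Option (Fin d) → Ω → ℝ := fun o => o.elim G fun j ω => X s ω j with hV
  have hind1 : IndepFun (fun ω (_ : Unit) => R ω) (fun ω o => V o ω) P := by
    refine IsGaussianProcess.indepFun_of_covariance_eq_zero (X := fun _ : Unit => R) (Y := V)
      (isGaussianProcess_of_mem_span hG ?_) (fun _ => hL2R.aemeasurable) ?_ ?_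
    · rintro (_ | _ | j)
      exacts [hspanR, hspanG, hspanX s j]
    · rintro (_ | j)
      exacts [hL2G.aemeasurable, (hL2X s j).aemeasurable]
    · rintro _ (_ | j)
      exacts [hRG, hRX j]
  have hind2 : IndepFun (fun ω (_ : Unit) => G ω) (fun ω j => X s ω j) P := by
    refine IsGaussianProcess.indepFun_of_covariance_eq_zero (X := fun _ : Unit => G)
      (Y := fun j ω => X s ω j)
      (isGaussianProcess_of_mem_span hG ?_) (fun _ => hL2G.aemeasurable) ?_ ?_
    · rintro (_ | j)
      exacts [hspanG, hspanX s j]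
    · exact fun j => (hL2X s j).aemeasurable
    · intro _ j
      rw [covariance_comm]; exact hXG j
  set c : ℝ := |σ s t / σ s s - 1| with hc
  -- Chosen so that over `B` the increment averages at least `C + 1`: the part `l * G` exceeds `l *
  -- K`, the remainder `R` has mean minus `l` times the mean of `G`, and the term in `X_s` is at
  -- least `-c`.
  set K : ℝ := (C + c + 1) / l + ∫ ω, G ω ∂P with hK
  set B : Set Ω := {ω | K < G ω} ∩ {ω | X s ω ∈ box 0 1} with hB
  have hBm : MeasurableSet[𝓕 s] B :=
    (measurableSet_lt measurable_const hGm).inter (hXs (measurableSet_box 0 1))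
  have hBm' : MeasurableSet B := 𝓕.le s _ hBm
  have hB0 : 0 < P B := by
    have e : P B = P {ω | K < G ω} * P {ω | X s ω ∈ box 0 1} := by
      have := hind2.measure_inter_preimage_eq_mul {f | K < f ()} {f | ∀ j, f j ∈ Metric.ball 0 1}
        (measurableSet_lt measurable_const (measurable_pi_apply ()))
        (by
          rw [show {f : Fin d → ℝ | ∀ j, f j ∈ Metric.ball 0 1} =
            univ.pi fun _ => Metric.ball 0 1 by ext; simp]
          exact MeasurableSet.univ_pi fun _ => Metric.isOpen_ball.measurableSet)
      exact this
    rw [e]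
    refine ENNReal.mul_pos ?_ ?_
    · have hlaw : HasGaussianLaw G P :=
        (isGaussianProcess_of_mem_span hG (S := Unit) (Y := fun _ => G)
          fun _ => hspanG).hasGaussianLaw_eval ()
      have := gaussianReal_Ioi_pos (∫ ω, G ω ∂P) (v := Var[G; P].toNNReal) (by simpa using hg0) K
      rw [← hlaw.map_eq_gaussianReal, Measure.map_apply_of_aemeasurable hL2G.aemeasurable
        measurableSet_Ioi] at this
      exact this.ne'
    · rw [hX.measure_box]
      exact Finset.prod_ne_zero_iff.2 fun j _ =>
        (gaussianReal_ball_pos (by simpa using hs) one_pos _).ne'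
  have hP : 0 < P.real B := ENNReal.toReal_pos hB0.ne' (measure_ne_top _ _)
  have hintX : ∀ u j, Integrable (fun ω => X u ω j) P := fun u j =>
    (hL2X u j).integrable one_le_two
  have hintG : Integrable G P := hL2G.integrable one_le_two
  have hintR : Integrable R P := hL2R.integrable one_le_two
  have hintXv : ∀ u, Integrable (X u) P := fun u =>
    (hX.gaussian.hasGaussianLaw_eval u).integrable
  have hnormB : ∀ ω ∈ B, ‖X s ω‖ ≤ d := fun ω hω => norm_le_of_mem_box i.pos hω.2
  -- upper bound for the mean of the increment over `B`
  have hup : ∫ ω in B, (X t ω i - X s ω i) ∂P ≤ C * P.real B := by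
    have e1 : ∫ ω in B, (X t ω i - X s ω i) ∂P = (∫ ω in B, (X t ω - X s ω) ∂P) i := by
      have := ContinuousLinearMap.integral_comp_comm (EuclideanSpace.proj (𝕜 := ℝ) i)
        (((hintXv t).sub (hintXv s)).integrableOn (s := B))
      simpa using this
    rw [e1]
    refine (le_abs_self _).trans ((abs_coord_le_norm _ i).trans ?_)
    have e2 := setIntegral_condExp (𝓕.le s) (f := fun ω => X t ω - X s ω)
      ((hintXv t).sub (hintXv s)) hBm
    rw [← e2]
    refine norm_setIntegral_le_of_norm_le_const_ae' (measure_lt_top _ _) ?_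
    filter_upwards [hC] with ω hω hωB
    exact hω (hnormB ω hωB)
  have hdecomp : ∀ ω, X t ω i - X s ω i = l * G ω + R ω + (σ s t / σ s s - 1) * X s ω i := by
    intro ω
    simp only [hR, hW, residual, Pi.sub_apply, Pi.smul_apply, smul_eq_mul]
    ring
  have hRB : ∫ ω in B, R ω ∂P = (∫ ω, R ω ∂P) * P.real B := by
    have hfun : IndepFun R (B.indicator fun _ => (1 : ℝ)) P := by
      have hD : MeasurableSet
          {f : Option (Fin d) → ℝ | K < f none ∧ ∀ j, f (some j) ∈ Metric.ball (0 : ℝ) 1} := by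
        rw [show {f : Option (Fin d) → ℝ | K < f none ∧ ∀ j, f (some j) ∈ Metric.ball (0 : ℝ) 1} =
          {f | K < f none} ∩ ⋂ j, (fun f : Option (Fin d) → ℝ => f (some j)) ⁻¹' Metric.ball 0 1 by
            ext; simp]
        exact (measurableSet_lt measurable_const (measurable_pi_apply none)).inter
          (MeasurableSet.iInter fun j => measurable_pi_apply _ Metric.isOpen_ball.measurableSet)
      exact hind1.comp (measurable_pi_apply ())
        ((measurable_const (a := (1 : ℝ))).indicator hD)
    have h2 := hfun.integral_mul_eq_mul_integral hL2R.aestronglyMeasurable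
      ((measurable_const.indicator hBm').aestronglyMeasurable)
    have h3 : (R * B.indicator fun _ => (1 : ℝ)) = B.indicator R := by
      ext ω; by_cases hω : ω ∈ B <;> simp [hω]
    rw [h3, integral_indicator hBm', integral_indicator_const _ hBm'] at h2
    simpa using h2
  have hRmean : ∫ ω, R ω ∂P = -(l * ∫ ω, G ω ∂P) := by
    have : ∫ ω, R ω ∂P = ∫ ω, W ω ∂P - ∫ ω, l * G ω ∂P :=
      integral_sub (hL2W.integrable one_le_two) (hintG.const_mul l)
    rw [this, hW, hX.integral_residual, integral_const_mul]
    ring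
  have hGB : K * P.real B ≤ ∫ ω in B, G ω ∂P := by
    have := setIntegral_mono_on (μ := P) (f := fun _ => K) (g := G) (integrableOn_const
      (measure_ne_top _ _)) hintG.integrableOn hBm' fun ω hω => le_of_lt hω.1
    rw [setIntegral_const, smul_eq_mul, mul_comm] at this
    exact this
  have hXB : -(c * P.real B) ≤ ∫ ω in B, (σ s t / σ s s - 1) * X s ω i ∂P := by
    have := norm_setIntegral_le_of_norm_le_const (μ := P) (s := B) (C := c)
      (f := fun ω => (σ s t / σ s s - 1) * X s ω i) (measure_lt_top _ _) fun ω hω => by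
        rw [norm_mul, Real.norm_eq_abs, Real.norm_eq_abs]
        refine mul_le_of_le_one_right (abs_nonneg _) ?_
        have := hω.2 i
        simp only [PiLp.zero_apply, Metric.mem_ball, dist_zero_right, Real.norm_eq_abs] at this
        exact this.le
    exact (abs_le.1 this).1
  have hlow : ∫ ω in B, (X t ω i - X s ω i) ∂P =
      l * ∫ ω in B, G ω ∂P + ∫ ω in B, R ω ∂P + ∫ ω in B, (σ s t / σ s s - 1) * X s ω i ∂P := by
    have h1 : Integrable (fun ω => l * G ω) (P.restrict B) := (hintG.const_mul l).integrableOn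
    have h2 : Integrable (fun ω => l * G ω + R ω) (P.restrict B) := h1.add hintR.integrableOn
    simp_rw [hdecomp]
    rw [integral_add h2 ((hintX s i).const_mul _).integrableOn, integral_add h1
      hintR.integrableOn, integral_const_mul]
  rw [hlow, hRB, hRmean] at hup
  have hlK : l * K = C + c + 1 + l * ∫ ω, G ω ∂P := by
    rw [hK]; field_simp
  have := mul_le_mul_of_nonneg_left hGB hl0.le
  rw [← mul_assoc, hlK] at this
  nlinarith

end GaussianHitting

/-! ### Conditional law of X_t given the past. -/

namespace GaussianHitting

section General

variable {Ω 𝓧 𝓨 : Type*} [mΩ : MeasurableSpace Ω] [MeasurableSpace 𝓧] [MeasurableSpace 𝓨]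
  {P : Measure Ω} [IsProbabilityMeasure P]

lemma measure_mem_eq_lintegral_of_indepFun {V : Ω → 𝓧} {W : Ω → 𝓨} (h : IndepFun V W P)
    (hV : Measurable V) (hW : Measurable W) {E : Set (𝓧 × 𝓨)} (hE : MeasurableSet E) :
    P {ω | (V ω, W ω) ∈ E} = ∫⁻ ω, P {ω' | (V ω, W ω') ∈ E} ∂P := by
  have h1 := (indepFun_iff_map_prod_eq_prod_map_map hV.aemeasurable hW.aemeasurable).1 h
  have h2 : P {ω | (V ω, W ω) ∈ E} = P.map (fun ω => (V ω, W ω)) E :=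
    (Measure.map_apply (hV.prodMk hW) hE).symm
  rw [h2, h1, Measure.prod_apply hE, lintegral_map (measurable_measure_prodMk_left hE) hV]
  exact lintegral_congr fun ω => Measure.map_apply hW (measurable_prodMk_left hE)

end General

variable {Ω : Type*} [mΩ : MeasurableSpace Ω] {P : Measure Ω} {N d : ℕ}
  {X : Param N → Ω → EuclideanSpace ℝ (Fin d)} {σ : Param N → Param N → ℝ}

/-- The residuals of the increments after `s` are independent of the past up to `s`. -/
lemma measure_residual_mem_inter [P.IsComplete] (hX : IsCenteredGaussianField P X σ)
    {𝓕 : Filtration (Param N) mΩ} (hG : IsGaussianFiltration P X 𝓕) {s t : Param N}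
    (hs : 0 < σ s s) (hXs : Measurable[𝓕 s] (X s)) {C : ℝ}
    (hC : ∀ᵐ ω ∂P, ‖X s ω‖ ≤ d → ‖(P[fun ω' => X t ω' - X s ω' | 𝓕 s]) ω‖ ≤ C)
    {S : Set Ω} (hS : MeasurableSet[𝓕 s] S) {D : Set (Fin d → ℝ)} (hD : MeasurableSet D) :
    P ({ω | (fun i => residual X σ s t i ω) ∈ D} ∩ S) =
      P {ω | (fun i => residual X σ s t i ω) ∈ D} * P S := by
  have := hX.isProbabilityMeasure
  obtain ⟨H, hGP, hHm, hHS⟩ := hG s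
  obtain ⟨S', hS', hSS'⟩ := hHS S hS
  have hind : IndepFun (fun ω i => residual X σ s t i ω) (fun ω (h : H) => (h : Ω → ℝ) ω) P := by
    refine IsGaussianProcess.indepFun_of_covariance_eq_zero (X := fun i => residual X σ s t i)
      (Y := fun (h : H) => (h : Ω → ℝ)) (isGaussianProcess_of_mem_span hGP ?_)
      (fun i => (hX.measurable_residual s t i).aemeasurable)
      (fun h => ((hHm h h.2).mono (𝓕.le s) le_rfl).aemeasurable) ?_
    · rintro (i | h)
      · exact Submodule.sub_mem _ (Submodule.subset_span ⟨Sum.inl (t, i), rfl⟩)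
          (Submodule.smul_mem _ (σ s t / σ s s) (Submodule.subset_span ⟨Sum.inl (s, i), rfl⟩))
      · exact Submodule.subset_span ⟨Sum.inr h, rfl⟩
    · exact fun i h => covariance_residual_eq_zero hX 𝓕 hs hXs hGP h.2 (hHm h h.2) hC i
  have hS'' : MeasurableSet[MeasurableSpace.comap (fun ω (h : H) => (h : Ω → ℝ) ω)
      MeasurableSpace.pi] S' := by
    rw [MeasurableSpace.pi, MeasurableSpace.comap_iSup,
      iSup_congr fun h : H => MeasurableSpace.comap_comp]
    exact hS'
  obtain ⟨D', hD', rfl⟩ := hS''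
  have h1 := hind.measure_inter_preimage_eq_mul D D' hD hD'
  rw [measure_congr hSS', measure_congr (Filter.EventuallyEq.inter
    (ae_eq_refl {ω | (fun i => residual X σ s t i ω) ∈ D}) hSS')]
  exact h1

/-- The conditional law of `X_t` given the past up to `s`. -/
lemma measure_inter_box_eq [P.IsComplete] (hX : IsCenteredGaussianField P X σ)
    {𝓕 : Filtration (Param N) mΩ} (hG : IsGaussianFiltration P X 𝓕) {s t : Param N}
    (hs : 0 < σ s s) (hXs : Measurable[𝓕 s] (X s)) {C : ℝ}
    (hC : ∀ᵐ ω ∂P, ‖X s ω‖ ≤ d → ‖(P[fun ω' => X t ω' - X s ω' | 𝓕 s]) ω‖ ≤ C)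
    {S : Set Ω} (hS : MeasurableSet[𝓕 s] S) (x : EuclideanSpace ℝ (Fin d)) (ε : ℝ) :
    P (S ∩ {ω | X t ω ∈ box x ε}) = ∫⁻ ω in S, ∏ i,
      gaussianReal 0 (σ t t - σ s t ^ 2 / σ s s).toNNReal
        (Metric.ball (x i - σ s t / σ s s * X s ω i) ε) ∂P := by
  have := hX.isProbabilityMeasure
  have hSm := 𝓕.le s S hS
  set q : ℝ := σ s t / σ s s with hq
  -- Adjoining the indicator of `S` makes the whole event a function of the independent pair `(V,
  -- W)`, so that `V` can be frozen and the residual integrated out.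
  set V : Ω → EuclideanSpace ℝ (Fin d) × ℝ := fun ω => (X s ω, S.indicator (fun _ => 1) ω) with hV
  have hVm : Measurable[𝓕 s] V :=
    Measurable.prodMk (m := 𝓕 s) hXs (Measurable.indicator (m := 𝓕 s) measurable_const hS)
  set W : Ω → Fin d → ℝ := fun ω i => residual X σ s t i ω with hW
  have hWm : Measurable W := measurable_pi_lambda _ fun i => hX.measurable_residual s t i
  have hind : IndepFun V W P := by
    refine IndepFun.symm ?_
    rw [indepFun_iff_measure_inter_preimage_eq_mul]
    intro D D' hD hD'
    exact measure_residual_mem_inter hX hG hs hXs hC (hVm hD') hD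
  set E : Set ((EuclideanSpace ℝ (Fin d) × ℝ) × (Fin d → ℝ)) :=
    {p | p.1.2 = 1} ∩ ⋂ i, {p | |p.2 i - (x i - q * p.1.1 i)| < ε} with hE
  have hEm : MeasurableSet E := by
    refine (measurableSet_eq_fun (measurable_snd.comp measurable_fst) measurable_const).inter
      (MeasurableSet.iInter fun i => measurableSet_lt ?_ measurable_const)
    exact continuous_abs.measurable.comp (((measurable_pi_apply i).comp measurable_snd).sub
      (measurable_const.sub (((measurable_coord_apply i).comp
        (measurable_fst.comp measurable_fst)).const_mul q)))
  have h1 := measure_mem_eq_lintegral_of_indepFun hind (hVm.mono (𝓕.le s) le_rfl) hWm hEm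
  have h2 : {ω | (V ω, W ω) ∈ E} = S ∩ {ω | X t ω ∈ box x ε} := by
    ext ω
    by_cases hω : ω ∈ S
    · simp only [hE, hV, hW, hω, mem_ofPred_eq, mem_inter_iff, indicator_of_mem, mem_iInter,
        true_and, box, Metric.mem_ball, Real.dist_eq, residual]
      refine forall_congr' fun i => ?_
      rw [← hq]
      ring_nf
    · simp [hE, hV, hω]
  rw [← h2, h1, ← lintegral_indicator hSm]
  refine lintegral_congr fun ω => ?_
  by_cases hω : ω ∈ S
  · rw [indicator_of_mem hω]
    have h3 := hX.measure_forall_coord s t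
      (B := fun i => {p : ℝ × ℝ | |(p.2 - q * p.1) - (x i - q * X s ω i)| < ε}) fun i =>
        measurableSet_lt (by fun_prop) measurable_const
    simp only [mem_ofPred_eq] at h3
    have h4 : {ω' | (V ω, W ω') ∈ E} =
        {ω' | ∀ i, |(X t ω' i - q * X s ω' i) - (x i - q * X s ω i)| < ε} := by
      ext ω'
      simp [hE, hV, hW, hω, residual, ← hq]
    rw [h4, h3]
    refine Finset.prod_congr rfl fun i _ => ?_
    rw [← hX.map_residual s t hs.ne' i, Measure.map_apply (hX.measurable_residual s t i)
      Metric.isOpen_ball.measurableSet]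
    congr 1
  · rw [indicator_of_notMem hω]
    have : {ω' | (V ω, W ω') ∈ E} = ∅ := by
      ext ω'
      simp [hE, hV, hω]
    rw [this, measure_empty]

end GaussianHitting

/-! ### Conditional mean of the occupation functional and the potential. -/

namespace GaussianHitting

/-- The usual comparison of set integrals is applied to the measure trimmed to `m`, where testing on
`m`-measurable sets is enough. -/
lemma ae_le_of_forall_setLIntegral_le_of_le {Ω : Type*} {m : MeasurableSpace Ω}
    [mΩ : MeasurableSpace Ω] (hm : m ≤ mΩ) {P : Measure Ω} [IsFiniteMeasure P] {f g : Ω → ℝ≥0∞}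
    (hf : Measurable[m] f) (hg : Measurable[m] g)
    (h : ∀ S, MeasurableSet[m] S → ∫⁻ ω in S, f ω ∂P ≤ ∫⁻ ω in S, g ω ∂P) : f ≤ᵐ[P] g := by
  refine ae_of_ae_trim hm ?_
  refine @ae_le_of_forall_setLIntegral_le_of_sigmaFinite Ω m (P.trim hm) inferInstance f g hf
    fun S hS _ => ?_
  rw [restrict_trim hm P hS, lintegral_trim hm hf, lintegral_trim hm hg]
  exact h S hS

variable {Ω : Type*} [mΩ : MeasurableSpace Ω] {P : Measure Ω} {N d : ℕ}
  {X : Param N → Ω → EuclideanSpace ℝ (Fin d)} {σ : Param N → Param N → ℝ}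

/-- The potential at `z` of the measure `μ`, for the kernel truncated at distance `ε`. -/
noncomputable def truncatedPotential (M β ε : ℝ) (μ : Measure (EuclideanSpace ℝ (Fin d)))
    (z : EuclideanSpace ℝ (Fin d)) : ℝ≥0∞ :=
  ∫⁻ x, ENNReal.ofReal (potential M β (max ‖z - x‖ ε)) ∂μ

lemma measurable_truncatedPotential (M β ε : ℝ) (μ : Measure (EuclideanSpace ℝ (Fin d)))
    [SFinite μ] : Measurable (truncatedPotential M β ε μ) :=
  measurable_lintegral_truncatedKernel M β ε μ

lemma measurable_dist_rpow (s : Param N) (α : ℝ) : Measurable fun t => dist s t ^ α :=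
  (measurable_const.dist measurable_id).pow_const α

lemma measurableSet_norm_le [P.IsComplete] (hX : IsCenteredGaussianField P X σ) (s : Param N)
    (α ε Λ : ℝ) :
    MeasurableSet {p : (Param N × EuclideanSpace ℝ (Fin d)) × Ω |
      max ‖X s p.2 - p.1.2‖ ε ≤ Λ * dist s p.1.1 ^ α} := by
  have h1 : Measurable fun p : (Param N × EuclideanSpace ℝ (Fin d)) × Ω => X s p.2 - p.1.2 :=
    ((hX.measurable s).comp measurable_snd).sub (measurable_snd.comp measurable_fst)
  have h2 : Measurable fun p : (Param N × EuclideanSpace ℝ (Fin d)) × Ω =>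
      Λ * dist s p.1.1 ^ α :=
    ((measurable_dist_rpow s α).comp (measurable_fst.comp measurable_fst)).const_mul Λ
  exact measurableSet_le (h1.norm.max measurable_const) h2

/-- The conditional mean of the occupation functional given the past up to `s` is bounded below by
the potential at `X_s`. -/
lemma IncrementBounds.exists_le_setLIntegral_occupation [P.IsComplete] {α : ℝ} {a b : ℝ≥0}
    {c C : ℝ} (h : IncrementBounds σ α a (b + 1) c C) (hX : IsCenteredGaussianField P X σ)
    {𝓕 : Filtration (Param N) mΩ} (hG : IsGaussianFiltration P X 𝓕) (had : Adapted 𝓕 X)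
    (hC : ∀ s ∈ cube N a (b + 1), ∀ t ∈ cube N a (b + 1), s ≤ t → ∃ C' : ℝ,
      ∀ᵐ ω ∂P, ‖X s ω‖ ≤ d → ‖(P[fun ω' => X t ω' - X s ω' | 𝓕 s]) ω‖ ≤ C')
    (hN : 0 < N) (hd : 0 < d) (hα : 0 < α) (hα1 : α < 1) {M : ℝ} (hM : 0 < M)
    (hβ : 0 ≤ (d : ℝ) - N / α) :
    ∃ k : ℝ, 0 < k ∧ ∀ ε : ℝ, 0 < ε → ε ≤ 2 * M →
      ∀ (μ : Measure (EuclideanSpace ℝ (Fin d))) [IsProbabilityMeasure μ],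
        μ (Metric.ball 0 M)ᶜ = 0 → ∀ s ∈ cube N a b, ∀ S : Set Ω, MeasurableSet[𝓕 s] S →
          (∀ ω ∈ S, ‖X s ω‖ ≤ M) →
          ∫⁻ ω in S, ENNReal.ofReal (k * ε ^ d) *
              truncatedPotential M ((d : ℝ) - N / α) ε μ (X s ω) ∂P ≤
            ∫⁻ ω in S, occupation X a (b + 1) μ ε ω ∂P := by
  have := hX.isProbabilityMeasure
  obtain ⟨K, hK, H₁⟩ := h.exists_le_prod_gaussianReal_ball (d := d) hM
    (Λ := 9 * M) (by positivity)
  obtain ⟨c', hc', H₂⟩ := le_lintegral_annulus hN hd hα hα1 hM hβ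
  refine ⟨K * c', by positivity, fun ε hε hεM μ _ hμ s hs S hS hSM => ?_⟩
  set β : ℝ := (d : ℝ) - N / α with hβd
  have hSm := 𝓕.le s S hS
  have hs' : s ∈ cube N a (b + 1) := fun i => ⟨(hs i).1, (hs i).2.trans (by simp)⟩
  have hss : 0 < σ s s := h.c_pos.trans_le (h.le_var s hs')
  have hbox := measurableSet_boxSet hX ε
  -- Only times in the unit corner cube above `s` whose distance to `s` is not too small for `‖X_s -
  -- x‖` and `ε` are kept. There the conditional standard deviation reaches the target box, and the
  -- conditional mass has the explicit lower bound `F`. The corner cube is why the occupation runs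
  -- up to `b + 1`.
  set T : Set ((Param N × EuclideanSpace ℝ (Fin d)) × Ω) :=
    {p | p.1.1 ∈ cornerCube s 1} ∩ {p | max ‖X s p.2 - p.1.2‖ ε ≤ 9 * M * dist s p.1.1 ^ α}
    with hT
  have hTm : MeasurableSet T :=
    ((measurable_fst.comp measurable_fst) (measurableSet_cornerCube s 1)).inter
      (measurableSet_norm_le hX s α ε _)
  set φ : Param N → ℝ≥0∞ := fun t => ENNReal.ofReal ((dist s t ^ α) ^ (-(d : ℝ))) with hφ
  have hφm : Measurable φ := ((measurable_dist_rpow s α).pow_const _).ennreal_ofReal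
  set F : (Param N × EuclideanSpace ℝ (Fin d)) × Ω → ℝ≥0∞ :=
    T.indicator fun p => ENNReal.ofReal (K * ε ^ d) * φ p.1.1 with hF
  have hFm : Measurable F :=
    ((hφm.comp (measurable_fst.comp measurable_fst)).const_mul _).indicator hTm
  have hle : ∀ θ : Param N × EuclideanSpace ℝ (Fin d), ∫⁻ ω in S, F (θ, ω) ∂P ≤
      (P.restrict S) {ω | (θ, ω) ∈ boxSet X ε} := by
    rintro ⟨t, x⟩
    by_cases ht : t ∈ cornerCube s 1
    · have ht' := cornerCube_subset_cube hs ht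
      have hst := le_of_mem_cornerCube ht
      obtain ⟨C', hC'⟩ := hC s hs' t ht' hst
      have hbm : MeasurableSet {ω | X t ω ∈ box x ε} := hX.measurable t (measurableSet_box x ε)
      change _ ≤ (P.restrict S) {ω | X t ω ∈ box x ε}
      rw [Measure.restrict_apply hbm, inter_comm, measure_inter_box_eq hX hG hss (had s) hC' hS]
      refine setLIntegral_mono' hSm fun ω hω => ?_
      by_cases hmem : ((t, x), ω) ∈ T
      · rw [hF, indicator_of_mem hmem, ← ENNReal.ofReal_mul (by positivity)]
        exact H₁ s hs' t ht' x (X s ω) (hSM ω hω) ε hε hmem.2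
      · rw [hF, indicator_of_notMem hmem]
        exact zero_le
    · have : ∀ ω, F ((t, x), ω) = 0 := fun ω => indicator_of_notMem (fun hmem => ht hmem.1) _
      simp [this]
  have hpt : ∀ ω ∈ S, ENNReal.ofReal (K * c' * ε ^ d) * truncatedPotential M β ε μ (X s ω) ≤
      ∫⁻ θ, F (θ, ω) ∂cubeProd N a (b + 1) μ := by
    intro ω hω
    rw [lintegral_cubeProd a (b + 1) μ (f := fun θ => F (θ, ω))
      (hFm.comp measurable_prodMk_right), truncatedPotential,
      ← lintegral_const_mul _ (measurable_truncatedKernel_right M β ε (X s ω))]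
    refine lintegral_mono_ae ?_
    filter_upwards [ae_norm_lt hμ] with x hx
    set u : ℝ := max ‖X s ω - x‖ ε with hu
    have hu0 : 0 < u := lt_max_of_lt_right hε
    have huM : u ≤ 2 * M :=
      max_le ((norm_sub_le _ x).trans (by linarith [hSM ω hω])) hεM
    set D : Set (Param N) := cornerCube s 1 ∩ {t | u ≤ 9 * M * dist s t ^ α} with hD
    have hDm : MeasurableSet D := (measurableSet_cornerCube s 1).inter
      (measurableSet_le measurable_const ((measurable_dist_rpow s α).const_mul _))
    calc ENNReal.ofReal (K * c' * ε ^ d) * ENNReal.ofReal (potential M β u)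
        = ENNReal.ofReal (K * ε ^ d) * ENNReal.ofReal (c' * potential M β u) := by
          rw [← ENNReal.ofReal_mul (by positivity), ← ENNReal.ofReal_mul (by positivity)]
          congr 1; ring
      _ ≤ ENNReal.ofReal (K * ε ^ d) * ∫⁻ t in D, φ t ∂paramVolume N := by
          gcongr
          exact H₂ s u hu0 huM
      _ = ∫⁻ t in D, F ((t, x), ω) ∂paramVolume N := by
          rw [← lintegral_const_mul _ hφm]
          exact setLIntegral_congr_fun hDm fun t ht => by
            simp only [hF]
            rw [indicator_of_mem (show ((t, x), ω) ∈ T from ht)]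
      _ ≤ _ := lintegral_mono_set (inter_subset_left.trans (cornerCube_subset_cube hs))
  calc _ ≤ ∫⁻ ω in S, ∫⁻ θ, F (θ, ω) ∂cubeProd N a (b + 1) μ ∂P := setLIntegral_mono' hSm hpt
    _ = ∫⁻ θ, ∫⁻ ω in S, F (θ, ω) ∂P ∂cubeProd N a (b + 1) μ :=
        (lintegral_lintegral_swap (f := fun θ ω => F (θ, ω)) hFm.aemeasurable).symm
    _ ≤ ∫⁻ θ, (P.restrict S) {ω | (θ, ω) ∈ boxSet X ε} ∂cubeProd N a (b + 1) μ :=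
        lintegral_mono hle
    _ = _ := (lintegral_measure_section hbox).symm

lemma occupation_le_measure_univ {Ω : Type*} {X : Param N → Ω → EuclideanSpace ℝ (Fin d)} (a b : ℝ≥0) (μ : Measure (EuclideanSpace ℝ (Fin d))) (ε : ℝ)
    (ω : Ω) : occupation X a b μ ε ω ≤ cubeProd N a b μ univ :=
  measure_mono (subset_univ _)

/-- The almost sure form of the lower bound for the conditional mean of the occupation
functional. -/
lemma IncrementBounds.exists_le_condExp_occupation [P.IsComplete] {α : ℝ} {a b : ℝ≥0}
    {c C : ℝ} (h : IncrementBounds σ α a (b + 1) c C) (hX : IsCenteredGaussianField P X σ)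
    {𝓕 : Filtration (Param N) mΩ} (hG : IsGaussianFiltration P X 𝓕) (had : Adapted 𝓕 X)
    (hC : ∀ s ∈ cube N a (b + 1), ∀ t ∈ cube N a (b + 1), s ≤ t → ∃ C' : ℝ,
      ∀ᵐ ω ∂P, ‖X s ω‖ ≤ d → ‖(P[fun ω' => X t ω' - X s ω' | 𝓕 s]) ω‖ ≤ C')
    (hN : 0 < N) (hd : 0 < d) (hα : 0 < α) (hα1 : α < 1) {M : ℝ} (hM : 0 < M)
    (hβ : 0 ≤ (d : ℝ) - N / α) :
    ∃ k : ℝ, 0 < k ∧ ∀ ε : ℝ, 0 < ε → ε ≤ 2 * M →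
      ∀ (μ : Measure (EuclideanSpace ℝ (Fin d))) [IsProbabilityMeasure μ],
        μ (Metric.ball 0 M)ᶜ = 0 → ∀ s ∈ cube N a b, ∀ᵐ ω ∂P, ‖X s ω‖ ≤ M →
          ENNReal.ofReal (k * ε ^ d) * truncatedPotential M ((d : ℝ) - N / α) ε μ (X s ω) ≤
            ENNReal.ofReal
              ((P[fun ω' => (occupation X a (b + 1) μ ε ω').toReal | 𝓕 s]) ω) := by
  have := hX.isProbabilityMeasure
  obtain ⟨k, hk, H⟩ := h.exists_le_setLIntegral_occupation hX hG had hC hN hd hα hα1 hM hβ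
  refine ⟨k, hk, fun ε hε hεM μ _ hμ s hs => ?_⟩
  have := isFiniteMeasure_cubeProd (N := N) a (b + 1) μ
  set β : ℝ := (d : ℝ) - N / α with hβd
  set B : Set Ω := {ω | ‖X s ω‖ ≤ M} with hB
  have hXs : Measurable[𝓕 s] (X s) := had s
  have hBm : MeasurableSet[𝓕 s] B := hXs (measurableSet_le measurable_norm measurable_const)
  set J : Ω → ℝ≥0∞ := occupation X a (b + 1) μ ε with hJ
  have hJm : Measurable J := measurable_occupation hX a (b + 1) μ ε
  have hJfin : ∀ ω, J ω ≠ ∞ := fun ω =>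
    ((occupation_le_measure_univ a (b + 1) μ ε ω).trans_lt (measure_lt_top _ _)).ne
  have hJint : Integrable (fun ω => (J ω).toReal) P :=
    integrable_of_mem_Icc hJm.ennreal_toReal (B := (cubeProd N a (b + 1) μ univ).toReal)
      fun ω => ⟨ENNReal.toReal_nonneg, ENNReal.toReal_mono (measure_ne_top _ _)
        (occupation_le_measure_univ a (b + 1) μ ε ω)⟩
  set f : Ω → ℝ≥0∞ := fun ω =>
    ENNReal.ofReal (k * ε ^ d) * truncatedPotential M β ε μ (X s ω) with hf
  have hfm : Measurable[𝓕 s] f :=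
    ((measurable_truncatedPotential M β ε μ).comp hXs).const_mul _
  set g : Ω → ℝ≥0∞ := fun ω => ENNReal.ofReal ((P[fun ω' => (J ω').toReal | 𝓕 s]) ω) with hg
  have hgm : Measurable[𝓕 s] g :=
    stronglyMeasurable_condExp.measurable.ennreal_ofReal
  have hnn : 0 ≤ᵐ[P] P[fun ω' => (J ω').toReal | 𝓕 s] :=
    condExp_nonneg (Filter.Eventually.of_forall fun ω => ENNReal.toReal_nonneg)
  have key : B.indicator f ≤ᵐ[P] g := by
    -- The estimate on events needs `‖X_s‖ ≤ M`, so a test set `S` is intersected with `B`, which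
    -- also belongs to the past.
    refine ae_le_of_forall_setLIntegral_le_of_le (𝓕.le s) (hfm.indicator hBm) hgm fun S hS => ?_
    have hSB : MeasurableSet[𝓕 s] (S ∩ B) := hS.inter hBm
    have e1 : ∫⁻ ω in S, g ω ∂P = ∫⁻ ω in S, J ω ∂P := by
      rw [hg, ← ofReal_integral_eq_lintegral_ofReal integrable_condExp.integrableOn
        (ae_restrict_of_ae hnn), setIntegral_condExp (𝓕.le s) hJint hS,
        ofReal_integral_eq_lintegral_ofReal hJint.integrableOn
          (Filter.Eventually.of_forall fun ω => ENNReal.toReal_nonneg)]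
      exact lintegral_congr fun ω => ENNReal.ofReal_toReal (hJfin ω)
    rw [e1, lintegral_indicator (𝓕.le s B hBm), Measure.restrict_restrict (𝓕.le s B hBm),
      inter_comm]
    exact (H ε hε hεM μ hμ s hs (S ∩ B) hSB fun ω hω => hω.2).trans
      (lintegral_mono_set inter_subset_left)
  filter_upwards [key] with ω hω hωB
  rwa [indicator_of_mem (by exact hωB)] at hω

end GaussianHitting

/-! ### Semicontinuity of potentials and energies, and a dense grid. -/

namespace GaussianHitting

open Filter Topology

section Kernel

variable {d : ℕ}

lemma continuousAt_potential {M β u : ℝ} (hM : 0 < M) (hu : 0 < u) :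
    ContinuousAt (potential M β) u := by
  unfold potential
  split_ifs
  · exact continuousAt_const
  · exact (continuousAt_const.div continuousAt_id hu.ne').log (by positivity : 3 * M / u ≠ 0)
  · exact Real.continuousAt_rpow_const u _ (Or.inl hu.ne')

/-- The truncated potential is lower semicontinuous along sequences. -/
lemma truncatedPotential_le_liminf {M β ε : ℝ} (hM : 0 < M) (hε : 0 < ε)
    (μ : Measure (EuclideanSpace ℝ (Fin d))) {z : EuclideanSpace ℝ (Fin d)}
    {y : ℕ → EuclideanSpace ℝ (Fin d)} (hy : Tendsto y atTop (𝓝 z)) :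
    truncatedPotential M β ε μ z ≤
      liminf (fun n => truncatedPotential M β ε μ (y n)) atTop := by
  refine le_trans (lintegral_mono fun x => ?_)
    (lintegral_liminf_le fun n => measurable_truncatedKernel_right M β ε (y n))
  refine le_of_eq (Tendsto.liminf_eq ?_).symm
  refine ENNReal.tendsto_ofReal ?_
  refine (continuousAt_potential hM (lt_max_of_lt_right hε)).tendsto.comp ?_
  exact ((hy.sub_const x).norm).max tendsto_const_nhds

lemma tendsto_potential_zero {M β : ℝ} (hM : 0 < M) (hβ : 0 ≤ β) :
    Tendsto (potential M β) (𝓝[>] 0) atTop := by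
  unfold potential
  simp only [if_neg (not_lt.2 hβ)]
  split_ifs with h
  · refine Real.tendsto_log_atTop.comp ?_
    exact tendsto_inv_nhdsGT_zero.const_mul_atTop (by positivity : (0 : ℝ) < 3 * M)
  · exact tendsto_rpow_neg_nhdsGT_zero (by
      rcases hβ.eq_or_lt with h' | h'
      exacts [(h h'.symm).elim, by linarith])

/-- Away from the origin the truncation is eventually inactive; at the origin the truncated values
tend to infinity. -/
lemma newtonKernel_le_liminf {M β : ℝ} (hM : 0 < M) (hβ : 0 ≤ β) {e : ℕ → ℝ}
    (he : Tendsto e atTop (𝓝[>] 0)) (x : EuclideanSpace ℝ (Fin d)) :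
    newtonKernel M β x ≤
      liminf (fun n => ENNReal.ofReal (potential M β (max ‖x‖ (e n)))) atTop := by
  have he0 : ∀ᶠ n in atTop, 0 < e n := he.eventually self_mem_nhdsWithin
  by_cases hx : x = 0
  · have : Tendsto (fun n => ENNReal.ofReal (potential M β (max ‖x‖ (e n)))) atTop (𝓝 ∞) := by
      refine ENNReal.tendsto_ofReal_nhds_top.2 ?_
      refine ((tendsto_potential_zero hM hβ).comp he).congr' ?_
      filter_upwards [he0] with n hn
      simp [hx, hn.le]
    rw [this.liminf_eq]
    exact le_top
  · have hx' : 0 < ‖x‖ := norm_pos_iff.2 hx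
    have hev : ∀ᶠ n in atTop, e n < ‖x‖ :=
      (tendsto_nhdsWithin_iff.1 he).1.eventually (gt_mem_nhds hx')
    refine le_liminf_of_le (by isBoundedDefault) ?_
    filter_upwards [hev] with n hn
    rw [max_eq_left hn.le]
    unfold newtonKernel potential
    rw [if_neg hx, if_neg (not_lt.2 hβ)]
    split_ifs <;> exact le_rfl

lemma energy_le_liminf {M β : ℝ} (hM : 0 < M) (hβ : 0 ≤ β) {e : ℕ → ℝ}
    (he : Tendsto e atTop (𝓝[>] 0)) (μ : Measure (EuclideanSpace ℝ (Fin d))) [SFinite μ] :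
    energy (newtonKernel M β) μ ≤ liminf (fun n => truncatedEnergy M β (e n) μ) atTop := by
  refine le_trans (lintegral_mono fun x => ?_)
    (lintegral_liminf_le fun n => measurable_lintegral_truncatedKernel M β (e n) μ)
  exact le_trans (lintegral_mono fun y => newtonKernel_le_liminf hM hβ he (x - y))
    (lintegral_liminf_le fun n => measurable_truncatedKernel_right M β (e n) x)

/-- Finiteness is what permits cancelling one factor of the truncated energy in the final estimate.
-/
lemma truncatedEnergy_lt_top {M β ε : ℝ} (hM : 0 < M) (hε : 0 < ε)
    (μ : Measure (EuclideanSpace ℝ (Fin d))) [IsFiniteMeasure μ] :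
    truncatedEnergy M β ε μ < ∞ := by
  refine lt_of_le_of_lt (lintegral_mono fun x => lintegral_mono fun y =>
    ENNReal.ofReal_le_ofReal (potential_anti hε (le_max_right ‖x - y‖ ε) hM)) ?_
  simp only [lintegral_const]
  finiteness

end Kernel

variable {Ω : Type*} [mΩ : MeasurableSpace Ω] {P : Measure Ω} {N d : ℕ}
  {X : Param N → Ω → EuclideanSpace ℝ (Fin d)} {σ : Param N → Param N → ℝ}

/-- Cairoli's inequality for bounded `[0, ∞]`-valued variables. -/
lemma IsCommutingFiltration.exists_cairoli_maximal_lintegral [IsProbabilityMeasure P]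
    {𝓕 : Filtration (Param N) mΩ} (h𝓕 : IsCommutingFiltration P 𝓕) (R : Finset ℝ≥0)
    {J : Ω → ℝ≥0∞} (hJ : Measurable J) {B : ℝ≥0∞} (hB : B ≠ ∞) (hJB : ∀ ω, J ω ≤ B) :
    ∃ S : Ω → ℝ≥0∞, Measurable S ∧
      (∀ s : Param N, (∀ i, s i ∈ R) →
        ∀ᵐ ω ∂P, ENNReal.ofReal ((P[fun ω' => (J ω').toReal | 𝓕 s]) ω) ≤ S ω) ∧
      ∫⁻ ω, S ω ^ 2 ∂P ≤ 4 ^ (N + 1) * ∫⁻ ω, J ω ^ 2 ∂P := by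
  have hJfin : ∀ ω, J ω ≠ ∞ := fun ω => ((hJB ω).trans_lt hB.lt_top).ne
  have hYB : ∀ ω, (J ω).toReal ∈ Icc 0 B.toReal := fun ω =>
    ⟨ENNReal.toReal_nonneg, ENNReal.toReal_mono hB (hJB ω)⟩
  have hsq : ∀ {Y : Ω → ℝ}, Measurable Y → (∀ ω, Y ω ∈ Icc 0 B.toReal) →
      ENNReal.ofReal (∫ ω, Y ω ^ 2 ∂P) = ∫⁻ ω, ENNReal.ofReal (Y ω) ^ 2 ∂P := by
    intro Y hY hYB
    rw [ofReal_integral_eq_lintegral_ofReal (integrable_of_mem_Icc (hY.pow_const 2)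
      (B := B.toReal ^ 2) fun ω => ⟨sq_nonneg _, pow_le_pow_left₀ (hYB ω).1 (hYB ω).2 2⟩)
      (Eventually.of_forall fun ω => sq_nonneg _)]
    exact lintegral_congr fun ω => ENNReal.ofReal_pow (hYB ω).1 2
  obtain ⟨S, hS, hSB, hle, hint⟩ := h𝓕.exists_cairoli_maximal R hJ.ennreal_toReal hYB
  refine ⟨fun ω => ENNReal.ofReal (S ω), hS.ennreal_ofReal, fun s hs => ?_, ?_⟩
  · filter_upwards [hle s hs] with ω hω
    exact ENNReal.ofReal_le_ofReal hω
  · rw [← hsq hS hSB]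
    refine (ENNReal.ofReal_le_ofReal hint).trans_eq ?_
    rw [ENNReal.ofReal_mul (by positivity), hsq hJ.ennreal_toReal hYB]
    congr 1
    · rw [ENNReal.ofReal_pow (by norm_num)]; norm_num
    · exact lintegral_congr fun ω => by rw [ENNReal.ofReal_toReal (hJfin ω)]

/-- A countable family of parameters which is dense in the cube, together with the finite sets that
contain the coordinates. -/
lemma exists_dense_grid (N : ℕ) {a b : ℝ≥0} (hab : a ≤ b) :
    ∃ q : ℕ → ℝ≥0, (∀ n, q n ∈ Icc a b) ∧ ∀ t ∈ cube N a b, ∃ w : ℕ → Fin N → ℕ,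
      Tendsto (fun j i => q (w j i)) atTop (𝓝 t) := by
  have : Nonempty (Icc a b) := ⟨⟨a, le_rfl, hab⟩⟩
  obtain ⟨q, hq⟩ := TopologicalSpace.exists_dense_seq (Icc a b)
  refine ⟨fun n => q n, fun n => (q n).2, fun t ht => ?_⟩
  have : ∀ i, ∃ w : ℕ → ℕ, Tendsto (fun j => ((q (w j) : Icc a b) : ℝ≥0)) atTop (𝓝 (t i)) := by
    intro i
    have h1 : (⟨t i, ht i⟩ : Icc a b) ∈ closure (range q) := hq _
    obtain ⟨y, hy, hlim⟩ := mem_closure_iff_seq_limit.1 h1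
    choose w hw using hy
    refine ⟨w, ?_⟩
    simp_rw [hw]
    exact (continuous_subtype_val.tendsto _).comp hlim
  choose w hw using this
  exact ⟨fun j i => w i j, tendsto_pi_nhds.2 hw⟩

end GaussianHitting

/-! ### Maximal inequality over the cube, and the upper bound. -/

namespace GaussianHitting

open Filter Topology

variable {Ω : Type*} [mΩ : MeasurableSpace Ω] {P : Measure Ω} {N d : ℕ}
  {X : Param N → Ω → EuclideanSpace ℝ (Fin d)} {σ : Param N → Param N → ℝ}

/-- Cairoli's inequality over the whole cube, for a lower semicontinuous function of a continuous
process which is dominated by the conditional means of a bounded variable. -/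
lemma IsCommutingFiltration.exists_maximal_of_le_condExp [IsProbabilityMeasure P]
    {𝓕 : Filtration (Param N) mΩ} (h𝓕 : IsCommutingFiltration P 𝓕)
    (hXc : ∀ ω, Continuous fun t => X t ω) {a b : ℝ≥0} (hab : a ≤ b)
    {J : Ω → ℝ≥0∞} (hJ : Measurable J) {B : ℝ≥0∞} (hB : B ≠ ∞) (hJB : ∀ ω, J ω ≤ B) {M : ℝ}
    {Φ : EuclideanSpace ℝ (Fin d) → ℝ≥0∞}
    (hΦ : ∀ (z : EuclideanSpace ℝ (Fin d)) (y : ℕ → EuclideanSpace ℝ (Fin d)),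
      Tendsto y atTop (𝓝 z) → Φ z ≤ liminf (fun n => Φ (y n)) atTop)
    (hle : ∀ s ∈ cube N a b, ∀ᵐ ω ∂P, ‖X s ω‖ ≤ M →
      Φ (X s ω) ≤ ENNReal.ofReal ((P[fun ω' => (J ω').toReal | 𝓕 s]) ω)) :
    ∃ T : Ω → ℝ≥0∞, ∫⁻ ω, T ω ∂P ≤ 4 ^ (N + 1) * ∫⁻ ω, J ω ^ 2 ∂P ∧
      ∀ᵐ ω ∂P, ∀ t ∈ cube N a b, ‖X t ω‖ < M → Φ (X t ω) ^ 2 ≤ T ω := by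
  classical
  obtain ⟨q, hq, hdense⟩ := exists_dense_grid N hab
  choose S hSm hSle hSint using fun n : ℕ =>
    h𝓕.exists_cairoli_maximal_lintegral ((Finset.range n).image q) hJ hB hJB
  -- The grids with coordinates among the first `n` points of the dense sequence increase, and each
  -- grid point belongs to all later ones. Fatou's lemma keeps the integral bound.
  refine ⟨fun ω => liminf (fun n => S n ω ^ 2) atTop, ?_, ?_⟩
  · refine (lintegral_liminf_le fun n => (hSm n).pow_const 2).trans ?_
    refine (liminf_le_liminf (Eventually.of_forall hSint)).trans_eq ?_
    exact tendsto_const_nhds.liminf_eq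
  · have h1 : ∀ᵐ ω ∂P, ∀ w : Fin N → ℕ, ‖X (fun i => q (w i)) ω‖ ≤ M →
        Φ (X (fun i => q (w i)) ω) ≤
          ENNReal.ofReal ((P[fun ω' => (J ω').toReal | 𝓕 fun i => q (w i)]) ω) :=
      ae_all_iff.2 fun w => hle _ fun i => hq (w i)
    have h2 : ∀ᵐ ω ∂P, ∀ (w : Fin N → ℕ) (n : ℕ), (∀ i, w i < n) →
        ENNReal.ofReal ((P[fun ω' => (J ω').toReal | 𝓕 fun i => q (w i)]) ω) ≤ S n ω := by
      refine ae_all_iff.2 fun w => ae_all_iff.2 fun n => ?_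
      by_cases hw : ∀ i, w i < n
      · filter_upwards [hSle n (fun i => q (w i)) fun i =>
          Finset.mem_image_of_mem q (Finset.mem_range.2 (hw i))] with ω hω _
        exact hω
      · exact Eventually.of_forall fun ω h => (hw h).elim
    filter_upwards [h1, h2] with ω h1 h2 t ht htM
    obtain ⟨w, hw⟩ := hdense t ht
    have hlim : Tendsto (fun j => X (fun i => q (w j i)) ω) atTop (𝓝 (X t ω)) :=
      ((hXc ω).tendsto t).comp hw
    have hev : ∀ᶠ j in atTop, ‖X (fun i => q (w j i)) ω‖ < M :=
      hlim.norm.eventually (gt_mem_nhds htM)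
    -- Semicontinuity along grid points tending to `t` replaces any path regularity of the
    -- conditional means. The strict bound at `t` ensures the weak one at the nearby grid points.
    have hkey : Φ (X t ω) ≤ liminf (fun n => S n ω) atTop := by
      refine (hΦ _ _ hlim).trans ?_
      refine liminf_le_of_le (by isBoundedDefault) fun y hy => ?_
      obtain ⟨j, hj, hjM⟩ := (hy.and hev).exists
      refine le_liminf_of_le (by isBoundedDefault) ?_
      filter_upwards [eventually_gt_atTop (Finset.univ.sup (w j))] with n hn
      exact hj.trans ((h1 (w j) hjM.le).trans
        (h2 (w j) n fun i => (Finset.le_sup (Finset.mem_univ i)).trans_lt hn))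
    refine (pow_le_pow_left₀ zero_le hkey 2).trans_eq ?_
    exact (pow_left_mono 2).map_liminf_of_continuousAt _
      (ENNReal.continuous_pow 2).continuousAt

/-- A hitting distribution of `A` has bounded energy, relative to the hitting probability. -/
lemma exists_hitProb_mul_energy_le [P.IsComplete] (hX : IsCenteredGaussianField P X σ)
    {𝓕 : Filtration (Param N) mΩ} (h𝓕 : IsCommutingFiltration P 𝓕) (had : Adapted 𝓕 X)
    (hG : IsGaussianFiltration P X 𝓕) {α γ : ℝ} (hα : 0 < α) (hα1 : α < 1) (hγ : α ≤ γ)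
    (hA1 : HypA1 σ α γ) (hA2 : HypA2 P X 𝓕 α γ) (hN : 0 < N) (hd : 0 < d)
    (hβ : 0 ≤ (d : ℝ) - N / α) {a b : ℝ≥0} (ha : 0 < a) (hab : a < b) {M : ℝ} (hM : 0 < M) :
    ∃ L : ℝ, 0 < L ∧ ∀ A : Set (EuclideanSpace ℝ (Fin d)), IsCompact A → A ⊆ Metric.ball 0 M →
      hitProb P X a b A ≠ 0 → ∃ μ : Measure (EuclideanSpace ℝ (Fin d)), IsProbabilityMeasure μ ∧
        μ Aᶜ = 0 ∧ hitProb P X a b A * energy (newtonKernel M ((d : ℝ) - N / α)) μ ≤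
          ENNReal.ofReal L := by
  have := hX.isProbabilityMeasure
  have hab1 : a < b + 1 := hab.trans (by simp)
  obtain ⟨c, C, h⟩ := hA1.incrementBounds hα hγ ha hab1
  have hC : ∀ s ∈ cube N a (b + 1), ∀ t ∈ cube N a (b + 1), s ≤ t → ∃ C' : ℝ,
      ∀ᵐ ω ∂P, ‖X s ω‖ ≤ d → ‖(P[fun ω' => X t ω' - X s ω' | 𝓕 s]) ω‖ ≤ C' := by
    -- The radius `d` is used because the unit box around `0` lies in the ball of that radius.
    obtain ⟨C₆, C₇, C₈, -, -, -, H⟩ := hA2 a (b + 1) ha hab1 d (by exact_mod_cast hd)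
    exact fun s hs t ht hst => ⟨_, (H s hs t ht hst).1⟩
  obtain ⟨k, hk, H₁⟩ := h.exists_le_condExp_occupation hX hG had hC hN hd hα hα1 hM hβ
  obtain ⟨K, hK, H₂⟩ := h.exists_lintegral_occupation_sq_le hX hN hd hα hM
  set β : ℝ := (d : ℝ) - N / α with hβd
  refine ⟨4 ^ (N + 1) * K / k ^ 2, by positivity, fun A hA hAM hp => ?_⟩
  obtain ⟨Z, hZm, hZ⟩ := exists_measurable_hit_value (isCompact_cube N a b) hA.isClosed
    hX.continuous_paths hX.measurable
  set E : Set Ω := {ω | ∃ t ∈ cube N a b, X t ω ∈ A} with hE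
  have hEm : MeasurableSet E := measurableSet_exists_mem (isCompact_cube N a b) hA.isClosed
    (fun ω => (hX.continuous_paths ω).continuousOn) fun t _ => hX.measurable t
  change P E ≠ 0 at hp
  have hpt : P E ≠ ∞ := measure_ne_top _ _
  have : IsProbabilityMeasure P[|E] := cond_isProbabilityMeasure hp
  -- The same `μ` serves as the hitting law and as the weight of the occupation functional; this is
  -- what makes the energy appear on both sides below.
  set μ : Measure (EuclideanSpace ℝ (Fin d)) := (P[|E]).map Z with hμ
  have hμp : IsProbabilityMeasure μ := Measure.isProbabilityMeasure_map hZm.aemeasurable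
  have hint : ∀ f : EuclideanSpace ℝ (Fin d) → ℝ≥0∞, Measurable f →
      P E * ∫⁻ z, f z ∂μ = ∫⁻ ω in E, f (Z ω) ∂P := fun f hf => by
    rw [hμ, lintegral_map hf hZm, ProbabilityTheory.cond, lintegral_smul_measure, smul_eq_mul,
      ← mul_assoc, ENNReal.mul_inv_cancel hp hpt, one_mul]
  have hμA : μ Aᶜ = 0 := by
    have hAm := hA.isClosed.isOpen_compl.measurableSet
    rw [hμ, Measure.map_apply hZm hAm, cond_apply hEm]
    have : E ∩ Z ⁻¹' Aᶜ = ∅ := by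
      ext ω
      simp only [mem_inter_iff, mem_preimage, mem_compl_iff, mem_empty_iff_false, iff_false,
        not_and, not_not]
      exact fun hω => (hZ ω hω).1
    rw [this, measure_empty, mul_zero]
  have hμM : μ (Metric.ball 0 M)ᶜ = 0 := measure_mono_null (compl_subset_compl.2 hAM) hμA
  refine ⟨μ, hμp, hμA, ?_⟩
  change P E * _ ≤ _
  have hbound : ∀ ε : ℝ, 0 < ε → ε ≤ 2 * M →
      truncatedEnergy M β ε μ ≤ ENNReal.ofReal (4 ^ (N + 1) * K / k ^ 2) / P E := by
    intro ε hε hεM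
    set I := truncatedEnergy M β ε μ with hI
    have hItop : I ≠ ∞ := (truncatedEnergy_lt_top hM hε μ).ne
    rcases eq_or_ne I 0 with hI0 | hI0
    · rw [hI0]; exact zero_le
    have := isFiniteMeasure_cubeProd (N := N) a (b + 1) μ
    set c' : ℝ≥0∞ := ENNReal.ofReal (k * ε ^ d) with hc'
    set U := truncatedPotential M β ε μ with hU
    have hUm : Measurable U := measurable_truncatedPotential M β ε μ
    obtain ⟨T, hT, hTle⟩ := h𝓕.exists_maximal_of_le_condExp hX.continuous_paths hab.le
      (measurable_occupation hX a (b + 1) μ ε) (measure_ne_top _ _)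
      (occupation_le_measure_univ a (b + 1) μ ε) (M := M) (Φ := fun z => c' * U z)
      (fun z y hy => by
        rw [ENNReal.liminf_const_mul_of_ne_top ENNReal.ofReal_ne_top]
        gcongr
        exact truncatedPotential_le_liminf hM hε μ hy)
      (H₁ ε hε hεM μ hμM)
    -- The maximal bound holds for all parameters simultaneously, so it may be read at the random
    -- one where the path takes the value `Z`.
    have h1 : P E * ∫⁻ z, (c' * U z) ^ 2 ∂μ ≤ ∫⁻ ω, T ω ∂P := by
      rw [hint _ ((hUm.const_mul c').pow_const 2)]
      refine (setLIntegral_mono_ae' hEm ?_).trans (setLIntegral_le_lintegral E T)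
      filter_upwards [hTle] with ω hω hωE
      obtain ⟨hZA, t, ht, htZ⟩ := hZ ω hωE
      have := hω t ht (by rw [htZ]; simpa using hAM hZA)
      rwa [htZ] at this
    -- The truncated energy is the `μ`-mean of its own potential, so Cauchy–Schwarz bounds its
    -- square.
    have h2 : c' ^ 2 * I ^ 2 ≤ ∫⁻ z, (c' * U z) ^ 2 ∂μ := by
      rw [← mul_pow]
      refine le_trans (le_of_eq ?_) (sq_lintegral_le (hUm.const_mul c').aemeasurable)
      rw [lintegral_const_mul _ hUm]
      rfl
    have h3 : P E * (c' ^ 2 * I ^ 2) ≤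
        4 ^ (N + 1) * (ENNReal.ofReal (K * ε ^ (2 * d)) * I) :=
      calc _ ≤ P E * ∫⁻ z, (c' * U z) ^ 2 ∂μ := by gcongr
        _ ≤ _ := h1.trans (hT.trans (by gcongr; exact H₂ ε hε hεM μ hμM))
    have e1 : c' ^ 2 = ENNReal.ofReal (k ^ 2 * ε ^ (2 * d)) := by
      rw [hc', ← ENNReal.ofReal_pow (by positivity)]
      congr 1; ring
    have e2 : (4 : ℝ≥0∞) ^ (N + 1) * ENNReal.ofReal (K * ε ^ (2 * d)) =
        ENNReal.ofReal (4 ^ (N + 1) * K / k ^ 2) * ENNReal.ofReal (k ^ 2 * ε ^ (2 * d)) := by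
      rw [← ENNReal.ofReal_mul (by positivity), show (4 : ℝ≥0∞) = ENNReal.ofReal 4 by norm_num,
        ← ENNReal.ofReal_pow (by norm_num), ← ENNReal.ofReal_mul (by positivity)]
      congr 1
      field_simp
    rw [e1, ← mul_assoc (4 ^ (N + 1)), e2] at h3
    set κ := ENNReal.ofReal (k ^ 2 * ε ^ (2 * d)) with hκ
    have hκ0 : κ * I ≠ 0 := mul_ne_zero (by
      rw [hκ, Ne, ENNReal.ofReal_eq_zero, not_le]; positivity) hI0
    have hκt : κ * I ≠ ∞ := ENNReal.mul_ne_top ENNReal.ofReal_ne_top hItop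
    rw [ENNReal.le_div_iff_mul_le (Or.inl hp) (Or.inl hpt)]
    -- The left side is quadratic in `I`, the right side linear; one factor `I` and the power of `ε`
    -- cancel.
    refine (ENNReal.mul_le_mul_iff_left hκ0 hκt).1 ?_
    calc I * P E * (κ * I) = P E * (κ * I ^ 2) := by ring
      _ ≤ _ := h3.trans_eq (by ring)
  set e : ℕ → ℝ := fun n => min (2 * M) 1 * (1 / ((n : ℝ) + 1)) with he
  have hmin : 0 < min (2 * M) 1 := by positivity
  have he0 : ∀ n, 0 < e n := fun n => by positivity
  have hen : ∀ n, e n ≤ 2 * M := fun n =>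
    (mul_le_of_le_one_right hmin.le (by
      rw [div_le_one (by positivity)]; linarith [Nat.cast_nonneg (α := ℝ) n])).trans
      (min_le_left _ _)
  have hlim : Tendsto e atTop (𝓝[>] 0) := by
    refine tendsto_nhdsWithin_iff.2 ⟨?_, Eventually.of_forall he0⟩
    simpa [he] using (tendsto_one_div_add_atTop_nhds_zero_nat (𝕜 := ℝ)).const_mul (min (2 * M) 1)
  have hfin : energy (newtonKernel M β) μ ≤ ENNReal.ofReal (4 ^ (N + 1) * K / k ^ 2) / P E := by
    refine (energy_le_liminf hM hβ hlim μ).trans ?_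
    refine (liminf_le_liminf (Eventually.of_forall fun n => hbound (e n) (he0 n) (hen n))).trans_eq
      tendsto_const_nhds.liminf_eq
  rw [ENNReal.le_div_iff_mul_le (Or.inl hp) (Or.inl hpt)] at hfin
  rwa [mul_comm]

/-- The upper bound for the hitting probability. -/
theorem exists_hitProb_le_mul_newtonCap [P.IsComplete] (hX : IsCenteredGaussianField P X σ)
    {𝓕 : Filtration (Param N) mΩ} (h𝓕 : IsCommutingFiltration P 𝓕) (had : Adapted 𝓕 X)
    (hG : IsGaussianFiltration P X 𝓕) {α γ : ℝ} (hα : 0 < α) (hα1 : α < 1) (hγ : α ≤ γ)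
    (hA1 : HypA1 σ α γ) (hA2 : HypA2 P X 𝓕 α γ) (hN : 0 < N) (hd : 0 < d)
    {a b : ℝ≥0} (ha : 0 < a) (hab : a < b) {M : ℝ} (hM : 0 < M) :
    ∃ K₂ : ℝ≥0, 0 < K₂ ∧
      ∀ A : Set (EuclideanSpace ℝ (Fin d)), IsCompact A → A ⊆ Metric.ball 0 M →
        hitProb P X a b A ≤ (K₂ : ℝ≥0∞) * newtonCap M ((d : ℝ) - (N : ℝ) / α) A := by
  have := hX.isProbabilityMeasure
  by_cases hβ : (d : ℝ) - N / α < 0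
  · refine ⟨1, one_pos, fun A _ _ => ?_⟩
    rw [newtonCap, if_pos hβ, ENNReal.coe_one, one_mul]
    exact prob_le_one
  · obtain ⟨L, hL, H⟩ := exists_hitProb_mul_energy_le hX h𝓕 had hG hα hα1 hγ hA1 hA2 hN hd
      (not_lt.1 hβ) ha hab hM
    refine ⟨L.toNNReal, by simpa using hL, fun A hA hAM => ?_⟩
    change _ ≤ ENNReal.ofReal L * _
    rcases eq_or_ne (hitProb P X a b A) 0 with hp | hp
    · rw [hp]; exact zero_le
    obtain ⟨μ, hμ, hμA, hle⟩ := H A hA hAM hp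
    rw [newtonCap, if_neg hβ, capacity, ← div_eq_mul_inv]
    set p := hitProb P X a b A
    set inf := ⨅ (μ : Measure (EuclideanSpace ℝ (Fin d))) (_ : IsProbabilityMeasure μ)
      (_ : μ Aᶜ = 0), energy (newtonKernel M ((d : ℝ) - N / α)) μ
    have h1 : p * inf ≤ ENNReal.ofReal L := by
      refine le_trans ?_ hle
      gcongr
      exact iInf_le_of_le μ (iInf_le_of_le hμ (iInf_le _ hμA))
    have hL0 : ENNReal.ofReal L ≠ 0 := by simpa using hL
    exact (ENNReal.le_div_iff_mul_le (Or.inr hL0) (Or.inr ENNReal.ofReal_ne_top)).2 h1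

end GaussianHitting

theorem theorem3p1 {Ω : Type*} [mΩ : MeasurableSpace Ω] (P : Measure Ω) [IsProbabilityMeasure P]
    [P.IsComplete] {N d : ℕ} (hd : 0 < d)
    (X : GaussianHitting.Param N → Ω → EuclideanSpace ℝ (Fin d))
    (σ : GaussianHitting.Param N → GaussianHitting.Param N → ℝ)
    (hX : GaussianHitting.IsCenteredGaussianField P X σ)
    (α γ : ℝ) (hα0 : 0 < α) (hα1 : α < 1) (hγ : α ≤ γ) (hN : 2 ≤ (N : ℝ) / α)
    (hA1 : GaussianHitting.HypA1 σ α γ) :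
    (∀ a b : ℝ≥0, 0 < a → a < b → ∀ M : ℝ, 0 < M →
      ∃ K₁ : ℝ≥0, 0 < K₁ ∧
        ∀ A : Set (EuclideanSpace ℝ (Fin d)), IsCompact A → A.Nonempty → A ⊆ Metric.ball 0 M →
          (K₁ : ℝ≥0∞) * GaussianHitting.newtonCap M ((d : ℝ) - (N : ℝ) / α) A
            ≤ GaussianHitting.hitProb P X a b A) ∧
    (∀ 𝓕 : Filtration (GaussianHitting.Param N) mΩ,
      GaussianHitting.IsCommutingFiltration P 𝓕 → Adapted 𝓕 X →
      GaussianHitting.IsGaussianFiltration P X 𝓕 → GaussianHitting.HypA2 P X 𝓕 α γ →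
      ∀ a b : ℝ≥0, 0 < a → a < b → ∀ M : ℝ, 0 < M →
        ∃ K₂ : ℝ≥0, 0 < K₂ ∧
          ∀ A : Set (EuclideanSpace ℝ (Fin d)), IsCompact A → A ⊆ Metric.ball 0 M →
            GaussianHitting.hitProb P X a b A
              ≤ (K₂ : ℝ≥0∞) * GaussianHitting.newtonCap M ((d : ℝ) - (N : ℝ) / α) A) := by
  have hN0 : 0 < N := by
    refine Nat.pos_of_ne_zero fun h => ?_
    rw [h] at hN
    norm_num at hN
  refine ⟨fun a b ha hab M hM =>
    GaussianHitting.exists_mul_newtonCap_le_hitProb hX hN0 hd hα0 hγ hA1 ha hab hM,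
    fun 𝓕 h𝓕 had hG hA2 a b ha hab M hM =>
    GaussianHitting.exists_hitProb_le_mul_newtonCap hX h𝓕 had hG hα0 hα1 hγ hA1 hA2 hN0 hd ha hab
      hM⟩
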